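/- Let $n,p\ge 1$ and $m_i,p_i\ge 1$ ($i=1,\dots,n$) be integers, let $x_{i,k}\in\mathbb{R}^p$ ($1\le i\le n$, $1\le k\le p_i$), $\mu\in\mathbb{R}^p$, and let $\Psi$ be a symmetric positive definite $p\times p$ matrix. Put $\lambda(\xi)=\{\xi+\sqrt{\xi^2+4}\}/2$ for $\xi\in\mathbb{R}$, $\beta_{i,k}=x_{i,k}^\top\beta$ and $\Lambda_i=\sum_{k=1}^{p_i}\lambda(\beta_{i,k})$ for $\beta\in\mathbb{R}^p$. Consider the model with prior $\beta\sim \mathrm{N}_p(\mu,\Psi^{-1})$ in which, given $\beta$, the count vectors $y_i=(y_{i,k})_{k=0}^{p_i}$ are independent and multinomial with total $m_i$ and cell probabilities $1/(1+\Lambda_i)$ for $k=0$ and $\lambda(\beta_{i,k})/(1+\Lambda_i)$ for $k=1,\dots,p_i$. Fix observed counts $y_{i,k}\in\{0,1,2,\dots\}$ with $\sum_{k=0}^{p_i}y_{i,k}=m_i$. Let $\mathrm{Ga}(a,b)$ be the gamma distribution with shape $a$ and rate $b$, and let $\mathrm{IGauss}(\nu,1)$ be the inverse Gaussian distribution with density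 proportional to $v^{-3/2}\exp\{-\frac12(v/\nu^2+1/v)\}$, $v>0$. Consider the Markov chain on $\mathbb{R}^p$ in which one step from $\beta$ is as follows: 1. sample independently $u_{i,0}\sim \mathrm{Ga}(m_i,\,2+2\Lambda_i)$ for all $i$ and $u_{i,k}\sim \mathrm{Ga}\big(y_{i,k},\,-\beta_{i,k}+\sqrt{\beta_{i,k}^2+4}\big)$ for all $i$ and $k=1,\dots,p_i$; 2. given $u$ and $\beta$, sample independently $v_{i,k}\sim \mathrm{IGauss}\big(1/\{(u_{i,k}+u_{i,0})\sqrt{\beta_{i,k}^2+4}\},\,1\big)$ for all $i$ and $k=1,\dots,p_i$; 3. given $u$ and $v$, sample the new $\beta$ from $\mathrm{N}_p\big(\widehat\Psi^{-1}\{\Psi\mu+\sum_{i=1}^n\sum_{k=1}^{p_i}x_{i,k}(u_{i,k}-u_{i,0})\},\ \widehat\Psi^{-1}\big)$, where $\widehat\Psi=\Psi+\sum_{i=1}^n\sum_{k=1}^{p_i}v_{i,k}(u_{i,k}+u_{i,0})^2\,x_{i,k}x_{i,k}^\top$. Suppose that $\sum_{i=1}^n\sum_{k=1}^{p_i}x_{i,k}x_{i,k}^\top$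 is positive definite and that $y_{i,k}\ge 1$ for all $k=1,\dots,p_i$ and all $i=1,\dots,n$. Then this Markov chain is geometrically ergodic: the posterior distribution $\pi$ of $\beta$ given the counts is an invariant distribution of the chain, and there are $t\in(0,1)$ and a function $M\colon\mathbb{R}^p\to[0,\infty)$ such that $\|P^N(\beta,\cdot)-\pi\|_{\mathrm{TV}}\le M(\beta)\,t^N$ for all $\beta\in\mathbb{R}^p$ and all integers $N\ge 0$, where $P$ is the transition kernel of the chain and $\|\cdot\|_{\mathrm{TV}}$ is the total variation distance (the supremum over measurable sets). -/

import Mathlib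

open MeasureTheory ProbabilityTheory
open scoped ENNReal Nat Matrix

/-! ### Geometric ergodicity -/

/-- The total variation distance `sup_A |μ(A) - ν(A)|` (over measurable sets `A`) between two
finite measures. -/
noncomputable def tvDist {α : Type*} [MeasurableSpace α] (μ ν : Measure α) : ℝ :=
  ⨆ A : {A : Set α // MeasurableSet A}, |μ.real A - ν.real A|

/-- The Markov chain with transition kernel `κ` is geometrically ergodic with limit `π`:
`π` is an invariant probability measure and, for a rate `0 < t < 1` and a finite function `M`
of the starting point, the law of the chain after `N` steps is within `M a * t ^ N` of `π` in
total variation, from every starting point `a`. (`κ ^ N` is the `N`-fold composition of `κ`.) -/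
def IsGeometricallyErgodic {α : Type*} [MeasurableSpace α] (κ : Kernel α α) (π : Measure α) :
    Prop :=
  IsMarkovKernel κ ∧ IsProbabilityMeasure π ∧ Kernel.Invariant κ π ∧
    ∃ (M : α → ℝ) (t : ℝ), 0 < t ∧ t < 1 ∧ ∀ (a : α) (N : ℕ), tvDist ((κ ^ N) a) π ≤ M a * t ^ N

namespace MultinomialGibbs

/-! ### Densities -/

/-- Density at `b` of the `p`-variate normal distribution with mean `μ` and precision matrix
(inverse covariance matrix) `Q`. -/
noncomputable def normalPDF {p : ℕ} (μ : Fin p → ℝ) (Q : Matrix (Fin p) (Fin p) ℝ)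
    (b : Fin p → ℝ) : ℝ :=
  √(Q.det / (2 * Real.pi) ^ p) * Real.exp (-(1 / 2) * ((b - μ) ⬝ᵥ (Q *ᵥ (b - μ))))

/-- Density at `v` of the inverse Gaussian distribution with parameters `μ, l > 0`. -/
noncomputable def invGaussPDF (μ l v : ℝ) : ℝ :=
  if 0 < v then
    √(l / (2 * Real.pi)) * Real.exp (l / μ) * (1 / v ^ (3 / 2 : ℝ)) *
      Real.exp (-(1 / 2) * (l / μ ^ 2 * v + l / v))
  else 0

/-! ### The model -/

/-- The link function `ξ ↦ (ξ + √(ξ² + 4)) / 2`. -/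
noncomputable def link (ξ : ℝ) : ℝ := (ξ + √(ξ ^ 2 + 4)) / 2

/-- The linear predictor `β_{i,k} = x_{i,k}ᵀ β`. -/
def linPred {n p : ℕ} {q : Fin n → ℕ} (x : (i : Fin n) → Fin (q i) → Fin p → ℝ)
    (b : Fin p → ℝ) (i : Fin n) (k : Fin (q i)) : ℝ := x i k ⬝ᵥ b

/-- `Λ_i = ∑_k λ(β_{i,k})`. -/
noncomputable def linkSum {n p : ℕ} {q : Fin n → ℕ} (x : (i : Fin n) → Fin (q i) → Fin p → ℝ)
    (b : Fin p → ℝ) (i : Fin n) : ℝ := ∑ k, link (linPred x b i k)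

/-- The likelihood: the product over `i` of the multinomial probabilities of the counts
`y i 0, …, y i (q i)` (of total `m i`), where category `0` is the baseline, of probability
`1 / (1 + Λ_i)`, and category `k + 1` has probability `λ(β_{i,k}) / (1 + Λ_i)`
(`k : Fin (q i)`). -/
noncomputable def likelihood {n p : ℕ} {q : Fin n → ℕ} (m : Fin n → ℕ)
    (y : (i : Fin n) → Fin (q i + 1) → ℕ) (x : (i : Fin n) → Fin (q i) → Fin p → ℝ)
    (b : Fin p → ℝ) : ℝ :=
  ∏ i, (((m i)! : ℝ) / (∏ k, ((y i k)! : ℝ)) * (1 / (1 + linkSum x b i) ^ (y i 0)) *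
    ∏ k : Fin (q i), (link (linPred x b i k) / (1 + linkSum x b i)) ^ (y i k.succ))

/-- The prior `N_p(μ, Ψ⁻¹)`. -/
noncomputable def prior {p : ℕ} (μ : Fin p → ℝ) (Ψ : Matrix (Fin p) (Fin p) ℝ) :
    Measure (Fin p → ℝ) :=
  volume.withDensity fun b => ENNReal.ofReal (normalPDF μ Ψ b)

/-- The posterior distribution of `β` given the counts: the normalized product of the prior and
the likelihood. -/
noncomputable def posterior {n p : ℕ} {q : Fin n → ℕ} (m : Fin n → ℕ)
    (y : (i : Fin n) → Fin (q i + 1) → ℕ) (x : (i : Fin n) → Fin (q i) → Fin p → ℝ)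
    (μ : Fin p → ℝ) (Ψ : Matrix (Fin p) (Fin p) ℝ) : Measure (Fin p → ℝ) :=
  (∫⁻ b, ENNReal.ofReal (likelihood m y x b) ∂(prior μ Ψ))⁻¹ •
    (prior μ Ψ).withDensity fun b => ENNReal.ofReal (likelihood m y x b)

/-! ### The Gibbs sampler -/

/-- The gamma latent variables: `u i 0` is `u_{i,0}` and `u i k.succ` goes with `x i k`. -/
abbrev LatentU {n : ℕ} (q : Fin n → ℕ) : Type := (i : Fin n) → Fin (q i + 1) → ℝ

/-- The inverse Gaussian latent variables. -/
abbrev LatentV {n : ℕ} (q : Fin n → ℕ) : Type := (i : Fin n) → Fin (q i) → ℝ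

/-- The density `p(u | β, y)`; `gammaPDFReal a r` is the gamma density of shape `a` and
rate `r`. -/
noncomputable def uDensity {n p : ℕ} {q : Fin n → ℕ} (m : Fin n → ℕ)
    (y : (i : Fin n) → Fin (q i + 1) → ℕ) (x : (i : Fin n) → Fin (q i) → Fin p → ℝ)
    (b : Fin p → ℝ) (u : LatentU q) : ℝ :=
  ∏ i, (gammaPDFReal (m i) (2 + 2 * linkSum x b i) (u i 0) *
    ∏ k : Fin (q i), gammaPDFReal (y i k.succ)
      (-linPred x b i k + √(linPred x b i k ^ 2 + 4)) (u i k.succ))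

/-- The density `p(v | u, β, y)`. -/
noncomputable def vDensity {n p : ℕ} {q : Fin n → ℕ}
    (x : (i : Fin n) → Fin (q i) → Fin p → ℝ)
    (b : Fin p → ℝ) (u : LatentU q) (v : LatentV q) : ℝ :=
  ∏ i, ∏ k : Fin (q i),
    invGaussPDF (1 / ((u i k.succ + u i 0) * √(linPred x b i k ^ 2 + 4))) 1 (v i k)

/-- The precision matrix `Ψ + ∑_{i,k} v_{i,k} (u_{i,k} + u_{i,0})² x_{i,k} x_{i,k}ᵀ`. -/
noncomputable def postPrecision {n p : ℕ} {q : Fin n → ℕ}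
    (x : (i : Fin n) → Fin (q i) → Fin p → ℝ) (Ψ : Matrix (Fin p) (Fin p) ℝ)
    (u : LatentU q) (v : LatentV q) : Matrix (Fin p) (Fin p) ℝ :=
  Ψ + ∑ i, ∑ k : Fin (q i),
    (v i k * (u i k.succ + u i 0) ^ 2) • Matrix.vecMulVec (x i k) (x i k)

/-- The mean `Ψ̂⁻¹ (Ψ μ + ∑_{i,k} (u_{i,k} - u_{i,0}) x_{i,k})`, with `Ψ̂` the matrix
`postPrecision`. -/
noncomputable def postMean {n p : ℕ} {q : Fin n → ℕ}
    (x : (i : Fin n) → Fin (q i) → Fin p → ℝ) (μ : Fin p → ℝ) (Ψ : Matrix (Fin p) (Fin p) ℝ)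
    (u : LatentU q) (v : LatentV q) : Fin p → ℝ :=
  (postPrecision x Ψ u v)⁻¹ *ᵥ
    (Ψ *ᵥ μ + ∑ i, ∑ k : Fin (q i), (u i k.succ - u i 0) • x i k)

/-- The density `p(β | v, u, y)`. -/
noncomputable def bDensity {n p : ℕ} {q : Fin n → ℕ}
    (x : (i : Fin n) → Fin (q i) → Fin p → ℝ) (μ : Fin p → ℝ) (Ψ : Matrix (Fin p) (Fin p) ℝ)
    (u : LatentU q) (v : LatentV q) (b : Fin p → ℝ) : ℝ :=
  normalPDF (postMean x μ Ψ u v) (postPrecision x Ψ u v) b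

/-- Sampling `u` given `β`. -/
noncomputable def uKernel {n p : ℕ} {q : Fin n → ℕ} (m : Fin n → ℕ)
    (y : (i : Fin n) → Fin (q i + 1) → ℕ) (x : (i : Fin n) → Fin (q i) → Fin p → ℝ) :
    Kernel (Fin p → ℝ) (LatentU q) :=
  (Kernel.const _ volume).withDensity fun b u => ENNReal.ofReal (uDensity m y x b u)

/-- Sampling `v` given `(β, u)`. -/
noncomputable def vKernel {n p : ℕ} {q : Fin n → ℕ}
    (x : (i : Fin n) → Fin (q i) → Fin p → ℝ) :
    Kernel ((Fin p → ℝ) × LatentU q) (LatentV q) :=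
  (Kernel.const _ volume).withDensity fun bu v => ENNReal.ofReal (vDensity x bu.1 bu.2 v)

/-- Sampling `β` given `(u, v)`. -/
noncomputable def bKernel {n p : ℕ} {q : Fin n → ℕ}
    (x : (i : Fin n) → Fin (q i) → Fin p → ℝ) (μ : Fin p → ℝ) (Ψ : Matrix (Fin p) (Fin p) ℝ) :
    Kernel (LatentU q × LatentV q) (Fin p → ℝ) :=
  (Kernel.const _ volume).withDensity fun uv b => ENNReal.ofReal (bDensity x μ Ψ uv.1 uv.2 b)

/-- The transition kernel of the Gibbs chain `β ↦ β'`: given `β`, sample `u`, then `v` given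
`(β, u)`, then the new `β'` given `(u, v)`. -/
noncomputable def gibbsKernel {n p : ℕ} {q : Fin n → ℕ} (m : Fin n → ℕ)
    (y : (i : Fin n) → Fin (q i + 1) → ℕ) (x : (i : Fin n) → Fin (q i) → Fin p → ℝ)
    (μ : Fin p → ℝ) (Ψ : Matrix (Fin p) (Fin p) ℝ) : Kernel (Fin p → ℝ) (Fin p → ℝ) :=
  bKernel x μ Ψ ∘ₖ (uKernel m y x ⊗ₖ vKernel x)

/-! ### The densities are measurable and the kernels s-finite

So `Kernel.withDensity` and `⊗ₖ` above never take their default values. -/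

lemma measurable_linPred {n p : ℕ} {q : Fin n → ℕ}
    (x : (i : Fin n) → Fin (q i) → Fin p → ℝ) (i : Fin n) (k : Fin (q i)) :
    Measurable fun b => linPred x b i k := by
  unfold linPred dotProduct
  fun_prop

lemma measurable_linkSum {n p : ℕ} {q : Fin n → ℕ}
    (x : (i : Fin n) → Fin (q i) → Fin p → ℝ) (i : Fin n) :
    Measurable fun b => linkSum x b i := by
  unfold linkSum link
  have := measurable_linPred x i
  fun_prop

lemma measurable_likelihood {n p : ℕ} {q : Fin n → ℕ} (m : Fin n → ℕ)
    (y : (i : Fin n) → Fin (q i + 1) → ℕ) (x : (i : Fin n) → Fin (q i) → Fin p → ℝ) :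
    Measurable (likelihood m y x) := by
  unfold likelihood link
  have := measurable_linPred x
  have := measurable_linkSum x
  fun_prop

lemma measurable_gamma {α : Type*} [MeasurableSpace α] (a : ℝ) {f g : α → ℝ}
    (hf : Measurable f) (hg : Measurable g) :
    Measurable fun z => gammaPDFReal a (f z) (g z) := by
  unfold gammaPDFReal
  exact Measurable.ite (measurableSet_le measurable_const hg) (by fun_prop) (by fun_prop)

lemma measurable_invGauss {α : Type*} [MeasurableSpace α] (l : ℝ) {f g : α → ℝ}
    (hf : Measurable f) (hg : Measurable g) :
    Measurable fun z => invGaussPDF (f z) l (g z) := by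
  unfold invGaussPDF
  exact Measurable.ite (measurableSet_lt measurable_const hg) (by fun_prop) (by fun_prop)

lemma measurable_uDensity {n p : ℕ} {q : Fin n → ℕ} (m : Fin n → ℕ)
    (y : (i : Fin n) → Fin (q i + 1) → ℕ) (x : (i : Fin n) → Fin (q i) → Fin p → ℝ) :
    Measurable (Function.uncurry (uDensity m y x)) := by
  unfold uDensity Function.uncurry
  have h1 := measurable_linPred x
  have h2 := measurable_linkSum x
  refine Finset.measurable_fun_prod _ fun i _ => (measurable_gamma _ ?_ ?_).mul
    (Finset.measurable_fun_prod _ fun k _ => measurable_gamma _ ?_ ?_) <;> fun_prop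

lemma measurable_vDensity {n p : ℕ} {q : Fin n → ℕ}
    (x : (i : Fin n) → Fin (q i) → Fin p → ℝ) :
    Measurable (Function.uncurry fun bu : (Fin p → ℝ) × LatentU q => vDensity x bu.1 bu.2) := by
  unfold vDensity Function.uncurry
  have h1 := measurable_linPred x
  refine Finset.measurable_fun_prod _ fun i _ =>
    Finset.measurable_fun_prod _ fun k _ => measurable_invGauss _ ?_ ?_ <;> fun_prop

lemma measurable_postPrecision {n p : ℕ} {q : Fin n → ℕ}
    (x : (i : Fin n) → Fin (q i) → Fin p → ℝ) (Ψ : Matrix (Fin p) (Fin p) ℝ) (r s : Fin p) :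
    Measurable fun uv : LatentU q × LatentV q => postPrecision x Ψ uv.1 uv.2 r s := by
  simp only [postPrecision, Matrix.add_apply, Matrix.sum_apply, Matrix.smul_apply, smul_eq_mul]
  fun_prop

lemma measurable_det {α : Type*} [MeasurableSpace α] {p : ℕ}
    {Q : α → Matrix (Fin p) (Fin p) ℝ} (hQ : ∀ r s, Measurable fun z => Q z r s) :
    Measurable fun z => (Q z).det := by
  simp only [Matrix.det_apply]
  fun_prop

lemma measurable_inv_entry {α : Type*} [MeasurableSpace α] {p : ℕ}
    {Q : α → Matrix (Fin p) (Fin p) ℝ} (hQ : ∀ r s, Measurable fun z => Q z r s) (r s : Fin p) :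
    Measurable fun z => (Q z)⁻¹ r s := by
  simp only [Matrix.inv_def, Matrix.smul_apply, Ring.inverse_eq_inv', Matrix.adjugate_apply,
    smul_eq_mul]
  refine (measurable_det hQ).inv.mul (measurable_det fun a c => ?_)
  by_cases h : a = s
  · subst h
    simp
  · simpa [Matrix.updateRow_ne h] using hQ a c

lemma measurable_bDensity {n p : ℕ} {q : Fin n → ℕ}
    (x : (i : Fin n) → Fin (q i) → Fin p → ℝ) (μ : Fin p → ℝ)
    (Ψ : Matrix (Fin p) (Fin p) ℝ) :
    Measurable (Function.uncurry fun uv : LatentU q × LatentV q =>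
      bDensity x μ Ψ uv.1 uv.2) := by
  have h1 := measurable_postPrecision x Ψ
  have h2 := measurable_det h1
  have h3 := measurable_inv_entry h1
  have h4 : ∀ r, Measurable fun uv : LatentU q × LatentV q => postMean x μ Ψ uv.1 uv.2 r := by
    intro r
    simp only [postMean, Matrix.mulVec, dotProduct, Pi.add_apply, Finset.sum_apply,
      Pi.smul_apply, smul_eq_mul]
    refine Finset.measurable_fun_sum _ fun s _ => (h3 r s).mul (measurable_const.add ?_)
    fun_prop
  have h5 : ∀ r, Measurable fun z : (LatentU q × LatentV q) × (Fin p → ℝ) =>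
      z.2 r - postMean x μ Ψ z.1.1 z.1.2 r := fun r =>
    ((measurable_pi_apply r).comp measurable_snd).sub ((h4 r).comp measurable_fst)
  simp only [bDensity, normalPDF, Function.uncurry_def, Matrix.mulVec, dotProduct, Pi.sub_apply]
  refine ((h2.comp measurable_fst).div_const _).sqrt.mul
    (Real.measurable_exp.comp (measurable_const.mul ?_))
  exact Finset.measurable_fun_sum _ fun r _ => (h5 r).mul
    (Finset.measurable_fun_sum _ fun s _ => ((h1 r s).comp measurable_fst).mul (h5 s))

instance {n p : ℕ} {q : Fin n → ℕ} (m : Fin n → ℕ)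
    (y : (i : Fin n) → Fin (q i + 1) → ℕ) (x : (i : Fin n) → Fin (q i) → Fin p → ℝ) :
    IsSFiniteKernel (uKernel m y x) :=
  Kernel.IsSFiniteKernel.withDensity _ fun _ _ => ENNReal.ofReal_ne_top

instance {n p : ℕ} {q : Fin n → ℕ} (x : (i : Fin n) → Fin (q i) → Fin p → ℝ) :
    IsSFiniteKernel (vKernel x) :=
  Kernel.IsSFiniteKernel.withDensity _ fun _ _ => ENNReal.ofReal_ne_top

instance {n p : ℕ} {q : Fin n → ℕ} (x : (i : Fin n) → Fin (q i) → Fin p → ℝ)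
    (μ : Fin p → ℝ) (Ψ : Matrix (Fin p) (Fin p) ℝ) : IsSFiniteKernel (bKernel x μ Ψ) :=
  Kernel.IsSFiniteKernel.withDensity _ fun _ _ => ENNReal.ofReal_ne_top

end MultinomialGibbs

/-! The proof is Harris' theorem applied with the drift function V(β) = (β - μ)ᵀ Ψ (β - μ).

Invariance. Multiply prior, likelihood, `uDensity` and `vDensity`. The gamma normalizers cancel the
powers of the link function and, since the counts add up to the total, those of 1 + Λ. The inverse
Gaussian exponent replaces the square roots √(β_{i,k}² + 4) by terms polynomial in β_{i,k} and a
multiple of λ(β_{i,k}), which the baseline gamma variable cancels. What remains in the exponent is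
quadratic in β, so the conditional law of β is the normal law of the third sampling step
(`exists_joint_eq_mul_bDensity`). Integrating the latent variables out returns prior times
likelihood, and Tonelli gives `invariant_gibbsKernel_posterior`.

Drift. The precision of the new β dominates Ψ, so its fluctuation about the conditional mean adds at
most a constant to V. The conditional mean minimizes V(z) plus a weighted sum of squared residuals,
hence V there is at most the objective at any trial point (`quad_postMean_sub_le`). Take the trial
point μ + t(β - μ). The first term is t² V(β). The expected residuals, averaged over v and then u,
are bounded up to a multiple of (1 - t)² V(β): the v-average rests on the mean of v and on the
chi-square-type variable (a√v - 1/√v)² (`lintegral_vKernel_objective_le`), and the u-average on the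
gamma means compensating the coefficients √(β_{i,k}² + 4) ∓ β_{i,k}
(`lintegral_uKernel_category_le`). So V is multiplied by t² + (1 - t)² A, which is below 1 for t = A
/ (1 + A).

Minorization. Sublevel sets of V are compact. On a compact set of β the density of (u, v) is bounded
below on a fixed cube, and the law of the new β given (u, v) does not involve the old β
(`exists_minorization_gibbsKernel`). -/

/-! ### Harris' theorem by contraction of weighted oscillations -/

section Harris

/-- A function whose oscillation is controlled by a weight is, up to an additive constant, bounded
by that weight. -/
lemma exists_abs_add_le_of_oscillation_le {α : Type*} {f W : α → ℝ} {B : ℝ} (hB : ∀ a, |f a| ≤ B)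
    (hW : ∀ a, 0 ≤ W a) (h : ∀ a b, |f a - f b| ≤ W a + W b) :
    ∃ c, ∀ a, |f a + c| ≤ W a := by
  have hbdd : BddBelow (Set.range fun a => W a - f a) := by
    refine ⟨-B, ?_⟩
    rintro _ ⟨a, rfl⟩
    have h1 := (abs_le.1 (hB a)).2
    have h2 := hW a
    show -B ≤ W a - f a
    linarith
  refine ⟨⨅ a, (W a - f a), fun a => ?_⟩
  have : Nonempty α := ⟨a⟩
  have h1 : ⨅ b, (W b - f b) ≤ W a - f a := ciInf_le hbdd a
  have h2 : -W a - f a ≤ ⨅ b, (W b - f b) := le_ciInf fun b => by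
    have := (abs_le.1 (h a b)).1
    have := (abs_le.1 (h b a)).2
    linarith
  rw [abs_le]
  constructor <;> linarith

variable {α : Type*} [MeasurableSpace α]

/-- Integrals of a function dominated by `W` against two measures that share a common part. -/
lemma integral_sub_integral_le_of_le {μ₁ μ₂ ν : Measure α} [IsFiniteMeasure μ₁]
    [IsFiniteMeasure μ₂] {g W : α → ℝ} (h₁ : ν ≤ μ₁) (h₂ : ν ≤ μ₂)
    (hg₁ : Integrable g μ₁) (hg₂ : Integrable g μ₂) (hW₁ : Integrable W μ₁)
    (hW₂ : Integrable W μ₂) (hgW : ∀ a, |g a| ≤ W a) :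
    ∫ a, g a ∂μ₁ - ∫ a, g a ∂μ₂ ≤ ∫ a, W a ∂μ₁ + ∫ a, W a ∂μ₂ - 2 * ∫ a, W a ∂ν := by
  have hgν := hg₁.mono_measure h₁
  have hWν := hW₁.mono_measure h₁
  -- Both W - g and W + g are nonnegative, so their integrals only grow from ν to μ₁ and μ₂. In the
  -- sum of the two inequalities the integral of g against ν cancels.
  have e1 : ∫ a, (W a - g a) ∂ν ≤ ∫ a, (W a - g a) ∂μ₁ :=
    integral_mono_measure h₁ (ae_of_all _ fun a => sub_nonneg.2 (abs_le.1 (hgW a)).2)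
      (hW₁.sub hg₁)
  have e2 : ∫ a, (W a + g a) ∂ν ≤ ∫ a, (W a + g a) ∂μ₂ :=
    integral_mono_measure h₂ (ae_of_all _ fun a => by
      have := (abs_le.1 (hgW a)).1
      show 0 ≤ W a + g a
      linarith) (hW₂.add hg₂)
  rw [integral_sub hWν hgν, integral_sub hW₁ hg₁] at e1
  rw [integral_add hWν hgν, integral_add hW₂ hg₂] at e2
  linarith

/-- The weighted contraction estimate of Hairer and Mattingly: a kernel with a drift condition
contracts oscillations measured by the weight `1 + δ V`. -/
lemma exists_contraction_of_drift (κ : Kernel α α) [IsMarkovKernel κ]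
    {V : α → ℝ} (hV0 : ∀ a, 0 ≤ V a) {γ K : ℝ} (hγ0 : 0 ≤ γ) (hγ : γ < 1)
    (hK : 0 ≤ K) (hVi : ∀ a, Integrable V (κ a)) (hdrift : ∀ a, ∫ b, V b ∂κ a ≤ γ * V a + K)
    (hminor : ∀ R : ℝ, ∃ ν : Measure α, ν ≠ 0 ∧ ∀ a, V a ≤ R → ν ≤ κ a) :
    ∃ δ t : ℝ, 0 < δ ∧ 0 < t ∧ t < 1 ∧ ∀ (f : α → ℝ) (B L : ℝ), Measurable f → 0 ≤ L →
      (∀ a, |f a| ≤ B) → (∀ a b, |f a - f b| ≤ L * ((1 + δ * V a) + (1 + δ * V b))) →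
      ∀ a b, |∫ c, f c ∂κ a - ∫ c, f c ∂κ b| ≤ t * L * ((1 + δ * V a) + (1 + δ * V b)) := by
  -- Beyond R the drift gain (1 - γ)(V a + V b) exceeds 4K + 2, more than the loss 2K, with room for
  -- strict contraction.
  set R : ℝ := (4 * K + 2) / (1 - γ) with hR
  have hγ' : 0 < 1 - γ := by linarith
  obtain ⟨ν, hν0, hν⟩ := hminor R
  set ε : ℝ := min 1 (ν.real Set.univ) with hε
  -- One estimate for both regimes: ν' is the minorizing measure when V a + V b ≤ R, and 0 when the
  -- drift alone must contract.
  have key : ∀ δ : ℝ, 0 < δ → ∀ (f : α → ℝ) (B L : ℝ), Measurable f → 0 ≤ L →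
      (∀ a, |f a| ≤ B) → (∀ a b, |f a - f b| ≤ L * ((1 + δ * V a) + (1 + δ * V b))) →
      ∀ (ν' : Measure α) (a b : α), ν' ≤ κ a → ν' ≤ κ b →
      ∫ c, f c ∂κ a - ∫ c, f c ∂κ b ≤
        L * (2 + δ * γ * (V a + V b) + 2 * δ * K - 2 * ν'.real Set.univ) := by
    intro δ hδ f B L hf hL hB hosc ν' a b ha hb
    obtain ⟨c, hc⟩ := exists_abs_add_le_of_oscillation_le (W := fun a => L * (1 + δ * V a)) hB
      (fun a => mul_nonneg hL (by have := mul_nonneg hδ.le (hV0 a); linarith))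
      (fun a b => (hosc a b).trans_eq (by ring))
    have hfi : ∀ a, Integrable f (κ a) := fun a =>
      Integrable.of_bound hf.aestronglyMeasurable B (ae_of_all _ hB)
    have hWi : ∀ a, Integrable (fun b => L * (1 + δ * V b)) (κ a) := fun a =>
      ((integrable_const 1).add ((hVi a).const_mul δ)).const_mul L
    have hi : ∀ a, ∫ b, (f b + c) ∂κ a = ∫ b, f b ∂κ a + c := fun a => by
      rw [integral_add (hfi a) (integrable_const c)]; simp
    have hW : ∀ a, ∫ b, L * (1 + δ * V b) ∂κ a ≤ L * (1 + δ * (γ * V a + K)) := fun a => by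
      rw [integral_const_mul, integral_add (integrable_const 1) ((hVi a).const_mul δ),
        integral_const_mul]
      simp only [integral_const, probReal_univ, smul_eq_mul, mul_one]
      gcongr
      exact hdrift a
    have hfin : IsFiniteMeasure ν' := isFiniteMeasure_of_le _ ha
    have hWν : L * ν'.real Set.univ ≤ ∫ b, L * (1 + δ * V b) ∂ν' := by
      have : ∫ b, L ∂ν' ≤ ∫ b, L * (1 + δ * V b) ∂ν' :=
        integral_mono (integrable_const L) ((hWi a).mono_measure ha) fun b => by
          have := mul_nonneg hL (mul_nonneg hδ.le (hV0 b))
          show L ≤ L * (1 + δ * V b)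
          linarith
      simpa [mul_comm] using this
    have := integral_sub_integral_le_of_le ha hb ((hfi a).add (integrable_const c))
      ((hfi b).add (integrable_const c)) (hWi a) (hWi b) hc
    simp only [Pi.add_apply] at this
    rw [hi a, hi b] at this
    have h1 := hW a
    have h2 := hW b
    nlinarith
  have hR0 : 0 ≤ R := div_nonneg (by linarith) hγ'.le
  -- If the sublevel set is empty, the minorization says nothing about ν, not even finiteness. Then
  -- every point lies beyond R and the drift alone contracts.
  by_cases hne : ∃ a, V a ≤ R
  swap
  · push Not at hne
    refine ⟨1, max ((1 + γ) / 2) (3 / 4), one_pos, by positivity, ?_, ?_⟩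
    · simp only [max_lt_iff]; constructor <;> linarith
    intro f B L hf hL hB hosc
    have h2 : ∀ a b, ∫ c, f c ∂κ a - ∫ c, f c ∂κ b ≤
        max ((1 + γ) / 2) (3 / 4) * L * ((1 + 1 * V a) + (1 + 1 * V b)) := by
      intro a b
      have h3 := key 1 one_pos f B L hf hL hB hosc 0 a b (Measure.zero_le _) (Measure.zero_le _)
      refine h3.trans ?_
      have ha := (hne a).le
      have hb := (hne b).le
      rw [hR, div_le_iff₀ hγ'] at ha hb
      have hs : (1 + γ) / 2 ≤ max ((1 + γ) / 2) (3 / 4) := le_max_left _ _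
      have h4 : 2 + 1 * γ * (V a + V b) + 2 * 1 * K - 2 * (0 : Measure α).real Set.univ ≤
          (1 + γ) / 2 * ((1 + 1 * V a) + (1 + 1 * V b)) := by
        simp
        nlinarith [hV0 a, hV0 b]
      calc _ ≤ L * ((1 + γ) / 2 * ((1 + 1 * V a) + (1 + 1 * V b))) := by gcongr
        _ ≤ L * (max ((1 + γ) / 2) (3 / 4) * ((1 + 1 * V a) + (1 + 1 * V b))) := by
            gcongr
            have := hV0 a; have := hV0 b
            linarith
        _ = _ := by ring
    intro a b
    rw [abs_le]
    have h3 := h2 a b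
    have h4 := h2 b a
    constructor <;> linarith
  obtain ⟨a₀, ha₀⟩ := hne
  have : IsFiniteMeasure ν := isFiniteMeasure_of_le _ (hν a₀ ha₀)
  have hε0 : 0 < ε := lt_min one_pos (by
    rw [measureReal_def, ENNReal.toReal_pos_iff]
    exact ⟨Measure.measure_univ_pos.2 hν0, measure_lt_top _ _⟩)
  have hε1 : ε ≤ 1 := min_le_left _ _
  -- The weight is small enough that the drift constant, entering as 2δK, uses up at most half of
  -- the gain 2ε from the common part.
  set δ : ℝ := ε / (2 * K + 1) with hδ
  have hδ0 : 0 < δ := by positivity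
  have hδK : 2 * δ * K ≤ ε := by
    rw [hδ]
    have : 2 * (ε / (2 * K + 1)) * K = ε * (2 * K / (2 * K + 1)) := by ring
    rw [this]
    have : 2 * K / (2 * K + 1) ≤ 1 := (div_le_one (by positivity)).2 (by linarith)
    nlinarith
  -- The entries serve, in order, the constant part near the center, the part growing with V, and
  -- the constant part 2 + δR beyond R.
  set t : ℝ := max (max (1 - ε / 2) ((1 + γ) / 2)) (1 - δ * K / (2 + δ * R) - δ / (2 + δ * R)
    ) with ht
  have h2R : 0 < 2 + δ * R := by positivity
  have htlt : t < 1 := by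
    rw [ht]
    simp only [max_lt_iff]
    refine ⟨⟨by linarith, by linarith⟩, ?_⟩
    have h1 : 0 ≤ δ * K / (2 + δ * R) := by positivity
    have h2 : 0 < δ / (2 + δ * R) := by positivity
    linarith
  have ht0 : 0 < t := lt_of_lt_of_le (by linarith : (0:ℝ) < 1 - ε / 2)
    ((le_max_left _ _).trans (le_max_left _ _))
  refine ⟨δ, t, hδ0, ht0, htlt, ?_⟩
  intro f B L hf hL hB hosc
  have h2 : ∀ a b, ∫ c, f c ∂κ a - ∫ c, f c ∂κ b ≤
        t * L * ((1 + δ * V a) + (1 + δ * V b)) := by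
    intro a b
    have hVa := hV0 a
    have hVb := hV0 b
    have hrw : t * L * ((1 + δ * V a) + (1 + δ * V b)) =
      L * (t * ((1 + δ * V a) + (1 + δ * V b))) := by ring
    rw [hrw]
    by_cases hab : V a + V b ≤ R
    · have h3 := key δ hδ0 f B L hf hL hB hosc ν a b (hν a (by linarith)) (hν b (by linarith))
      refine h3.trans (mul_le_mul_of_nonneg_left ?_ hL)
      have h4 : ε ≤ ν.real Set.univ := min_le_right _ _
      have h5 : 1 - ε / 2 ≤ t := (le_max_left _ _).trans (le_max_left _ _)
      have h6 : γ ≤ t := by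
        have : (1 + γ) / 2 ≤ t := (le_max_right _ _).trans (le_max_left _ _)
        linarith
      have h7 : δ * γ * (V a + V b) ≤ t * (δ * (V a + V b)) := by
        have : 0 ≤ δ * (V a + V b) := by positivity
        nlinarith
      nlinarith
    · have h3 := key δ hδ0 f B L hf hL hB hosc 0 a b (Measure.zero_le _) (Measure.zero_le _)
      refine h3.trans (mul_le_mul_of_nonneg_left ?_ hL)
      simp only [measureReal_zero_apply, mul_zero, sub_zero]
      push Not at hab
      set S := V a + V b with hS
      have h5 : 1 - δ * K / (2 + δ * R) - δ / (2 + δ * R) ≤ t := le_max_right _ _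
      have h6 : (1 + γ) / 2 ≤ t := (le_max_right _ _).trans (le_max_left _ _)
      have hRe : R * (1 - γ) = 4 * K + 2 := by rw [hR]; field_simp
      have e1 : (1 - δ * K / (2 + δ * R) - δ / (2 + δ * R)) * (2 + δ * R) =
          2 + δ * R - δ * K - δ := by
        field_simp
      have e2 : 2 + δ * R - δ * K - δ ≤ t * (2 + δ * R) := by
        rw [← e1]; exact mul_le_mul_of_nonneg_right h5 h2R.le
      have e3 : (1 + γ) / 2 * (δ * (S - R)) ≤ t * (δ * (S - R)) :=
        mul_le_mul_of_nonneg_right h6 (by apply mul_nonneg hδ0.le; linarith)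
      have e4 : (1 + δ * V a) + (1 + δ * V b) = (2 + δ * R) + δ * (S - R) := by rw [hS]; ring
      rw [e4, mul_add]
      have e5 : 0 ≤ (1 - γ) * (δ * (S - R)) :=
        mul_nonneg hγ'.le (mul_nonneg hδ0.le (by linarith))
      nlinarith
  intro a b
  rw [abs_le]
  have h3 := h2 a b
  have h4 := h2 b a
  constructor <;> linarith

/-- Harris' theorem: a drift condition and a minorization condition on the sublevel sets of the
drift function imply geometric ergodicity. -/
theorem isGeometricallyErgodic_of_drift_of_minorization (κ : Kernel α α) [IsMarkovKernel κ]
    (π : Measure α) [IsProbabilityMeasure π] (hinv : Kernel.Invariant κ π)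
    {V : α → ℝ} (hV : Measurable V) (hV0 : ∀ a, 0 ≤ V a)
    (hVπ : ∫⁻ a, ENNReal.ofReal (V a) ∂π ≠ ∞) {γ K : ℝ} (hγ0 : 0 ≤ γ) (hγ : γ < 1)
    (hK : 0 ≤ K)
    (hdrift : ∀ a, ∫⁻ b, ENNReal.ofReal (V b) ∂κ a ≤ ENNReal.ofReal (γ * V a + K))
    (hminor : ∀ R : ℝ, ∃ ν : Measure α, ν ≠ 0 ∧ ∀ a, V a ≤ R → ν ≤ κ a) :
    IsGeometricallyErgodic κ π := by
  have hVi : ∀ a, Integrable V (κ a) := fun a =>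
    (lintegral_ofReal_ne_top_iff_integrable hV.aestronglyMeasurable (ae_of_all _ hV0)).1
      (ne_top_of_le_ne_top ENNReal.ofReal_ne_top (hdrift a))
  have hVπi : Integrable V π :=
    (lintegral_ofReal_ne_top_iff_integrable hV.aestronglyMeasurable (ae_of_all _ hV0)).1 hVπ
  have hdrift' : ∀ a, ∫ b, V b ∂κ a ≤ γ * V a + K := fun a => by
    rw [integral_eq_lintegral_of_nonneg_ae (ae_of_all _ hV0) hV.aestronglyMeasurable]
    exact ENNReal.toReal_le_of_le_ofReal (by have := mul_nonneg hγ0 (hV0 a); linarith) (hdrift a)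
  obtain ⟨δ, t, hδ, ht0, ht1, hcontr⟩ :=
    exists_contraction_of_drift κ hV0 hγ0 hγ hK hVi hdrift' hminor
  have hpow : ∀ N : ℕ, IsMarkovKernel (κ ^ N) := by
    intro N
    induction N with
    | zero => rw [pow_zero]; exact inferInstanceAs (IsMarkovKernel Kernel.id)
    | succ N ih => rw [pow_succ]; exact Kernel.IsMarkovKernel.comp (κ ^ N) κ
  have hinvN : ∀ N : ℕ, Kernel.Invariant (κ ^ N) π := by
    intro N
    induction N with
    | zero => rw [pow_zero]; exact Measure.bind_dirac
    | succ N ih => rw [pow_succ]; exact Kernel.Invariant.comp ih hinv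
  have hmeas : ∀ (N : ℕ) (A : Set α), MeasurableSet A → Measurable fun a => ((κ ^ N) a).real A :=
    fun N A hA => (Kernel.measurable_coe _ hA).ennreal_toReal
  have hb : ∀ (N : ℕ) (A : Set α) (a : α), |((κ ^ N) a).real A| ≤ 1 := fun N A a => by
    rw [abs_of_nonneg measureReal_nonneg]; exact measureReal_le_one
  -- The contraction is iterated on the functions a ↦ κ^N(a, A). For N = 0 their oscillation is at
  -- most 1, which the weight dominates.
  have hosc : ∀ (A : Set α), MeasurableSet A → ∀ (N : ℕ) (a b : α),
      |((κ ^ N) a).real A - ((κ ^ N) b).real A| ≤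
        t ^ N * ((1 + δ * V a) + (1 + δ * V b)) := by
    intro A hA N
    induction N with
    | zero =>
      intro a b
      have h1 : 0 ≤ ((κ ^ 0) a).real A := measureReal_nonneg
      have h2 : ((κ ^ 0) a).real A ≤ 1 := measureReal_le_one
      have h3 : 0 ≤ ((κ ^ 0) b).real A := measureReal_nonneg
      have h4 : ((κ ^ 0) b).real A ≤ 1 := measureReal_le_one
      have h5 := mul_nonneg hδ.le (hV0 a)
      have h6 := mul_nonneg hδ.le (hV0 b)
      rw [abs_le]
      constructor <;> linarith
    | succ N ih =>
      intro a b
      have hrec : ∀ a, ((κ ^ (N + 1)) a).real A = ∫ c, ((κ ^ N) c).real A ∂κ a := by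
        intro a
        rw [measureReal_def, pow_succ, show κ ^ N * κ = (κ ^ N) ∘ₖ κ from rfl, Kernel.comp_apply' _ _ _ hA,
          ← integral_toReal (Kernel.measurable_coe _ hA).aemeasurable
            (ae_of_all _ fun c => measure_lt_top _ _)]
        rfl
      rw [hrec a, hrec b]
      refine (hcontr _ 1 (t ^ N) (hmeas N A hA) (by positivity) (hb N A) ih a b).trans_eq ?_
      ring
  refine ⟨inferInstance, inferInstance, hinv,
    fun a => (1 + δ * V a) + (1 + δ * ∫ b, V b ∂π), t, ht0, ht1, fun a N => ?_⟩
  unfold tvDist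
  have : Nonempty {A : Set α // MeasurableSet A} := ⟨⟨∅, MeasurableSet.empty⟩⟩
  refine ciSup_le fun ⟨A, hA⟩ => ?_
  -- By invariance the distance to π is an average over b of distances between the chains started at
  -- a and at b. This is where the integrability of V under π enters.
  have hπA : π.real A = ∫ b, ((κ ^ N) b).real A ∂π := by
    conv_lhs => rw [measureReal_def, ← (hinvN N).def]
    rw [Measure.bind_apply hA (Kernel.aemeasurable _),
      ← integral_toReal (Kernel.measurable_coe _ hA).aemeasurable
        (ae_of_all _ fun c => measure_lt_top _ _)]
    rfl
  have hint : Integrable (fun b => ((κ ^ N) b).real A) π :=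
    Integrable.of_bound (hmeas N A hA).aestronglyMeasurable 1 (ae_of_all _ (hb N A))
  have hsub : ((κ ^ N) a).real A - π.real A =
      ∫ b, (((κ ^ N) a).real A - ((κ ^ N) b).real A) ∂π := by
    rw [integral_sub (integrable_const _) hint, hπA]; simp
  show |((κ ^ N) a).real A - π.real A| ≤ _
  rw [hsub]
  refine (abs_integral_le_integral_abs).trans ?_
  have hWi : Integrable (fun b => t ^ N * ((1 + δ * V a) + (1 + δ * V b))) π :=
    ((integrable_const _).add ((integrable_const 1).add (hVπi.const_mul δ))).const_mul _
  refine (integral_mono ((integrable_const _).sub hint).abs hWi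
    fun b => hosc A hA N a b).trans_eq ?_
  have h1 : Integrable (fun b => 1 + δ * V b) π := (integrable_const 1).add (hVπi.const_mul δ)
  rw [integral_const_mul, integral_add (integrable_const _) h1,
    integral_add (integrable_const _) (hVπi.const_mul δ), integral_const_mul]
  simp
  ring

end Harris

/-! ### Finite products of measures with densities -/

section ProductMeasures

/-- Tonelli's theorem for a product of functions of the coordinates. -/
lemma lintegral_fin_prod_eq_prod {n : ℕ} {E : Fin n → Type*}
    {mE : ∀ i, MeasurableSpace (E i)} {μ : (i : Fin n) → Measure (E i)} [∀ i, SigmaFinite (μ i)]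
    {f : (i : Fin n) → E i → ℝ≥0∞} (hf : ∀ i, Measurable (f i)) :
    ∫⁻ x : (i : Fin n) → E i, ∏ i, f i (x i) ∂(Measure.pi μ) = ∏ i, ∫⁻ x, f i x ∂(μ i) := by
  induction n with
  | zero => simp
  | succ n ih =>
    have hmp := (measurePreserving_piFinSuccAbove μ 0).symm
    rw [← hmp.lintegral_comp_emb (MeasurableEquiv.measurableEmbedding _), Fin.prod_univ_succ,
      ← ih fun i => hf i.succ]
    have hg : Measurable fun y : (i : Fin n) → E i.succ => ∏ i, f i.succ (y i) :=
      Finset.measurable_fun_prod _ fun i _ => (hf i.succ).comp (measurable_pi_apply i)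
    rw [← lintegral_prod_mul (hf 0).aemeasurable hg.aemeasurable]
    refine lintegral_congr fun z => ?_
    rw [Fin.prod_univ_succ]
    rfl

/-- A product of measures with densities has the product density. -/
lemma pi_withDensity {n : ℕ} {E : Fin n → Type*}
    {mE : ∀ i, MeasurableSpace (E i)} {μ : (i : Fin n) → Measure (E i)} [∀ i, SigmaFinite (μ i)]
    {f : (i : Fin n) → E i → ℝ≥0∞} (hf : ∀ i, Measurable (f i))
    [∀ i, SigmaFinite ((μ i).withDensity (f i))] :
    Measure.pi (fun i => (μ i).withDensity (f i)) =
      (Measure.pi μ).withDensity fun x => ∏ i, f i (x i) := by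
  refine Measure.pi_eq fun s hs => ?_
  rw [withDensity_apply _ (MeasurableSet.univ_pi hs),
    ← lintegral_indicator (MeasurableSet.univ_pi hs)]
  have h : ∀ x : (i : Fin n) → E i, (Set.univ.pi s).indicator (fun x => ∏ i, f i (x i)) x =
      ∏ i, (s i).indicator (f i) (x i) := by
    intro x
    by_cases hx : x ∈ Set.univ.pi s
    · rw [Set.indicator_of_mem hx]
      exact Finset.prod_congr rfl fun i _ => by rw [Set.indicator_of_mem (hx i trivial)]
    · rw [Set.indicator_of_notMem hx]
      simp only [Set.mem_pi, Set.mem_univ, true_imp_iff, not_forall] at hx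
      obtain ⟨i, hi⟩ := hx
      exact (Finset.prod_eq_zero (Finset.mem_univ i) (Set.indicator_of_notMem hi _)).symm
  simp_rw [h]
  rw [lintegral_fin_prod_eq_prod fun i => (hf i).indicator (hs i)]
  exact Finset.prod_congr rfl fun i _ => by
    rw [withDensity_apply _ (hs i), lintegral_indicator (hs i)]

/-- The integral of a function of one coordinate against a product of probability measures. -/
lemma lintegral_pi_eval {ι : Type*} [Fintype ι] {E : ι → Type*}
    {mE : ∀ i, MeasurableSpace (E i)} {μ : (i : ι) → Measure (E i)}
    [∀ i, IsProbabilityMeasure (μ i)] (i : ι) {f : E i → ℝ≥0∞} (hf : Measurable f) :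
    ∫⁻ x, f (x i) ∂(Measure.pi μ) = ∫⁻ z, f z ∂(μ i) :=
  (measurePreserving_eval μ i).lintegral_comp hf

end ProductMeasures

/-! ### Mean of the gamma distribution -/

section Gamma

/-- The factor z raises the shape by one: z times the density of shape a is a / r times the density
of shape a + 1. -/
lemma lintegral_id_gammaMeasure {a r : ℝ} (ha : 0 < a) (hr : 0 < r) :
    ∫⁻ z, ENNReal.ofReal z ∂(gammaMeasure a r) = ENNReal.ofReal (a / r) := by
  have hm : Measurable (gammaPDF a r) := (measurable_gammaPDFReal a r).ennreal_ofReal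
  rw [gammaMeasure, lintegral_withDensity_eq_lintegral_mul _ hm ENNReal.measurable_ofReal]
  have h : ∀ z, (gammaPDF a r * fun z => ENNReal.ofReal z) z =
      ENNReal.ofReal (a / r) * gammaPDF (a + 1) r z := by
    intro z
    simp only [Pi.mul_apply]
    rcases lt_or_ge z 0 with hz | hz
    · rw [gammaPDF_of_neg hz, gammaPDF_of_neg hz]; simp
    rw [gammaPDF_of_nonneg hz, gammaPDF_of_nonneg hz, ← ENNReal.ofReal_mul' hz,
      ← ENNReal.ofReal_mul (by positivity : 0 ≤ a / r)]
    congr 1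
    have hG := Real.Gamma_pos_of_pos ha
    rcases hz.eq_or_lt with rfl | hz
    · rw [add_sub_cancel_right, Real.zero_rpow ha.ne']; simp
    rw [Real.Gamma_add_one ha.ne', Real.rpow_add_one hr.ne', add_sub_cancel_right,
      Real.rpow_sub_one hz.ne']
    field_simp
  simp_rw [h]
  have hm' : Measurable (gammaPDF (a + 1) r) := (measurable_gammaPDFReal _ r).ennreal_ofReal
  rw [lintegral_const_mul _ hm',
    lintegral_gammaPDF_eq_one (by positivity) hr, mul_one]

end Gamma

/-! ### Inverse Gaussian distribution: normalization, mean, and a second moment -/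

section InverseGaussian

/-- The map `v ↦ a √v - 1 / √v` turns Lebesgue measure on `(0, ∞)`, weighted by its derivative, into
Lebesgue measure on `ℝ`. -/
lemma lintegral_comp_mul_sqrt_sub_inv_sqrt {a : ℝ} (ha : 0 < a) (h : ℝ → ℝ≥0∞) :
    ∫⁻ y, h y = ∫⁻ v in Set.Ioi (0 : ℝ),
      ENNReal.ofReal ((a / √v + 1 / (v * √v)) / 2) * h (a * √v - 1 / √v) := by
  have himg : (fun v : ℝ => a * √v - 1 / √v) '' Set.Ioi 0 = Set.univ := by
    refine Set.eq_univ_of_forall fun y => ?_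
    have hs := Real.sq_sqrt (by positivity : 0 ≤ y ^ 2 + 4 * a)
    have hpos : 0 < y + √(y ^ 2 + 4 * a) := by
      have : |y| < √(y ^ 2 + 4 * a) := by
        rw [← Real.sqrt_sq_eq_abs]
        exact Real.sqrt_lt_sqrt (sq_nonneg y) (by linarith)
      have := neg_abs_le y
      linarith
    -- The preimage of y has √v = z / (2a), the positive root of a s² - y s - 1 = 0.
    obtain ⟨z, hz, hzq⟩ : ∃ z, 0 < z ∧ z ^ 2 = 2 * y * z + 4 * a :=
      ⟨y + √(y ^ 2 + 4 * a), hpos, by nlinarith⟩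
    refine ⟨(z / (2 * a)) ^ 2, by
      simp only [Set.mem_Ioi]; positivity, ?_⟩
    simp only
    rw [Real.sqrt_sq (by positivity)]
    have : a * (z / (2 * a)) - 1 / (z / (2 * a)) = (z ^ 2 - 4 * a) / (2 * z) := by
      field_simp
      ring
    rw [this, hzq]
    field_simp
    ring
  have hder : ∀ v ∈ Set.Ioi (0 : ℝ), HasDerivWithinAt (fun v : ℝ => a * √v - 1 / √v)
      ((a / √v + 1 / (v * √v)) / 2) (Set.Ioi 0) v := by
    intro v hv
    have hv : 0 < v := hv
    have h1 := (Real.hasDerivAt_sqrt hv.ne')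
    have hs : 0 < √v := Real.sqrt_pos.2 hv
    have h2 := (h1.const_mul a).sub (h1.inv hs.ne')
    refine HasDerivAt.hasDerivWithinAt ?_
    have h3 : (fun v : ℝ => a * √v - 1 / √v) = (fun y => a * √y) - (fun x => √x)⁻¹ := by
      ext z; simp
    rw [h3]
    convert h2 using 1
    rw [Real.sq_sqrt hv.le]
    field_simp
    ring
  have hmono : MonotoneOn (fun v : ℝ => a * √v - 1 / √v) (Set.Ioi 0) := by
    intro v hv w hw hvw
    have hs : 0 < √v := Real.sqrt_pos.2 hv
    have h1 : √v ≤ √w := Real.sqrt_le_sqrt hvw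
    simp only
    gcongr
  have := lintegral_image_eq_lintegral_deriv_mul_of_monotoneOn measurableSet_Ioi hder hmono h
  rwa [himg, Measure.restrict_univ] at this

/-- The symmetry `v ↦ 1 / (a² v)`. -/
lemma lintegral_inv_mul_sqrt_mul_comp {a : ℝ} (ha : 0 < a) (h : ℝ → ℝ≥0∞) :
    ∫⁻ v in Set.Ioi (0 : ℝ), ENNReal.ofReal (1 / (v * √v)) * h ((a * √v - 1 / √v) ^ 2) =
      ∫⁻ v in Set.Ioi (0 : ℝ), ENNReal.ofReal (a / √v) * h ((a * √v - 1 / √v) ^ 2) := by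
  have himg : (fun v : ℝ => 1 / (a ^ 2 * v)) '' Set.Ioi 0 = Set.Ioi 0 := by
    ext w
    simp only [Set.mem_image, Set.mem_Ioi]
    constructor
    · rintro ⟨v, hv, rfl⟩; positivity
    · intro hw
      exact ⟨1 / (a ^ 2 * w), by positivity, by field_simp⟩
  have hder : ∀ v ∈ Set.Ioi (0 : ℝ), HasDerivWithinAt (fun v : ℝ => 1 / (a ^ 2 * v))
      (-(1 / (a ^ 2 * v ^ 2))) (Set.Ioi 0) v := by
    intro v hv
    have hv : 0 < v := hv
    have h2 := ((hasDerivAt_id v).const_mul (a ^ 2)).inv (by simp only [id]; positivity)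
    refine HasDerivAt.hasDerivWithinAt ?_
    have h3 : (fun v : ℝ => 1 / (a ^ 2 * v)) = (fun y => a ^ 2 * id y)⁻¹ := by
      ext z; simp
    have h4 : -(1 / (a ^ 2 * v ^ 2)) = -(a ^ 2 * 1) / (a ^ 2 * id v) ^ 2 := by
      simp only [id]
      field_simp
    rw [h3, h4]
    exact h2
  have hinj : Set.InjOn (fun v : ℝ => 1 / (a ^ 2 * v)) (Set.Ioi 0) := by
    intro v hv w hw hvw
    have hv : 0 < v := hv
    have hw : 0 < w := hw
    simp only at hvw
    field_simp at hvw
    exact hvw.symm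
  have := lintegral_image_eq_lintegral_abs_deriv_mul measurableSet_Ioi hder hinj
    (fun v => ENNReal.ofReal (1 / (v * √v)) * h ((a * √v - 1 / √v) ^ 2))
  rw [himg] at this
  rw [this]
  -- The substitution changes the sign of a√v - 1/√v, so its square is preserved, while the weight
  -- 1/(v√v) dv becomes (a/√v) dv.
  refine setLIntegral_congr_fun measurableSet_Ioi fun v hv => ?_
  have hv : 0 < v := hv
  have hs : 0 < √v := Real.sqrt_pos.2 hv
  have hsq := Real.sq_sqrt hv.le
  have e1 : √(1 / (a ^ 2 * v)) = 1 / (a * √v) := by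
    rw [Real.sqrt_div zero_le_one, Real.sqrt_one, Real.sqrt_mul (by positivity),
      Real.sqrt_sq ha.le]
  simp only [e1]
  rw [← mul_assoc, ← ENNReal.ofReal_mul (abs_nonneg _)]
  congr 2
  · rw [abs_neg, abs_of_pos (by positivity)]
    field_simp
    exact hsq
  · field_simp
    ring

/-- The Jacobian of v ↦ a√v - 1/√v is the average of the weights a/√v and 1/(v√v), and by the
symmetry both give the same integral of an even function. Hence each of them alone can play the
Jacobian. As a consequence (a√v - 1/√v)² is the square of a standard normal variable under the
inverse Gaussian law. -/
lemma lintegral_inv_mul_sqrt_mul_comp_eq {a : ℝ} (ha : 0 < a) {h : ℝ → ℝ≥0∞}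
    (hh : Measurable h) :
    ∫⁻ v in Set.Ioi (0 : ℝ), ENNReal.ofReal (1 / (v * √v)) * h ((a * √v - 1 / √v) ^ 2) =
      ∫⁻ y : ℝ, h (y ^ 2) := by
  rw [lintegral_comp_mul_sqrt_sub_inv_sqrt ha (fun y => h (y ^ 2))]
  have hsplit : ∀ v ∈ Set.Ioi (0 : ℝ),
      ENNReal.ofReal ((a / √v + 1 / (v * √v)) / 2) * h ((a * √v - 1 / √v) ^ 2) =
      2⁻¹ * (ENNReal.ofReal (a / √v) * h ((a * √v - 1 / √v) ^ 2)) +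
      2⁻¹ * (ENNReal.ofReal (1 / (v * √v)) * h ((a * √v - 1 / √v) ^ 2)) := by
    intro v hv
    have hv : 0 < v := hv
    rw [ENNReal.ofReal_div_of_pos two_pos, ENNReal.ofReal_add (by positivity) (by positivity),
      ENNReal.ofReal_ofNat, ENNReal.div_eq_inv_mul]
    ring
  rw [setLIntegral_congr_fun measurableSet_Ioi hsplit,
    lintegral_add_left (by fun_prop), lintegral_const_mul _ (by fun_prop),
    lintegral_const_mul _ (by fun_prop), lintegral_inv_mul_sqrt_mul_comp ha, ← two_mul,
    ← mul_assoc, ENNReal.mul_inv_cancel two_ne_zero ENNReal.ofNat_ne_top, one_mul]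

/-- The inverse Gaussian distribution with mean `1 / a` and shape `1`. -/
noncomputable def invGaussMeasure (a : ℝ) : Measure ℝ :=
  volume.withDensity fun v => ENNReal.ofReal (MultinomialGibbs.invGaussPDF (1 / a) 1 v)

/-- The exponent a - (a²v + 1/v)/2 is a perfect square, which shows the standard normal density in
the variable a√v - 1/√v. -/
lemma invGaussPDF_of_pos {a v : ℝ} (hv : 0 < v) :
    MultinomialGibbs.invGaussPDF (1 / a) 1 v =
      1 / (v * √v) * (√(1 / (2 * Real.pi)) * Real.exp (-(1 / 2) * (a * √v - 1 / √v) ^ 2)) := by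
  have hs : 0 < √v := Real.sqrt_pos.2 hv
  have hsq := Real.sq_sqrt hv.le
  rw [MultinomialGibbs.invGaussPDF, if_pos hv]
  have e1 : v ^ (3 / 2 : ℝ) = v * √v := by
    rw [show (3 / 2 : ℝ) = 1 + 1 / 2 by norm_num, Real.rpow_add hv, Real.rpow_one,
      Real.sqrt_eq_rpow]
  have e2 : -(1 / 2) * (a * √v - 1 / √v) ^ 2 =
      1 / (1 / a) + -(1 / 2) * (1 / (1 / a) ^ 2 * v + 1 / v) := by
    have : (a * √v - 1 / √v) ^ 2 = a ^ 2 * √v ^ 2 - 2 * a + 1 / √v ^ 2 := by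
      field_simp
      ring
    rw [this, hsq]
    simp only [one_div, inv_inv, inv_pow]
    ring
  rw [e1, e2, Real.exp_add]
  ring

lemma measurable_invGaussPDF (a : ℝ) :
    Measurable fun v => ENNReal.ofReal (MultinomialGibbs.invGaussPDF (1 / a) 1 v) :=
  (MultinomialGibbs.measurable_invGauss 1 measurable_const measurable_id).ennreal_ofReal

/-- Integrals against the inverse Gaussian distribution as integrals over `(0, ∞)`. -/
lemma lintegral_invGaussMeasure {a : ℝ} {g : ℝ → ℝ≥0∞} (hg : Measurable g) :
    ∫⁻ v, g v ∂(invGaussMeasure a) = ∫⁻ v in Set.Ioi (0 : ℝ),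
      ENNReal.ofReal (1 / (v * √v)) * (ENNReal.ofReal
        (√(1 / (2 * Real.pi)) * Real.exp (-(1 / 2) * (a * √v - 1 / √v) ^ 2)) * g v) := by
  rw [invGaussMeasure, lintegral_withDensity_eq_lintegral_mul _ (measurable_invGaussPDF a) hg,
    ← lintegral_indicator measurableSet_Ioi]
  refine lintegral_congr fun v => ?_
  by_cases hv : 0 < v
  · rw [Set.indicator_of_mem (Set.mem_Ioi.2 hv), Pi.mul_apply, invGaussPDF_of_pos hv,
      ENNReal.ofReal_mul (by positivity), mul_assoc]
  · rw [Set.indicator_of_notMem (by simpa using hv), Pi.mul_apply,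
      MultinomialGibbs.invGaussPDF, if_neg hv]
    simp

lemma lintegral_exp_neg_mul_sq {b : ℝ} (hb : 0 < b) :
    ∫⁻ y : ℝ, ENNReal.ofReal (Real.exp (-b * y ^ 2)) = ENNReal.ofReal √(Real.pi / b) := by
  rw [← integral_gaussian, ofReal_integral_eq_lintegral_ofReal (integrable_exp_neg_mul_sq hb)
    (ae_of_all _ fun y => (Real.exp_pos _).le)]

lemma lintegral_gauss_sq :
    ∫⁻ y : ℝ, ENNReal.ofReal (√(1 / (2 * Real.pi)) * Real.exp (-(1 / 2) * y ^ 2)) = 1 := by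
  simp_rw [ENNReal.ofReal_mul (Real.sqrt_nonneg _)]
  rw [lintegral_const_mul _ (by fun_prop), lintegral_exp_neg_mul_sq (by norm_num),
    ← ENNReal.ofReal_mul (Real.sqrt_nonneg _), ← Real.sqrt_mul (by positivity)]
  have : 1 / (2 * Real.pi) * (Real.pi / (1 / 2)) = 1 := by
    have := Real.pi_pos
    field_simp
  rw [this]; simp

lemma isProbabilityMeasure_invGaussMeasure {a : ℝ} (ha : 0 < a) :
    IsProbabilityMeasure (invGaussMeasure a) := by
  refine ⟨?_⟩
  rw [← lintegral_one, lintegral_invGaussMeasure measurable_const]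
  simp only [mul_one]
  rw [lintegral_inv_mul_sqrt_mul_comp_eq ha
    (h := fun t => ENNReal.ofReal (√(1 / (2 * Real.pi)) * Real.exp (-(1 / 2) * t)))
    (by fun_prop)]
  exact lintegral_gauss_sq

/-- The factor v turns the weight 1/(v√v) into 1/√v, which is 1/a times the other weight of the
symmetry, so the normalization is reused. -/
lemma lintegral_id_invGaussMeasure {a : ℝ} (ha : 0 < a) :
    ∫⁻ v, ENNReal.ofReal v ∂(invGaussMeasure a) = ENNReal.ofReal (1 / a) := by
  rw [lintegral_invGaussMeasure ENNReal.measurable_ofReal]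
  have h1 := lintegral_inv_mul_sqrt_mul_comp ha
    (h := fun t => ENNReal.ofReal (√(1 / (2 * Real.pi)) * Real.exp (-(1 / 2) * t)))
  rw [lintegral_inv_mul_sqrt_mul_comp_eq ha (h := fun t => ENNReal.ofReal
    (√(1 / (2 * Real.pi)) * Real.exp (-(1 / 2) * t))) (by fun_prop), lintegral_gauss_sq] at h1
  have h2 : ∀ v ∈ Set.Ioi (0 : ℝ), ENNReal.ofReal (1 / (v * √v)) * (ENNReal.ofReal
        (√(1 / (2 * Real.pi)) * Real.exp (-(1 / 2) * (a * √v - 1 / √v) ^ 2)) *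
          ENNReal.ofReal v) =
      ENNReal.ofReal (1 / a) * (ENNReal.ofReal (a / √v) * ENNReal.ofReal
        (√(1 / (2 * Real.pi)) * Real.exp (-(1 / 2) * (a * √v - 1 / √v) ^ 2))) := by
    intro v hv
    have hv : 0 < v := hv
    have hs : 0 < √v := Real.sqrt_pos.2 hv
    rw [← ENNReal.ofReal_mul (by positivity), ← ENNReal.ofReal_mul (by positivity),
      ← ENNReal.ofReal_mul (by positivity), ← ENNReal.ofReal_mul (by positivity)]
    congr 1
    field_simp
  rw [setLIntegral_congr_fun measurableSet_Ioi h2, lintegral_const_mul _ (by fun_prop), ← h1,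
    mul_one]

/-- Half of the Gaussian decay absorbs a quadratic factor. This reduces second moments to Gaussian
integrals with exponent 1/4, at the price of a non-sharp constant. -/
lemma mul_exp_neg_half_le (t : ℝ) :
    Real.exp (-(1 / 2) * t) * t ≤ 4 * Real.exp (-(1 / 4) * t) := by
  have h1 : t ≤ 4 * Real.exp (1 / 4 * t) := by
    have := Real.add_one_le_exp (1 / 4 * t)
    linarith
  have h2 : Real.exp (-(1 / 4) * t) = Real.exp (-(1 / 2) * t) * Real.exp (1 / 4 * t) := by
    rw [← Real.exp_add]; ring_nf
  rw [h2]
  nlinarith [Real.exp_pos (-(1 / 2) * t)]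

lemma lintegral_sq_invGaussMeasure_le {a : ℝ} (ha : 0 < a) :
    ∫⁻ v, ENNReal.ofReal ((a * √v - 1 / √v) ^ 2) ∂(invGaussMeasure a) ≤ 8 := by
  rw [lintegral_invGaussMeasure (by fun_prop),
    lintegral_inv_mul_sqrt_mul_comp_eq ha (h := fun t => ENNReal.ofReal
      (√(1 / (2 * Real.pi)) * Real.exp (-(1 / 2) * t)) * ENNReal.ofReal t) (by fun_prop)]
  calc _ ≤ ∫⁻ y : ℝ, ENNReal.ofReal (√(1 / (2 * Real.pi)) * 4) *
        ENNReal.ofReal (Real.exp (-(1 / 4) * y ^ 2)) := by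
        refine lintegral_mono fun y => ?_
        rw [← ENNReal.ofReal_mul (by positivity), ← ENNReal.ofReal_mul (by positivity)]
        refine ENNReal.ofReal_le_ofReal ?_
        rw [mul_assoc, mul_assoc]
        exact mul_le_mul_of_nonneg_left (mul_exp_neg_half_le _) (Real.sqrt_nonneg _)
    _ = ENNReal.ofReal (4 * √2) := by
        rw [lintegral_const_mul _ (by fun_prop), lintegral_exp_neg_mul_sq (by norm_num),
          ← ENNReal.ofReal_mul (by positivity)]
        congr 1
        have : √(1 / (2 * Real.pi)) * 4 * √(Real.pi / (1 / 4)) =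
          4 * (√(1 / (2 * Real.pi)) * √(Real.pi / (1 / 4))) := by ring
        rw [this, ← Real.sqrt_mul (by positivity)]
        congr 2
        have := Real.pi_pos
        field_simp
        norm_num
    _ ≤ 8 := by
        rw [← ENNReal.ofReal_ofNat]
        refine ENNReal.ofReal_le_ofReal ?_
        have : √2 ≤ 2 := by rw [Real.sqrt_le_left (by norm_num)]; norm_num
        linarith

end InverseGaussian

/-! ### Multivariate normal densities given by a precision matrix -/

section Gaussian

variable {p : ℕ}

-- A square root of the precision: B carries the quadratic form to the Euclidean one, reducing
-- Gaussian integrals to products and bounds on linear forms to Cauchy-Schwarz.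
open scoped MatrixOrder in
lemma Matrix.PosDef.exists_transpose_mul_self {Q : Matrix (Fin p) (Fin p) ℝ} (hQ : Q.PosDef) :
    ∃ B : Matrix (Fin p) (Fin p) ℝ, Q = Bᵀ * B ∧ B.det ≠ 0 := by
  obtain ⟨B, hB⟩ := CStarAlgebra.nonneg_iff_eq_star_mul_self.mp hQ.posSemidef.nonneg
  refine ⟨B, by rw [hB, Matrix.star_eq_conjTranspose, Matrix.conjTranspose_eq_transpose_of_trivial],
    fun h => ?_⟩
  have := hQ.det_pos
  rw [hB, Matrix.det_mul, h, mul_zero] at this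
  exact lt_irrefl _ this

lemma dotProduct_transpose_mul_self_mulVec (B : Matrix (Fin p) (Fin p) ℝ) (z : Fin p → ℝ) :
    z ⬝ᵥ ((Bᵀ * B) *ᵥ z) = ∑ i, (B *ᵥ z) i ^ 2 := by
  rw [← Matrix.mulVec_mulVec, Matrix.dotProduct_mulVec, Matrix.vecMul_transpose, dotProduct]
  exact Finset.sum_congr rfl fun i _ => (sq _).symm

lemma Matrix.PosDef.dotProduct_mulVec_self_nonneg {Q : Matrix (Fin p) (Fin p) ℝ} (hQ : Q.PosDef)
    (z : Fin p → ℝ) : 0 ≤ z ⬝ᵥ (Q *ᵥ z) := by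
  simpa using hQ.posSemidef.dotProduct_mulVec_nonneg z

lemma Matrix.PosDef.dotProduct_mulVec_symm {Q : Matrix (Fin p) (Fin p) ℝ} (hQ : Q.PosDef)
    (z w : Fin p → ℝ) : z ⬝ᵥ (Q *ᵥ w) = w ⬝ᵥ (Q *ᵥ z) := by
  have h : Qᵀ = Q := by
    simpa [Matrix.conjTranspose_eq_transpose_of_trivial] using hQ.isHermitian.eq
  rw [Matrix.dotProduct_mulVec, ← Matrix.mulVec_transpose, h, dotProduct_comm]

/-- A linear form is bounded by a positive definite quadratic form. -/
lemma Matrix.PosDef.exists_sq_dotProduct_le {Q : Matrix (Fin p) (Fin p) ℝ} (hQ : Q.PosDef)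
    (a : Fin p → ℝ) : ∃ C : ℝ, 0 ≤ C ∧ ∀ z, (a ⬝ᵥ z) ^ 2 ≤ C * (z ⬝ᵥ (Q *ᵥ z)) := by
  obtain ⟨B, rfl, hB⟩ := hQ.exists_transpose_mul_self
  refine ⟨∑ i, (a ᵥ* B⁻¹) i ^ 2, by positivity, fun z => ?_⟩
  have h : a ⬝ᵥ z = ∑ i, (a ᵥ* B⁻¹) i * (B *ᵥ z) i := by
    change _ = (a ᵥ* B⁻¹) ⬝ᵥ (B *ᵥ z)
    rw [← Matrix.dotProduct_mulVec, Matrix.mulVec_mulVec,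
      Matrix.nonsing_inv_mul _ (isUnit_iff_ne_zero.2 hB), Matrix.one_mulVec]
  rw [h, dotProduct_transpose_mul_self_mulVec]
  exact Finset.sum_mul_sq_le_sq_mul_sq _ _ _

lemma lintegral_exp_neg_mul_sum_sq {c : ℝ} (hc : 0 < c) :
    ∫⁻ z : Fin p → ℝ, ENNReal.ofReal (Real.exp (-c * ∑ i, z i ^ 2)) =
      ENNReal.ofReal (√(Real.pi / c) ^ p) := by
  have h : ∀ z : Fin p → ℝ, ENNReal.ofReal (Real.exp (-c * ∑ i, z i ^ 2)) =
      ∏ i, ENNReal.ofReal (Real.exp (-c * z i ^ 2)) := fun z => by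
    rw [Finset.mul_sum, Real.exp_sum, ENNReal.ofReal_prod_of_nonneg fun _ _ => (Real.exp_pos _).le]
  simp_rw [h]
  rw [volume_pi, lintegral_fin_prod_eq_prod (f := fun _ t => ENNReal.ofReal (Real.exp (-c * t ^ 2)))
    fun _ => by fun_prop]
  rw [lintegral_exp_neg_mul_sq hc, Finset.prod_const, Finset.card_univ, Fintype.card_fin,
    ENNReal.ofReal_pow (Real.sqrt_nonneg _)]

lemma lintegral_comp_mulVec_sub {B : Matrix (Fin p) (Fin p) ℝ} (hB : B.det ≠ 0) (m : Fin p → ℝ)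
    {g : (Fin p → ℝ) → ℝ≥0∞} (hg : Measurable g) :
    ∫⁻ z, g (B *ᵥ (z - m)) = ENNReal.ofReal |B.det|⁻¹ * ∫⁻ z, g z := by
  rw [lintegral_sub_right_eq_self (fun z => g (B *ᵥ z)) m, ← abs_inv, ← smul_eq_mul,
    ← lintegral_smul_measure, ← Real.map_matrix_volume_pi_eq_smul_volume_pi hB, lintegral_map hg]
  · rfl
  · exact (Matrix.toLin' B).continuous_of_finiteDimensional.measurable

/-- The exponent c is left free: c = 1/2 gives the total mass of the density, c = 1/4 the bound on
its second moment. After the change of variables by B the determinant cancels, so the value does not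
depend on Q or m. -/
lemma lintegral_sqrt_det_mul_exp {Q : Matrix (Fin p) (Fin p) ℝ} (hQ : Q.PosDef) (m : Fin p → ℝ)
    {c : ℝ} (hc : 0 < c) :
    ∫⁻ b, ENNReal.ofReal (√(Q.det / (2 * Real.pi) ^ p) *
      Real.exp (-c * ((b - m) ⬝ᵥ (Q *ᵥ (b - m))))) = ENNReal.ofReal (√(1 / (2 * c)) ^ p) := by
  obtain ⟨B, rfl, hB⟩ := hQ.exists_transpose_mul_self
  simp_rw [dotProduct_transpose_mul_self_mulVec]
  rw [lintegral_comp_mulVec_sub hB m (g := fun z => ENNReal.ofReal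
    (√((Bᵀ * B).det / (2 * Real.pi) ^ p) * Real.exp (-c * ∑ i, z i ^ 2))) (by fun_prop)]
  simp_rw [ENNReal.ofReal_mul (Real.sqrt_nonneg _)]
  rw [lintegral_const_mul _ (by fun_prop), lintegral_exp_neg_mul_sum_sq hc,
    ← ENNReal.ofReal_mul (Real.sqrt_nonneg _), ← ENNReal.ofReal_mul (by positivity)]
  congr 1
  have hB' : 0 < |B.det| := abs_pos.2 hB
  have e1 : ∀ t : ℝ, 0 ≤ t → √t ^ p = √(t ^ p) := fun t ht => by
    rw [eq_comm, Real.sqrt_eq_iff_mul_self_eq (by positivity) (by positivity), ← mul_pow,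
      Real.mul_self_sqrt ht]
  rw [Matrix.det_mul, Matrix.det_transpose, Real.sqrt_div (mul_self_nonneg _),
    Real.sqrt_mul_self_eq_abs, ← e1 _ (by positivity), div_mul_eq_mul_div, mul_div_assoc,
    ← div_pow, ← Real.sqrt_div (by positivity), ← mul_assoc, inv_mul_cancel₀ hB'.ne', one_mul]
  congr 2
  have := Real.pi_pos
  field_simp

namespace MultinomialGibbs

lemma normalPDF_nonneg (m : Fin p → ℝ) (Q : Matrix (Fin p) (Fin p) ℝ) (b : Fin p → ℝ) :
    0 ≤ normalPDF m Q b := by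
  unfold normalPDF; positivity

lemma continuous_normalPDF (m : Fin p → ℝ) (Q : Matrix (Fin p) (Fin p) ℝ) :
    Continuous (normalPDF m Q) := by
  unfold normalPDF
  fun_prop

lemma lintegral_normalPDF (m : Fin p → ℝ) {Q : Matrix (Fin p) (Fin p) ℝ} (hQ : Q.PosDef) :
    ∫⁻ b, ENNReal.ofReal (normalPDF m Q b) = 1 := by
  unfold normalPDF
  rw [lintegral_sqrt_det_mul_exp hQ m (by norm_num)]
  norm_num

/-- What matters is uniformity in m and Q, since in the chain both depend on the latent variables.
-/
lemma lintegral_quad_mul_normalPDF_le (m : Fin p → ℝ) {Q : Matrix (Fin p) (Fin p) ℝ}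
    (hQ : Q.PosDef) :
    ∫⁻ b, ENNReal.ofReal (normalPDF m Q b) * ENNReal.ofReal ((b - m) ⬝ᵥ (Q *ᵥ (b - m))) ≤
      ENNReal.ofReal (4 * √2 ^ p) := by
  calc _ ≤ ∫⁻ b, ENNReal.ofReal 4 * ENNReal.ofReal (√(Q.det / (2 * Real.pi) ^ p) *
      Real.exp (-(1 / 4) * ((b - m) ⬝ᵥ (Q *ᵥ (b - m))))) := by
        refine lintegral_mono fun b => ?_
        rw [← ENNReal.ofReal_mul (normalPDF_nonneg _ _ _), ← ENNReal.ofReal_mul (by norm_num)]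
        refine ENNReal.ofReal_le_ofReal ?_
        rw [normalPDF, mul_assoc, mul_left_comm 4]
        exact mul_le_mul_of_nonneg_left (mul_exp_neg_half_le _) (Real.sqrt_nonneg _)
    _ = _ := by
        rw [lintegral_const_mul' _ _ ENNReal.ofReal_ne_top,
          lintegral_sqrt_det_mul_exp hQ m (by norm_num), ← ENNReal.ofReal_mul (by norm_num)]
        norm_num

end MultinomialGibbs

end Gaussian

/-! ### Quadratic forms of the conditional law of β -/

namespace MultinomialGibbs

variable {n p : ℕ} {q : Fin n → ℕ}

lemma dotProduct_postPrecision_mulVec (x : (i : Fin n) → Fin (q i) → Fin p → ℝ)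
    (Ψ : Matrix (Fin p) (Fin p) ℝ) (u : LatentU q) (v : LatentV q) (a b : Fin p → ℝ) :
    a ⬝ᵥ (postPrecision x Ψ u v *ᵥ b) = a ⬝ᵥ (Ψ *ᵥ b) +
      ∑ i, ∑ k : Fin (q i), v i k * (u i k.succ + u i 0) ^ 2 *
        (linPred x a i k * linPred x b i k) := by
  simp only [postPrecision, Matrix.add_mulVec, dotProduct_add, Matrix.sum_mulVec,
    dotProduct_sum, Matrix.smul_mulVec, dotProduct_smul, smul_eq_mul, linPred]
  congr 1
  refine Finset.sum_congr rfl fun i _ => Finset.sum_congr rfl fun k _ => ?_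
  rw [Matrix.vecMulVec_mulVec]
  simp [dotProduct_comm a, mul_comm]

lemma posDef_postPrecision (x : (i : Fin n) → Fin (q i) → Fin p → ℝ)
    {Ψ : Matrix (Fin p) (Fin p) ℝ} (hΨ : Ψ.PosDef) {u : LatentU q} {v : LatentV q}
    (hv : ∀ i k, 0 < v i k) : (postPrecision x Ψ u v).PosDef := by
  refine hΨ.add_posSemidef (Matrix.posSemidef_sum _ fun i _ => Matrix.posSemidef_sum _ fun k _ => ?_)
  refine Matrix.PosSemidef.smul ?_ (mul_nonneg (hv i k).le (sq_nonneg _))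
  simpa using Matrix.posSemidef_vecMulVec_self_star (x i k)

lemma postPrecision_mulVec_postMean (x : (i : Fin n) → Fin (q i) → Fin p → ℝ) (μ : Fin p → ℝ)
    {Ψ : Matrix (Fin p) (Fin p) ℝ} (hΨ : Ψ.PosDef) {u : LatentU q} {v : LatentV q}
    (hv : ∀ i k, 0 < v i k) :
    postPrecision x Ψ u v *ᵥ postMean x μ Ψ u v =
      Ψ *ᵥ μ + ∑ i, ∑ k : Fin (q i), (u i k.succ - u i 0) • x i k := by
  rw [postMean, Matrix.mulVec_mulVec, Matrix.mul_nonsing_inv _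
    (isUnit_iff_ne_zero.2 (posDef_postPrecision x hΨ hv).det_pos.ne'), Matrix.one_mulVec]

lemma dotProduct_postPrecision_mulVec_postMean (x : (i : Fin n) → Fin (q i) → Fin p → ℝ)
    (μ : Fin p → ℝ) {Ψ : Matrix (Fin p) (Fin p) ℝ} (hΨ : Ψ.PosDef) {u : LatentU q}
    {v : LatentV q} (hv : ∀ i k, 0 < v i k) (a : Fin p → ℝ) :
    a ⬝ᵥ (postPrecision x Ψ u v *ᵥ postMean x μ Ψ u v) = a ⬝ᵥ (Ψ *ᵥ μ) +
      ∑ i, ∑ k : Fin (q i), (u i k.succ - u i 0) * linPred x a i k := by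
  rw [postPrecision_mulVec_postMean x μ hΨ hv]
  simp only [dotProduct_add, dotProduct_sum, dotProduct_smul, smul_eq_mul, linPred,
    dotProduct_comm _ a]

/-- Completing the square in the exponent of the conditional density of `β`. -/
lemma quad_postPrecision_sub_postMean (x : (i : Fin n) → Fin (q i) → Fin p → ℝ)
    (μ : Fin p → ℝ) {Ψ : Matrix (Fin p) (Fin p) ℝ} (hΨ : Ψ.PosDef) {u : LatentU q}
    {v : LatentV q} (hv : ∀ i k, 0 < v i k) (b : Fin p → ℝ) :
    (b - postMean x μ Ψ u v) ⬝ᵥ (postPrecision x Ψ u v *ᵥ (b - postMean x μ Ψ u v)) =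
      (b - μ) ⬝ᵥ (Ψ *ᵥ (b - μ)) +
      ∑ i, ∑ k : Fin (q i), (v i k * (u i k.succ + u i 0) ^ 2 * linPred x b i k ^ 2 -
        2 * ((u i k.succ - u i 0) * linPred x b i k)) +
      (postMean x μ Ψ u v ⬝ᵥ (postPrecision x Ψ u v *ᵥ postMean x μ Ψ u v) - μ ⬝ᵥ (Ψ *ᵥ μ)) := by
  have hQ := posDef_postPrecision x hΨ (u := u) hv
  simp only [Matrix.mulVec_sub, sub_dotProduct, dotProduct_sub]
  rw [hQ.dotProduct_mulVec_symm (postMean x μ Ψ u v) b,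
    dotProduct_postPrecision_mulVec_postMean x μ hΨ hv b, dotProduct_postPrecision_mulVec,
    hΨ.dotProduct_mulVec_symm μ b]
  simp only [Finset.sum_sub_distrib, ← Finset.mul_sum, sq]
  ring

/-- The mean of the conditional distribution of `β` minimizes the exponent of its density. -/
lemma quad_postMean_sub_le (x : (i : Fin n) → Fin (q i) → Fin p → ℝ)
    (μ : Fin p → ℝ) {Ψ : Matrix (Fin p) (Fin p) ℝ} (hΨ : Ψ.PosDef) {u : LatentU q}
    {v : LatentV q} (hv : ∀ i k, 0 < v i k) (hu : ∀ i (k : Fin (q i)), 0 < u i k.succ + u i 0)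
    (z : Fin p → ℝ) :
    (postMean x μ Ψ u v - μ) ⬝ᵥ (Ψ *ᵥ (postMean x μ Ψ u v - μ)) ≤ (z - μ) ⬝ᵥ (Ψ *ᵥ (z - μ)) +
      ∑ i, ∑ k : Fin (q i), v i k * (u i k.succ + u i 0) ^ 2 *
        (linPred x z i k - (u i k.succ - u i 0) / (v i k * (u i k.succ + u i 0) ^ 2)) ^ 2 := by
  set w := postMean x μ Ψ u v with hw
  have hQ := posDef_postPrecision x hΨ (u := u) hv
  have h0 := hQ.dotProduct_mulVec_self_nonneg (z - w)
  have h1 := quad_postPrecision_sub_postMean x μ hΨ (u := u) hv z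
  have h2 := quad_postPrecision_sub_postMean x μ hΨ (u := u) hv w
  rw [← hw] at h1 h2
  rw [sub_self, zero_dotProduct] at h2
  -- Completing the square in each category leaves a remainder free of b, which cancels when the
  -- exponents at z and at the minimizer w are compared.
  have h3 : ∀ b : Fin p → ℝ, ∑ i, ∑ k : Fin (q i), (v i k * (u i k.succ + u i 0) ^ 2 *
        linPred x b i k ^ 2 - 2 * ((u i k.succ - u i 0) * linPred x b i k)) =
      ∑ i, ∑ k : Fin (q i), v i k * (u i k.succ + u i 0) ^ 2 *
        (linPred x b i k - (u i k.succ - u i 0) / (v i k * (u i k.succ + u i 0) ^ 2)) ^ 2 -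
      ∑ i, ∑ k : Fin (q i), (u i k.succ - u i 0) ^ 2 / (v i k * (u i k.succ + u i 0) ^ 2) := by
    intro b
    rw [← Finset.sum_sub_distrib]
    refine Finset.sum_congr rfl fun i _ => ?_
    rw [← Finset.sum_sub_distrib]
    refine Finset.sum_congr rfl fun k _ => ?_
    have hv' := (hv i k).ne'
    have hu' := (hu i k).ne'
    field_simp
    ring
  rw [h3] at h1 h2
  have h4 : 0 ≤ ∑ i, ∑ k : Fin (q i), v i k * (u i k.succ + u i 0) ^ 2 *
        (linPred x w i k - (u i k.succ - u i 0) / (v i k * (u i k.succ + u i 0) ^ 2)) ^ 2 :=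
    Finset.sum_nonneg fun i _ => Finset.sum_nonneg fun k _ =>
      mul_nonneg (mul_nonneg (hv i k).le (sq_nonneg _)) (sq_nonneg _)
  linarith

end MultinomialGibbs

/-! ### The sampling kernels as product measures -/

lemma ae_pi_pi {n : ℕ} {r : Fin n → ℕ} {ν : (i : Fin n) → Fin (r i) → Measure ℝ}
    [∀ i k, SigmaFinite (ν i k)] {P : (i : Fin n) → Fin (r i) → ℝ → Prop}
    (h : ∀ i k, ∀ᵐ z ∂ν i k, P i k z) :
    ∀ᵐ u ∂(Measure.pi fun i => Measure.pi (ν i)), ∀ i k, P i k (u i k) := by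
  refine ae_all_iff.2 fun i => ae_all_iff.2 fun k => ?_
  exact (Measure.tendsto_eval_ae_ae (μ := fun i => Measure.pi (ν i)) (i := i)).eventually
    ((Measure.tendsto_eval_ae_ae (μ := ν i) (i := k)).eventually (h i k))

lemma lintegral_pi_pi_eval {n : ℕ} {r : Fin n → ℕ} {ν : (i : Fin n) → Fin (r i) → Measure ℝ}
    [∀ i k, IsProbabilityMeasure (ν i k)] (i : Fin n) (k : Fin (r i)) {f : ℝ → ℝ≥0∞}
    (hf : Measurable f) :
    ∫⁻ u, f (u i k) ∂(Measure.pi fun i => Measure.pi (ν i)) = ∫⁻ z, f z ∂(ν i k) := by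
  rw [lintegral_pi_eval (μ := fun i => Measure.pi (ν i)) i (f := fun z => f (z k)) (by fun_prop),
    lintegral_pi_eval (μ := ν i) k hf]

lemma pi_pi_withDensity {n : ℕ} {r : Fin n → ℕ} {f : (i : Fin n) → Fin (r i) → ℝ → ℝ≥0∞}
    (hf : ∀ i k, Measurable (f i k))
    [∀ i k, IsProbabilityMeasure ((volume : Measure ℝ).withDensity (f i k))] :
    (Measure.pi fun i => Measure.pi fun k => (volume : Measure ℝ).withDensity (f i k)) =
      (volume : Measure ((i : Fin n) → Fin (r i) → ℝ)).withDensity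
        fun u => ∏ i, ∏ k, f i k (u i k) := by
  have h1 : ∀ i, (Measure.pi fun k => (volume : Measure ℝ).withDensity (f i k)) =
      (volume : Measure (Fin (r i) → ℝ)).withDensity fun z => ∏ k, f i k (z k) := fun i => by
    rw [pi_withDensity (hf i), volume_pi]
  have h2 : ∀ i, IsProbabilityMeasure ((volume : Measure (Fin (r i) → ℝ)).withDensity
      fun z => ∏ k, f i k (z k)) := fun i => by
    rw [← h1]; infer_instance
  simp_rw [h1]
  have h3 : ∀ i, Measurable fun z : Fin (r i) → ℝ => ∏ k, f i k (z k) := fun i =>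
    Finset.measurable_fun_prod _ fun k _ => (hf i k).comp (measurable_pi_apply k)
  rw [pi_withDensity h3, volume_pi]

lemma ae_pos_gammaMeasure (a r : ℝ) : ∀ᵐ z ∂(gammaMeasure a r), 0 < z := by
  have hm : Measurable (gammaPDF a r) := (measurable_gammaPDFReal a r).ennreal_ofReal
  rw [gammaMeasure, ae_withDensity_iff hm]
  -- The density is given by its formula at 0 as well, where it need not vanish, so 0 is removed as
  -- a null set.
  filter_upwards [Measure.ae_ne volume (0 : ℝ)] with z hz h
  by_contra hz'
  exact h (gammaPDF_of_neg (lt_of_le_of_ne (not_lt.1 hz') hz))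

lemma ae_pos_invGaussMeasure (a : ℝ) : ∀ᵐ z ∂(invGaussMeasure a), 0 < z := by
  rw [invGaussMeasure, ae_withDensity_iff (measurable_invGaussPDF a)]
  refine ae_of_all _ fun z h => ?_
  by_contra hz
  exact h (by rw [MultinomialGibbs.invGaussPDF, if_neg hz, ENNReal.ofReal_zero])

namespace MultinomialGibbs

variable {n p : ℕ} {q : Fin n → ℕ}

lemma abs_lt_sqrt_sq_add_four (t : ℝ) : |t| < √(t ^ 2 + 4) := by
  rw [← Real.sqrt_sq_eq_abs]
  exact Real.sqrt_lt_sqrt (sq_nonneg t) (by linarith)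

lemma sqrt_sq_add_four_pos (t : ℝ) : 0 < √(t ^ 2 + 4) := Real.sqrt_pos.2 (by positivity)

lemma link_pos (t : ℝ) : 0 < link t := by
  have h1 := abs_lt_sqrt_sq_add_four t
  have h2 := neg_abs_le t
  unfold link
  linarith

lemma rate_pos (t : ℝ) : 0 < -t + √(t ^ 2 + 4) := by
  have h1 := abs_lt_sqrt_sq_add_four t
  have h2 := le_abs_self t
  linarith

lemma rate_mul_link (t : ℝ) : (-t + √(t ^ 2 + 4)) * link t = 2 := by
  have h := Real.sq_sqrt (by positivity : 0 ≤ t ^ 2 + 4)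
  unfold link
  linear_combination h / 2

lemma linkSum_nonneg (x : (i : Fin n) → Fin (q i) → Fin p → ℝ) (b : Fin p → ℝ) (i : Fin n) :
    0 ≤ linkSum x b i := Finset.sum_nonneg fun _ _ => (link_pos _).le

/-- The shape parameters of the gamma latent variables. -/
def uShape (m : Fin n → ℕ) (y : (i : Fin n) → Fin (q i + 1) → ℕ) (i : Fin n) :
    Fin (q i + 1) → ℝ :=
  Fin.cons (m i : ℝ) fun k => (y i k.succ : ℝ)

/-- The rate parameters of the gamma latent variables. -/
noncomputable def uRate (x : (i : Fin n) → Fin (q i) → Fin p → ℝ) (b : Fin p → ℝ) (i : Fin n) :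
    Fin (q i + 1) → ℝ :=
  Fin.cons (2 + 2 * linkSum x b i) fun k => -linPred x b i k + √(linPred x b i k ^ 2 + 4)

lemma uShape_pos {m : Fin n → ℕ} (hm : ∀ i, 1 ≤ m i) {y : (i : Fin n) → Fin (q i + 1) → ℕ}
    (hy : ∀ (i : Fin n) (k : Fin (q i)), 1 ≤ y i k.succ) (i : Fin n) (k : Fin (q i + 1)) :
    0 < uShape m y i k := by
  refine Fin.cases ?_ (fun k => ?_) k
  · exact Nat.cast_pos.2 (hm i)
  · exact Nat.cast_pos.2 (hy i k)

lemma uRate_pos (x : (i : Fin n) → Fin (q i) → Fin p → ℝ) (b : Fin p → ℝ) (i : Fin n)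
    (k : Fin (q i + 1)) : 0 < uRate x b i k := by
  refine Fin.cases ?_ (fun k => ?_) k
  · have := linkSum_nonneg x b i
    show 0 < 2 + 2 * linkSum x b i
    linarith
  · exact rate_pos _

lemma uDensity_eq_prod (m : Fin n → ℕ) (y : (i : Fin n) → Fin (q i + 1) → ℕ)
    (x : (i : Fin n) → Fin (q i) → Fin p → ℝ) (b : Fin p → ℝ) (u : LatentU q) :
    uDensity m y x b u = ∏ i, ∏ k, gammaPDFReal (uShape m y i k) (uRate x b i k) (u i k) := by
  unfold uDensity
  refine Finset.prod_congr rfl fun i _ => ?_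
  rw [Fin.prod_univ_succ]
  rfl

/-- Identifies the kernel with a product of gamma laws, so that mass, positivity and means can be
read off coordinatewise. The positive counts and totals give positive shapes, without which the
gamma densities would not be known to have mass one. -/
lemma uKernel_apply {m : Fin n → ℕ} (hm : ∀ i, 1 ≤ m i) {y : (i : Fin n) → Fin (q i + 1) → ℕ}
    (hy : ∀ (i : Fin n) (k : Fin (q i)), 1 ≤ y i k.succ)
    (x : (i : Fin n) → Fin (q i) → Fin p → ℝ) (b : Fin p → ℝ) :
    uKernel m y x b = Measure.pi fun i => Measure.pi fun k =>
      gammaMeasure (uShape m y i k) (uRate x b i k) := by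
  have hs := uShape_pos hm hy
  have hr := uRate_pos x b
  have : ∀ i k, IsProbabilityMeasure ((volume : Measure ℝ).withDensity
      (gammaPDF (uShape m y i k) (uRate x b i k))) := fun i k =>
    isProbabilityMeasure_gammaMeasure (hs i k) (hr i k)
  rw [uKernel, Kernel.withDensity_apply _ (measurable_uDensity m y x).ennreal_ofReal]
  unfold gammaMeasure
  have hmeas : ∀ i k, Measurable (gammaPDF (uShape m y i k) (uRate x b i k)) := fun i k =>
    (measurable_gammaPDFReal _ _).ennreal_ofReal
  rw [pi_pi_withDensity hmeas, Kernel.const_apply]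
  congr 1
  ext u
  rw [uDensity_eq_prod, ENNReal.ofReal_prod_of_nonneg fun i _ => Finset.prod_nonneg fun k _ =>
    gammaPDFReal_nonneg (hs i k) (hr i k) _]
  refine Finset.prod_congr rfl fun i _ => ?_
  rw [ENNReal.ofReal_prod_of_nonneg fun k _ => gammaPDFReal_nonneg (hs i k) (hr i k) _]
  rfl

lemma isMarkovKernel_uKernel {m : Fin n → ℕ} (hm : ∀ i, 1 ≤ m i)
    {y : (i : Fin n) → Fin (q i + 1) → ℕ}
    (hy : ∀ (i : Fin n) (k : Fin (q i)), 1 ≤ y i k.succ)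
    (x : (i : Fin n) → Fin (q i) → Fin p → ℝ) : IsMarkovKernel (uKernel m y x) := by
  refine ⟨fun b => ?_⟩
  have : ∀ i k, IsProbabilityMeasure (gammaMeasure (uShape m y i k) (uRate x b i k)) := fun i k =>
    isProbabilityMeasure_gammaMeasure (uShape_pos hm hy i k) (uRate_pos x b i k)
  rw [uKernel_apply hm hy]
  infer_instance

lemma ae_uKernel_pos {m : Fin n → ℕ} (hm : ∀ i, 1 ≤ m i) {y : (i : Fin n) → Fin (q i + 1) → ℕ}
    (hy : ∀ (i : Fin n) (k : Fin (q i)), 1 ≤ y i k.succ)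
    (x : (i : Fin n) → Fin (q i) → Fin p → ℝ) (b : Fin p → ℝ) :
    ∀ᵐ u ∂(uKernel m y x b), ∀ i k, 0 < u i k := by
  have : ∀ i k, IsProbabilityMeasure (gammaMeasure (uShape m y i k) (uRate x b i k)) := fun i k =>
    isProbabilityMeasure_gammaMeasure (uShape_pos hm hy i k) (uRate_pos x b i k)
  rw [uKernel_apply hm hy]
  exact ae_pi_pi (P := fun _ _ z => 0 < z) fun i k => ae_pos_gammaMeasure _ _

lemma lintegral_uKernel_eval {m : Fin n → ℕ} (hm : ∀ i, 1 ≤ m i)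
    {y : (i : Fin n) → Fin (q i + 1) → ℕ}
    (hy : ∀ (i : Fin n) (k : Fin (q i)), 1 ≤ y i k.succ)
    (x : (i : Fin n) → Fin (q i) → Fin p → ℝ) (b : Fin p → ℝ) (i : Fin n) (k : Fin (q i + 1)) :
    ∫⁻ u, ENNReal.ofReal (u i k) ∂(uKernel m y x b) =
      ENNReal.ofReal (uShape m y i k / uRate x b i k) := by
  have : ∀ i k, IsProbabilityMeasure (gammaMeasure (uShape m y i k) (uRate x b i k)) := fun i k =>
    isProbabilityMeasure_gammaMeasure (uShape_pos hm hy i k) (uRate_pos x b i k)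
  rw [uKernel_apply hm hy, lintegral_pi_pi_eval (r := fun i => q i + 1)
      (ν := fun i k => gammaMeasure (uShape m y i k) (uRate x b i k)) i k ENNReal.measurable_ofReal,
    lintegral_id_gammaMeasure (uShape_pos hm hy i k) (uRate_pos x b i k)]

lemma invGaussPDF_nonneg (a v : ℝ) : 0 ≤ invGaussPDF (1 / a) 1 v := by
  unfold invGaussPDF
  split_ifs <;> positivity

/-- The parameter of the inverse Gaussian latent variables. -/
noncomputable def vParam (x : (i : Fin n) → Fin (q i) → Fin p → ℝ) (b : Fin p → ℝ)
    (u : LatentU q) (i : Fin n) (k : Fin (q i)) : ℝ :=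
  (u i k.succ + u i 0) * √(linPred x b i k ^ 2 + 4)

lemma vParam_pos (x : (i : Fin n) → Fin (q i) → Fin p → ℝ) (b : Fin p → ℝ)
    {u : LatentU q} (hu : ∀ i k, 0 < u i k) (i : Fin n) (k : Fin (q i)) :
    0 < vParam x b u i k :=
  mul_pos (add_pos (hu _ _) (hu _ _)) (sqrt_sq_add_four_pos _)

/-- Positive u makes every inverse Gaussian parameter positive. The sampler produces such u almost
surely, so later statements about v hold for almost every u. -/
lemma vKernel_apply (x : (i : Fin n) → Fin (q i) → Fin p → ℝ) (b : Fin p → ℝ) {u : LatentU q}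
    (hu : ∀ i k, 0 < u i k) :
    vKernel x (b, u) = Measure.pi fun i => Measure.pi fun k =>
      invGaussMeasure (vParam x b u i k) := by
  have : ∀ i k, IsProbabilityMeasure ((volume : Measure ℝ).withDensity
      fun v => ENNReal.ofReal (invGaussPDF (1 / vParam x b u i k) 1 v)) := fun i k =>
    isProbabilityMeasure_invGaussMeasure (vParam_pos x b hu i k)
  rw [vKernel, Kernel.withDensity_apply _ (measurable_vDensity x).ennreal_ofReal]
  unfold invGaussMeasure
  rw [pi_pi_withDensity fun i k => measurable_invGaussPDF _, Kernel.const_apply]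
  congr 1
  ext v
  rw [vDensity, ENNReal.ofReal_prod_of_nonneg fun i _ => Finset.prod_nonneg fun k _ =>
    invGaussPDF_nonneg _ _]
  refine Finset.prod_congr rfl fun i _ => ?_
  rw [ENNReal.ofReal_prod_of_nonneg fun k _ => invGaussPDF_nonneg _ _]
  rfl

lemma isProbabilityMeasure_vKernel (x : (i : Fin n) → Fin (q i) → Fin p → ℝ) (b : Fin p → ℝ)
    {u : LatentU q} (hu : ∀ i k, 0 < u i k) : IsProbabilityMeasure (vKernel x (b, u)) := by
  have : ∀ i k, IsProbabilityMeasure (invGaussMeasure (vParam x b u i k)) := fun i k =>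
    isProbabilityMeasure_invGaussMeasure (vParam_pos x b hu i k)
  rw [vKernel_apply x b hu]
  infer_instance

lemma ae_vKernel_pos (x : (i : Fin n) → Fin (q i) → Fin p → ℝ) (b : Fin p → ℝ) {u : LatentU q}
    (hu : ∀ i k, 0 < u i k) : ∀ᵐ v ∂(vKernel x (b, u)), ∀ i k, 0 < v i k := by
  have : ∀ i k, IsProbabilityMeasure (invGaussMeasure (vParam x b u i k)) := fun i k =>
    isProbabilityMeasure_invGaussMeasure (vParam_pos x b hu i k)
  rw [vKernel_apply x b hu]
  exact ae_pi_pi (P := fun _ _ z => 0 < z) fun i k => ae_pos_invGaussMeasure _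

lemma lintegral_vKernel_eval (x : (i : Fin n) → Fin (q i) → Fin p → ℝ) (b : Fin p → ℝ)
    {u : LatentU q} (hu : ∀ i k, 0 < u i k) (i : Fin n) (k : Fin (q i)) {f : ℝ → ℝ≥0∞}
    (hf : Measurable f) :
    ∫⁻ v, f (v i k) ∂(vKernel x (b, u)) = ∫⁻ z, f z ∂(invGaussMeasure (vParam x b u i k)) := by
  have : ∀ i k, IsProbabilityMeasure (invGaussMeasure (vParam x b u i k)) := fun i k =>
    isProbabilityMeasure_invGaussMeasure (vParam_pos x b hu i k)
  rw [vKernel_apply x b hu, lintegral_pi_pi_eval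
    (ν := fun i k => invGaussMeasure (vParam x b u i k)) i k hf]

lemma lintegral_bKernel (x : (i : Fin n) → Fin (q i) → Fin p → ℝ) (μ : Fin p → ℝ)
    (Ψ : Matrix (Fin p) (Fin p) ℝ) (u : LatentU q) (v : LatentV q) {f : (Fin p → ℝ) → ℝ≥0∞}
    (hf : Measurable f) :
    ∫⁻ b, f b ∂(bKernel x μ Ψ (u, v)) = ∫⁻ b, ENNReal.ofReal (bDensity x μ Ψ u v b) * f b := by
  rw [bKernel, Kernel.lintegral_withDensity _ (measurable_bDensity x μ Ψ).ennreal_ofReal _ hf,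
    Kernel.const_apply]

lemma isProbabilityMeasure_bKernel (x : (i : Fin n) → Fin (q i) → Fin p → ℝ) (μ : Fin p → ℝ)
    {Ψ : Matrix (Fin p) (Fin p) ℝ} (hΨ : Ψ.PosDef) (u : LatentU q) {v : LatentV q}
    (hv : ∀ i k, 0 < v i k) : IsProbabilityMeasure (bKernel x μ Ψ (u, v)) := by
  refine ⟨?_⟩
  rw [← lintegral_one, lintegral_bKernel _ _ _ _ _ measurable_const]
  simp only [mul_one]
  exact lintegral_normalPDF _ (posDef_postPrecision x hΨ hv)

lemma lintegral_gibbsKernel (m : Fin n → ℕ) (y : (i : Fin n) → Fin (q i + 1) → ℕ)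
    (x : (i : Fin n) → Fin (q i) → Fin p → ℝ) (μ : Fin p → ℝ) (Ψ : Matrix (Fin p) (Fin p) ℝ)
    (b : Fin p → ℝ) {f : (Fin p → ℝ) → ℝ≥0∞} (hf : Measurable f) :
    ∫⁻ c, f c ∂(gibbsKernel m y x μ Ψ b) =
      ∫⁻ u, ∫⁻ v, ∫⁻ c, f c ∂(bKernel x μ Ψ (u, v)) ∂(vKernel x (b, u)) ∂(uKernel m y x b) := by
  rw [gibbsKernel, Kernel.lintegral_comp _ _ _ hf,
    Kernel.lintegral_compProd _ _ _ hf.lintegral_kernel]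

lemma isMarkovKernel_gibbsKernel {m : Fin n → ℕ} (hm : ∀ i, 1 ≤ m i)
    {y : (i : Fin n) → Fin (q i + 1) → ℕ}
    (hy : ∀ (i : Fin n) (k : Fin (q i)), 1 ≤ y i k.succ)
    (x : (i : Fin n) → Fin (q i) → Fin p → ℝ) (μ : Fin p → ℝ) {Ψ : Matrix (Fin p) (Fin p) ℝ}
    (hΨ : Ψ.PosDef) : IsMarkovKernel (gibbsKernel m y x μ Ψ) := by
  refine ⟨fun b => ⟨?_⟩⟩
  have := isMarkovKernel_uKernel hm hy x
  rw [← lintegral_one, lintegral_gibbsKernel _ _ _ _ _ _ measurable_const]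
  -- The kernels for v and β are known to have mass one only at positive latent variables, which is
  -- enough almost surely.
  have h : ∀ᵐ u ∂(uKernel m y x b), ∫⁻ v, ∫⁻ _, 1 ∂(bKernel x μ Ψ (u, v)) ∂(vKernel x (b, u)) =
      1 := by
    filter_upwards [ae_uKernel_pos hm hy x b] with u hu
    have := isProbabilityMeasure_vKernel x b hu
    have h' : ∀ᵐ v ∂(vKernel x (b, u)), ∫⁻ _, 1 ∂(bKernel x μ Ψ (u, v)) = 1 := by
      filter_upwards [ae_vKernel_pos x b hu] with v hv
      have := isProbabilityMeasure_bKernel x μ hΨ u hv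
      simp
    rw [lintegral_congr_ae h']
    simp
  rw [lintegral_congr_ae h]
  simp

end MultinomialGibbs

/-! ### The joint density and invariance of the posterior -/

namespace MultinomialGibbs

variable {n p : ℕ} {q : Fin n → ℕ}

/-- The factors of the joint density that belong to one category other than the baseline. -/
lemma link_pow_mul_gamma_mul_invGauss (c : ℕ) (t u₀ : ℝ) {u₁ v : ℝ} (hu₁ : 0 < u₁)
    (hv : 0 < v) :
    link t ^ c * gammaPDFReal c (-t + √(t ^ 2 + 4)) u₁ *
        invGaussPDF (1 / ((u₁ + u₀) * √(t ^ 2 + 4))) 1 v =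
      2 ^ c / Real.Gamma c * u₁ ^ ((c : ℝ) - 1) * (√(1 / (2 * Real.pi)) * (1 / v ^ (3 / 2 : ℝ))) *
        Real.exp (-2 * (v * (u₁ + u₀) ^ 2) - 1 / (2 * v)) *
        Real.exp ((u₁ - u₀) * t - v * (u₁ + u₀) ^ 2 * t ^ 2 / 2) * Real.exp (2 * link t * u₀) := by
  have hs := sqrt_sq_add_four_pos t
  have hsq := Real.sq_sqrt (by positivity : 0 ≤ t ^ 2 + 4)
  -- The gamma rate is 2 / λ(t), so its normalizer cancels the power of the link function coming
  -- from the likelihood.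
  have hpow : (2 : ℝ) ^ c = (-t + √(t ^ 2 + 4)) ^ c * link t ^ c := by
    rw [← mul_pow, rate_mul_link]
  rw [gammaPDFReal, if_pos hu₁.le, invGaussPDF, if_pos hv, Real.rpow_natCast, hpow]
  -- With s = √(t² + 4), the terms in s add up to u₀ s = 2 λ(t) u₀ - t u₀. This yields the linear
  -- term (u₁ - u₀) t and leaves a factor exp(2 λ(t) u₀) for the baseline variable.
  have hexp : Real.exp (-((-t + √(t ^ 2 + 4)) * u₁)) *
      (Real.exp (1 / (1 / ((u₁ + u₀) * √(t ^ 2 + 4)))) *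
      Real.exp (-(1 / 2) * (1 / (1 / ((u₁ + u₀) * √(t ^ 2 + 4))) ^ 2 * v + 1 / v))) =
      Real.exp (-2 * (v * (u₁ + u₀) ^ 2) - 1 / (2 * v)) *
        (Real.exp ((u₁ - u₀) * t - v * (u₁ + u₀) ^ 2 * t ^ 2 / 2) *
          Real.exp (2 * link t * u₀)) := by
    simp only [← Real.exp_add]
    congr 1
    simp only [one_div, inv_inv, inv_pow, mul_pow, hsq, link, mul_inv]
    ring
  linear_combination ((-t + √(t ^ 2 + 4)) ^ c * link t ^ c / Real.Gamma c * u₁ ^ ((c : ℝ) - 1) *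
    (√(1 / (2 * Real.pi)) * (1 / v ^ (3 / 2 : ℝ)))) * hexp

/-- The density of the multinomial counts and of the latent variables, for one multinomial
observation, is up to a factor free of the parameter the exponential of a quadratic function. -/
lemma exists_factor_multinomial_mul_latent {r : ℕ} (m : ℕ) (y : Fin (r + 1) → ℕ)
    (hy : ∑ k, y k = m) {u : Fin (r + 1) → ℝ} {v : Fin r → ℝ} (hu : ∀ k, 0 < u k)
    (hv : ∀ k, 0 < v k) :
    ∃ A : ℝ, ∀ t : Fin r → ℝ,
      ((m ! : ℝ) / (∏ k, ((y k)! : ℝ)) * (1 / (1 + ∑ k, link (t k)) ^ (y 0)) *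
        ∏ k, (link (t k) / (1 + ∑ k, link (t k))) ^ (y k.succ)) *
      (gammaPDFReal m (2 + 2 * ∑ k, link (t k)) (u 0) *
        ∏ k : Fin r, gammaPDFReal (y k.succ) (-t k + √(t k ^ 2 + 4)) (u k.succ)) *
      ∏ k, invGaussPDF (1 / ((u k.succ + u 0) * √(t k ^ 2 + 4))) 1 (v k) =
      A * Real.exp (∑ k, ((u k.succ - u 0) * t k - v k * (u k.succ + u 0) ^ 2 * t k ^ 2 / 2)) := by
  refine ⟨(m ! : ℝ) / (∏ k, ((y k)! : ℝ)) *
    (2 ^ m / Real.Gamma m * u 0 ^ ((m : ℝ) - 1) * Real.exp (-(2 * u 0))) *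
    ∏ k, (2 ^ y k.succ / Real.Gamma (y k.succ) * u k.succ ^ ((y k.succ : ℝ) - 1) *
      (√(1 / (2 * Real.pi)) * (1 / v k ^ (3 / 2 : ℝ))) *
      Real.exp (-2 * (v k * (u k.succ + u 0) ^ 2) - 1 / (2 * v k))), fun t => ?_⟩
  set L := ∑ k, link (t k) with hL
  have hL0 : 0 ≤ L := Finset.sum_nonneg fun _ _ => (link_pos _).le
  have hL1 : 0 < 1 + L := by linarith
  have h1 : ∏ k, (link (t k) ^ y k.succ * gammaPDFReal (y k.succ) (-t k + √(t k ^ 2 + 4))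
      (u k.succ) * invGaussPDF (1 / ((u k.succ + u 0) * √(t k ^ 2 + 4))) 1 (v k)) =
      ∏ k, _ := Finset.prod_congr rfl fun k _ =>
        link_pow_mul_gamma_mul_invGauss (y k.succ) (t k) (u 0) (hu k.succ) (hv k)
  rw [Finset.prod_mul_distrib, Finset.prod_mul_distrib, Finset.prod_mul_distrib,
    Finset.prod_mul_distrib, ← Real.exp_sum, ← Real.exp_sum, ← Finset.sum_mul, ← Finset.mul_sum,
    ← hL] at h1
  have h2 : gammaPDFReal m (2 + 2 * L) (u 0) = (1 + L) ^ m * (2 ^ m / Real.Gamma m *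
      u 0 ^ ((m : ℝ) - 1) * Real.exp (-(2 * u 0))) * Real.exp (-(2 * L * u 0)) := by
    rw [gammaPDFReal, if_pos (hu 0).le, Real.rpow_natCast,
      show 2 + 2 * L = (1 + L) * 2 by ring, mul_pow,
      show -((1 + L) * 2 * u 0) = -(2 * u 0) + -(2 * L * u 0) by ring, Real.exp_add]
    ring
  have h3 : ∏ k, (link (t k) / (1 + L)) ^ (y k.succ) =
      (∏ k, link (t k) ^ y k.succ) / (1 + L) ^ (∑ k : Fin r, y k.succ) := by
    simp_rw [div_pow]
    rw [Finset.prod_div_distrib, Finset.prod_pow_eq_pow_sum]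
  -- Since the counts add up to m, the normalizer of the baseline gamma density cancels all
  -- denominators of the likelihood.
  have h4 : (1 + L) ^ m = (1 + L) ^ (y 0) * (1 + L) ^ (∑ k : Fin r, y k.succ) := by
    rw [← pow_add, ← hy, Fin.sum_univ_succ]
  -- The factors left over from the categories are cancelled by the part of the baseline gamma rate
  -- that depends on Λ.
  have h5 : Real.exp (-(2 * L * u 0)) * Real.exp (2 * L * u 0) = 1 := by
    rw [← Real.exp_add]; simp
  rw [h2, h3, h4]
  have hp1 : (1 + L) ^ (y 0) ≠ 0 := by positivity
  have hp2 : (1 + L) ^ (∑ k : Fin r, y k.succ) ≠ 0 := by positivity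
  generalize (m ! : ℝ) / (∏ k, ((y k)! : ℝ)) = M at *
  generalize 2 ^ m / Real.Gamma m * u 0 ^ ((m : ℝ) - 1) * Real.exp (-(2 * u 0)) = N at *
  generalize Real.exp (-(2 * L * u 0)) = e1 at *
  generalize Real.exp (2 * L * u 0) = e2 at *
  generalize (1 + L) ^ (y 0) = a1 at *
  generalize (1 + L) ^ (∑ k : Fin r, y k.succ) = a2 at *
  have h6 : M * (1 / a1) * ((∏ k, link (t k) ^ y k.succ) / a2) *
      (a1 * a2 * N * e1 * ∏ k : Fin r, gammaPDFReal (y k.succ) (-t k + √(t k ^ 2 + 4))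
        (u k.succ)) * ∏ k, invGaussPDF (1 / ((u k.succ + u 0) * √(t k ^ 2 + 4))) 1 (v k) =
      M * N * e1 * ((∏ k, link (t k) ^ y k.succ) *
        (∏ k : Fin r, gammaPDFReal (y k.succ) (-t k + √(t k ^ 2 + 4)) (u k.succ)) *
        ∏ k, invGaussPDF (1 / ((u k.succ + u 0) * √(t k ^ 2 + 4))) 1 (v k)) := by
    field_simp
  rw [h6, h1]
  linear_combination (M * N * (∏ k, (2 ^ y k.succ / Real.Gamma (y k.succ) *
    u k.succ ^ ((y k.succ : ℝ) - 1) * (√(1 / (2 * Real.pi)) * (1 / v k ^ (3 / 2 : ℝ))) *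
      Real.exp (-2 * (v k * (u k.succ + u 0) ^ 2) - 1 / (2 * v k)))) *
      Real.exp (∑ k, ((u k.succ - u 0) * t k - v k * (u k.succ + u 0) ^ 2 * t k ^ 2 / 2))) * h5

/-- The joint density of `(β, u, v)` is proportional, as a function of `β`, to the conditional
density of `β`. -/
lemma exists_joint_eq_mul_bDensity {m : Fin n → ℕ} {y : (i : Fin n) → Fin (q i + 1) → ℕ}
    (hy_sum : ∀ i, ∑ k, y i k = m i) (x : (i : Fin n) → Fin (q i) → Fin p → ℝ)
    (μ : Fin p → ℝ) {Ψ : Matrix (Fin p) (Fin p) ℝ} (hΨ : Ψ.PosDef) {u : LatentU q} {v : LatentV q}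
    (hu : ∀ i k, 0 < u i k) (hv : ∀ i k, 0 < v i k) :
    ∃ G : ℝ, ∀ b, normalPDF μ Ψ b * likelihood m y x b * uDensity m y x b u * vDensity x b u v =
      G * bDensity x μ Ψ u v b := by
  choose A hA using fun i => exists_factor_multinomial_mul_latent (m i) (y i) (hy_sum i) (hu i) (hv i)
  set w := postMean x μ Ψ u v with hw
  set Q := postPrecision x Ψ u v with hQdef
  have hQ : Q.PosDef := posDef_postPrecision x hΨ hv
  set c := w ⬝ᵥ (Q *ᵥ w) - μ ⬝ᵥ (Ψ *ᵥ μ) with hc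
  set d := √(Q.det / (2 * Real.pi) ^ p) with hd
  have hd0 : d ≠ 0 := by
    have := hQ.det_pos
    have := Real.pi_pos
    exact (Real.sqrt_pos.2 (by positivity)).ne'
  refine ⟨√(Ψ.det / (2 * Real.pi) ^ p) * (∏ i, A i) / (d * Real.exp (-(1 / 2) * c)), fun b => ?_⟩
  have h1 : likelihood m y x b * uDensity m y x b u * vDensity x b u v = (∏ i, A i) *
      Real.exp (∑ i, ∑ k : Fin (q i), ((u i k.succ - u i 0) * linPred x b i k -
        v i k * (u i k.succ + u i 0) ^ 2 * linPred x b i k ^ 2 / 2)) := by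
    rw [Real.exp_sum, likelihood, uDensity, vDensity, ← Finset.prod_mul_distrib,
      ← Finset.prod_mul_distrib, ← Finset.prod_mul_distrib]
    exact Finset.prod_congr rfl fun i _ => hA i (linPred x b i)
  have h2 := quad_postPrecision_sub_postMean x μ hΨ (u := u) hv b
  have h3 : ∑ i, ∑ k : Fin (q i), (v i k * (u i k.succ + u i 0) ^ 2 * linPred x b i k ^ 2 -
        2 * ((u i k.succ - u i 0) * linPred x b i k)) = -2 *
      ∑ i, ∑ k : Fin (q i), ((u i k.succ - u i 0) * linPred x b i k -
        v i k * (u i k.succ + u i 0) ^ 2 * linPred x b i k ^ 2 / 2) := by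
    rw [Finset.mul_sum]
    refine Finset.sum_congr rfl fun i _ => ?_
    rw [Finset.mul_sum]
    exact Finset.sum_congr rfl fun k _ => by ring
  rw [h3, ← hw, ← hQdef, ← hc] at h2
  rw [mul_assoc, mul_assoc, ← mul_assoc (likelihood m y x b), h1, bDensity, normalPDF, normalPDF,
    ← hw, ← hQdef, h2, ← hd, mul_add, mul_add, Real.exp_add, Real.exp_add]
  have h4 : ∀ t : ℝ, -(1 / 2) * (-2 * t) = t := fun t => by ring
  rw [h4]
  field_simp

lemma likelihood_pos (m : Fin n → ℕ) (y : (i : Fin n) → Fin (q i + 1) → ℕ)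
    (x : (i : Fin n) → Fin (q i) → Fin p → ℝ) (b : Fin p → ℝ) : 0 < likelihood m y x b := by
  refine Finset.prod_pos fun i _ => ?_
  have h1 : 0 < 1 + linkSum x b i := by have := linkSum_nonneg x b i; linarith
  have h2 : ∀ k, 0 < link (linPred x b i k) := fun k => link_pos _
  refine mul_pos (mul_pos (div_pos (by positivity) (Finset.prod_pos fun k _ => by positivity))
    (by positivity)) (Finset.prod_pos fun k _ => pow_pos (div_pos (h2 k) h1) _)

/-- Every cell probability is at most 1. Boundedness makes the posterior normalizable and lets it
inherit the moments of the prior. -/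
lemma likelihood_le (m : Fin n → ℕ) (y : (i : Fin n) → Fin (q i + 1) → ℕ)
    (x : (i : Fin n) → Fin (q i) → Fin p → ℝ) (b : Fin p → ℝ) :
    likelihood m y x b ≤ ∏ i, ((m i)! : ℝ) / (∏ k, ((y i k)! : ℝ)) := by
  have h1 : ∀ i, 1 ≤ 1 + linkSum x b i := fun i => by have := linkSum_nonneg x b i; linarith
  have h2 : ∀ i k, 0 < link (linPred x b i k) := fun i k => link_pos _
  have h3 : ∀ i (k : Fin (q i)), 0 ≤ link (linPred x b i k) / (1 + linkSum x b i) := fun i k =>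
    div_nonneg (h2 i k).le (zero_le_one.trans (h1 i))
  have h4 : ∀ i (k : Fin (q i)), link (linPred x b i k) / (1 + linkSum x b i) ≤ 1 := fun i k => by
    refine (div_le_one (one_pos.trans_le (h1 i))).2 ?_
    have := Finset.single_le_sum (f := fun k => link (linPred x b i k))
      (fun k _ => (h2 i k).le) (Finset.mem_univ k)
    exact this.trans (by unfold linkSum; linarith)
  have h5 : ∀ i, 0 ≤ 1 / (1 + linkSum x b i) ^ (y i 0) := fun i =>
    div_nonneg zero_le_one (pow_nonneg (zero_le_one.trans (h1 i)) _)
  refine Finset.prod_le_prod (fun i _ => ?_) fun i _ => ?_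
  · exact mul_nonneg (mul_nonneg (by positivity) (h5 i))
      (Finset.prod_nonneg fun k _ => pow_nonneg (h3 i k) _)
  · rw [mul_assoc]
    refine mul_le_of_le_one_right (by positivity) (mul_le_one₀ ?_
      (Finset.prod_nonneg fun k _ => pow_nonneg (h3 i k) _)
      (Finset.prod_le_one (fun k _ => pow_nonneg (h3 i k) _) fun k _ => pow_le_one₀ (h3 i k) (h4 i k)))
    exact div_le_one_of_le₀ (one_le_pow₀ (h1 i)) (pow_nonneg (zero_le_one.trans (h1 i)) _)

lemma isProbabilityMeasure_prior (μ : Fin p → ℝ) {Ψ : Matrix (Fin p) (Fin p) ℝ}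
    (hΨ : Ψ.PosDef) : IsProbabilityMeasure (prior μ Ψ) := by
  refine ⟨?_⟩
  rw [prior, withDensity_apply _ MeasurableSet.univ, Measure.restrict_univ,
    lintegral_normalPDF μ hΨ]

lemma lintegral_likelihood_ne_zero (m : Fin n → ℕ) (y : (i : Fin n) → Fin (q i + 1) → ℕ)
    (x : (i : Fin n) → Fin (q i) → Fin p → ℝ) (μ : Fin p → ℝ) {Ψ : Matrix (Fin p) (Fin p) ℝ}
    (hΨ : Ψ.PosDef) : ∫⁻ b, ENNReal.ofReal (likelihood m y x b) ∂(prior μ Ψ) ≠ 0 := by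
  have := isProbabilityMeasure_prior μ hΨ
  rw [Ne, lintegral_eq_zero_iff (measurable_likelihood m y x).ennreal_ofReal]
  intro h
  have : ∀ᵐ b ∂(prior μ Ψ), False := by
    filter_upwards [h] with b hb
    exact (ENNReal.ofReal_pos.2 (likelihood_pos m y x b)).ne' hb
  rw [ae_iff] at this
  simp at this

lemma lintegral_likelihood_mul_le (m : Fin n → ℕ) (y : (i : Fin n) → Fin (q i + 1) → ℕ)
    (x : (i : Fin n) → Fin (q i) → Fin p → ℝ) (μ : Fin p → ℝ) (Ψ : Matrix (Fin p) (Fin p) ℝ)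
    (f : (Fin p → ℝ) → ℝ≥0∞) :
    ∫⁻ b, ENNReal.ofReal (likelihood m y x b) * f b ∂(prior μ Ψ) ≤
      ENNReal.ofReal (∏ i, ((m i)! : ℝ) / (∏ k, ((y i k)! : ℝ))) * ∫⁻ b, f b ∂(prior μ Ψ) := by
  rw [← lintegral_const_mul' _ _ ENNReal.ofReal_ne_top]
  exact lintegral_mono fun b => mul_le_mul_left (ENNReal.ofReal_le_ofReal (likelihood_le m y x b)) _

lemma lintegral_likelihood_ne_top (m : Fin n → ℕ) (y : (i : Fin n) → Fin (q i + 1) → ℕ)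
    (x : (i : Fin n) → Fin (q i) → Fin p → ℝ) (μ : Fin p → ℝ) {Ψ : Matrix (Fin p) (Fin p) ℝ}
    (hΨ : Ψ.PosDef) : ∫⁻ b, ENNReal.ofReal (likelihood m y x b) ∂(prior μ Ψ) ≠ ∞ := by
  have := isProbabilityMeasure_prior μ hΨ
  have := lintegral_likelihood_mul_le m y x μ Ψ fun _ => 1
  simp only [mul_one, lintegral_const, measure_univ] at this
  exact ne_top_of_le_ne_top ENNReal.ofReal_ne_top this

lemma isProbabilityMeasure_posterior (m : Fin n → ℕ) (y : (i : Fin n) → Fin (q i + 1) → ℕ)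
    (x : (i : Fin n) → Fin (q i) → Fin p → ℝ) (μ : Fin p → ℝ) {Ψ : Matrix (Fin p) (Fin p) ℝ}
    (hΨ : Ψ.PosDef) : IsProbabilityMeasure (posterior m y x μ Ψ) := by
  refine ⟨?_⟩
  rw [posterior, Measure.smul_apply, withDensity_apply _ MeasurableSet.univ,
    Measure.restrict_univ, smul_eq_mul, ENNReal.inv_mul_cancel
      (lintegral_likelihood_ne_zero m y x μ hΨ) (lintegral_likelihood_ne_top m y x μ hΨ)]

lemma uDensity_eq_zero_of_neg (m : Fin n → ℕ) (y : (i : Fin n) → Fin (q i + 1) → ℕ)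
    (x : (i : Fin n) → Fin (q i) → Fin p → ℝ) (b : Fin p → ℝ) {u : LatentU q} {i : Fin n}
    {k : Fin (q i + 1)} (hu : u i k < 0) : uDensity m y x b u = 0 := by
  rw [uDensity_eq_prod]
  exact Finset.prod_eq_zero (Finset.mem_univ i) (Finset.prod_eq_zero (Finset.mem_univ k)
    (by rw [gammaPDFReal, if_neg (not_le.2 hu)]))

lemma vDensity_eq_zero_of_nonpos (x : (i : Fin n) → Fin (q i) → Fin p → ℝ) (b : Fin p → ℝ)
    (u : LatentU q) {v : LatentV q} {i : Fin n} {k : Fin (q i)} (hv : v i k ≤ 0) :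
    vDensity x b u v = 0 :=
  Finset.prod_eq_zero (Finset.mem_univ i) (Finset.prod_eq_zero (Finset.mem_univ k)
    (by rw [invGaussPDF, if_neg (not_lt.2 hv)]))

lemma uDensity_nonneg {m : Fin n → ℕ} (hm : ∀ i, 1 ≤ m i) {y : (i : Fin n) → Fin (q i + 1) → ℕ}
    (hy : ∀ (i : Fin n) (k : Fin (q i)), 1 ≤ y i k.succ)
    (x : (i : Fin n) → Fin (q i) → Fin p → ℝ) (b : Fin p → ℝ) (u : LatentU q) :
    0 ≤ uDensity m y x b u := by
  rw [uDensity_eq_prod]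
  exact Finset.prod_nonneg fun i _ => Finset.prod_nonneg fun k _ =>
    gammaPDFReal_nonneg (uShape_pos hm hy i k) (uRate_pos x b i k) _

/-- The joint density of `(β, u, v)`, up to a constant factor. -/
noncomputable def jointDensity (m : Fin n → ℕ) (y : (i : Fin n) → Fin (q i + 1) → ℕ)
    (x : (i : Fin n) → Fin (q i) → Fin p → ℝ) (μ : Fin p → ℝ) (Ψ : Matrix (Fin p) (Fin p) ℝ)
    (b : Fin p → ℝ) (u : LatentU q) (v : LatentV q) : ℝ≥0∞ :=
  ENNReal.ofReal (normalPDF μ Ψ b) * ENNReal.ofReal (likelihood m y x b) *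
    ENNReal.ofReal (uDensity m y x b u) * ENNReal.ofReal (vDensity x b u v)

lemma measurable_jointDensity (m : Fin n → ℕ) (y : (i : Fin n) → Fin (q i + 1) → ℕ)
    (x : (i : Fin n) → Fin (q i) → Fin p → ℝ) (μ : Fin p → ℝ) (Ψ : Matrix (Fin p) (Fin p) ℝ) :
    Measurable fun z : (Fin p → ℝ) × LatentU q × LatentV q =>
      jointDensity m y x μ Ψ z.1 z.2.1 z.2.2 := by
  have h1 : Measurable fun z : (Fin p → ℝ) × LatentU q × LatentV q => normalPDF μ Ψ z.1 :=
    (continuous_normalPDF μ Ψ).measurable.comp measurable_fst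
  have h2 : Measurable fun z : (Fin p → ℝ) × LatentU q × LatentV q => likelihood m y x z.1 :=
    (measurable_likelihood m y x).comp measurable_fst
  have e3 : Measurable fun z : (Fin p → ℝ) × LatentU q × LatentV q => (z.1, z.2.1) :=
    measurable_fst.prodMk (measurable_fst.comp measurable_snd)
  have h3 : Measurable fun z : (Fin p → ℝ) × LatentU q × LatentV q =>
      uDensity m y x z.1 z.2.1 := by
    simpa only [Function.comp_def, Function.uncurry_def] using (measurable_uDensity m y x).comp e3
  have h4 : Measurable fun z : (Fin p → ℝ) × LatentU q × LatentV q =>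
      vDensity x z.1 z.2.1 z.2.2 := by
    simpa only [Function.comp_def, Function.uncurry_def] using
      (measurable_vDensity x).comp (e3.prodMk (measurable_snd.comp measurable_snd))
  exact ((h1.ennreal_ofReal.mul h2.ennreal_ofReal).mul h3.ennreal_ofReal).mul h4.ennreal_ofReal

/-- The conditional distribution of `β` under the joint density is the one that the sampler uses. -/
lemma lintegral_jointDensity_mul_bKernel {m : Fin n → ℕ} (hm : ∀ i, 1 ≤ m i)
    {y : (i : Fin n) → Fin (q i + 1) → ℕ} (hy_sum : ∀ i, ∑ k, y i k = m i)
    (hy : ∀ (i : Fin n) (k : Fin (q i)), 1 ≤ y i k.succ)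
    (x : (i : Fin n) → Fin (q i) → Fin p → ℝ) (μ : Fin p → ℝ) {Ψ : Matrix (Fin p) (Fin p) ℝ}
    (hΨ : Ψ.PosDef) {u : LatentU q} (hu : ∀ i k, u i k ≠ 0) (v : LatentV q)
    {f : (Fin p → ℝ) → ℝ≥0∞} (hf : Measurable f) :
    ∫⁻ b, jointDensity m y x μ Ψ b u v * ∫⁻ c, f c ∂(bKernel x μ Ψ (u, v)) =
      ∫⁻ b, jointDensity m y x μ Ψ b u v * f b := by
  -- Off the positive orthants the joint density vanishes and both sides are zero. Zero coordinates
  -- of u are excluded by hypothesis because a gamma density need not vanish there.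
  by_cases hu' : ∀ i k, 0 < u i k
  swap
  · push Not at hu'
    obtain ⟨i, k, hik⟩ := hu'
    have h : ∀ b, jointDensity m y x μ Ψ b u v = 0 := fun b => by
      rw [jointDensity, uDensity_eq_zero_of_neg m y x b (lt_of_le_of_ne hik (hu i k))]
      simp
    simp [h]
  by_cases hv' : ∀ i k, 0 < v i k
  swap
  · push Not at hv'
    obtain ⟨i, k, hik⟩ := hv'
    have h : ∀ b, jointDensity m y x μ Ψ b u v = 0 := fun b => by
      rw [jointDensity, vDensity_eq_zero_of_nonpos x b u hik]
      simp
    simp [h]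
  obtain ⟨G, hG⟩ := exists_joint_eq_mul_bDensity hy_sum x μ hΨ hu' hv'
  -- The sign of G need not be known: the product splits because the normal density is nonnegative.
  have h : ∀ b, jointDensity m y x μ Ψ b u v =
      ENNReal.ofReal G * ENNReal.ofReal (bDensity x μ Ψ u v b) := fun b => by
    rw [← ENNReal.ofReal_mul' (q := bDensity x μ Ψ u v b) (normalPDF_nonneg _ _ _), ← hG,
      jointDensity,
      ENNReal.ofReal_mul (mul_nonneg (mul_nonneg (normalPDF_nonneg _ _ _)
        (likelihood_pos _ _ _ _).le) (uDensity_nonneg hm hy x b u)),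
      ENNReal.ofReal_mul (mul_nonneg (normalPDF_nonneg _ _ _) (likelihood_pos _ _ _ _).le),
      ENNReal.ofReal_mul (normalPDF_nonneg _ _ _)]
  have hb : Measurable fun b => ENNReal.ofReal (bDensity x μ Ψ u v b) :=
    (continuous_normalPDF _ _).measurable.ennreal_ofReal
  have h1 : ∫⁻ b, ENNReal.ofReal (bDensity x μ Ψ u v b) = 1 :=
    lintegral_normalPDF _ (posDef_postPrecision x hΨ hv')
  simp_rw [h]
  rw [lintegral_mul_const _ (hb.const_mul _), lintegral_const_mul _ hb, h1, mul_one,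
    lintegral_bKernel x μ Ψ u v hf, ← lintegral_const_mul' _ _ ENNReal.ofReal_ne_top]
  simp_rw [mul_assoc]

lemma ae_forall_ne_zero : ∀ᵐ u : LatentU q, ∀ i k, u i k ≠ 0 := by
  have := ae_pi_pi (ν := fun i (_ : Fin (q i + 1)) => (volume : Measure ℝ))
    (P := fun _ _ z => z ≠ 0) fun i k => Measure.ae_ne volume (0 : ℝ)
  simp_rw [← volume_pi] at this
  exact this

lemma lintegral_uKernel_vKernel (m : Fin n → ℕ) (y : (i : Fin n) → Fin (q i + 1) → ℕ)
    (x : (i : Fin n) → Fin (q i) → Fin p → ℝ) (b : Fin p → ℝ) {F : LatentU q → LatentV q → ℝ≥0∞}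
    (hF : Measurable (Function.uncurry F)) :
    ∫⁻ u, ∫⁻ v, F u v ∂(vKernel x (b, u)) ∂(uKernel m y x b) =
      ∫⁻ u, ∫⁻ v, ENNReal.ofReal (uDensity m y x b u) * ENNReal.ofReal (vDensity x b u v) *
        F u v := by
  have hv : ∀ u, ∫⁻ v, F u v ∂(vKernel x (b, u)) =
      ∫⁻ v, ENNReal.ofReal (vDensity x b u v) * F u v := fun u => by
    rw [vKernel, Kernel.lintegral_withDensity _ (measurable_vDensity x).ennreal_ofReal _
      (hF.of_uncurry_left (x := u)), Kernel.const_apply]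
  simp_rw [hv]
  have hm : Measurable fun z : LatentU q × LatentV q =>
      ENNReal.ofReal (vDensity x b z.1 z.2) * F z.1 z.2 :=
    (((measurable_vDensity x).comp ((measurable_const.prodMk measurable_fst).prodMk
      measurable_snd)).ennreal_ofReal).mul hF
  rw [uKernel, Kernel.lintegral_withDensity _ (measurable_uDensity m y x).ennreal_ofReal _
    hm.lintegral_prod_right', Kernel.const_apply]
  refine lintegral_congr fun u => ?_
  rw [← lintegral_const_mul' _ _ ENNReal.ofReal_ne_top]
  simp_rw [mul_assoc]

/-- Integrating out the latent variables of the joint density. -/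
lemma lintegral_jointDensity_latent {m : Fin n → ℕ} (hm : ∀ i, 1 ≤ m i)
    {y : (i : Fin n) → Fin (q i + 1) → ℕ}
    (hy : ∀ (i : Fin n) (k : Fin (q i)), 1 ≤ y i k.succ)
    (x : (i : Fin n) → Fin (q i) → Fin p → ℝ) (μ : Fin p → ℝ) (Ψ : Matrix (Fin p) (Fin p) ℝ)
    (b : Fin p → ℝ) :
    ∫⁻ u, ∫⁻ v, jointDensity m y x μ Ψ b u v =
      ENNReal.ofReal (normalPDF μ Ψ b) * ENNReal.ofReal (likelihood m y x b) := by
  have := isMarkovKernel_uKernel hm hy x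
  have h1 : ∫⁻ u, ∫⁻ _, 1 ∂(vKernel x (b, u)) ∂(uKernel m y x b) = 1 := by
    have h : ∀ᵐ u ∂(uKernel m y x b), ∫⁻ _, 1 ∂(vKernel x (b, u)) = 1 := by
      filter_upwards [ae_uKernel_pos hm hy x b] with u hu
      have := isProbabilityMeasure_vKernel x b hu
      simp
    rw [lintegral_congr_ae h]
    simp
  rw [lintegral_uKernel_vKernel m y x b (F := fun _ _ => 1) measurable_const] at h1
  simp only [mul_one] at h1
  unfold jointDensity
  simp_rw [mul_assoc]
  have hne : ENNReal.ofReal (normalPDF μ Ψ b) * ENNReal.ofReal (likelihood m y x b) ≠ ∞ :=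
    ENNReal.mul_ne_top ENNReal.ofReal_ne_top ENNReal.ofReal_ne_top
  simp_rw [← mul_assoc (ENNReal.ofReal (normalPDF μ Ψ b)) (ENNReal.ofReal (likelihood m y x b))]
  simp_rw [lintegral_const_mul' _ _ hne]
  rw [h1, mul_one]

lemma lintegral_prior_likelihood (m : Fin n → ℕ) (y : (i : Fin n) → Fin (q i + 1) → ℕ)
    (x : (i : Fin n) → Fin (q i) → Fin p → ℝ) (μ : Fin p → ℝ) (Ψ : Matrix (Fin p) (Fin p) ℝ)
    {f : (Fin p → ℝ) → ℝ≥0∞} (hf : Measurable f) :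
    ∫⁻ b, f b ∂((prior μ Ψ).withDensity fun b => ENNReal.ofReal (likelihood m y x b)) =
      ∫⁻ b, ENNReal.ofReal (normalPDF μ Ψ b) * ENNReal.ofReal (likelihood m y x b) * f b := by
  have h1 : Measurable fun b => ENNReal.ofReal (likelihood m y x b) :=
    (measurable_likelihood m y x).ennreal_ofReal
  have h2 : Measurable fun b => ENNReal.ofReal (normalPDF μ Ψ b) :=
    (continuous_normalPDF μ Ψ).measurable.ennreal_ofReal
  rw [lintegral_withDensity_eq_lintegral_mul _ h1 hf, prior,
    lintegral_withDensity_eq_lintegral_mul _ h2 (h1.mul hf)]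
  simp only [Pi.mul_apply, mul_assoc]

/-- The posterior distribution is invariant for the Gibbs sampler. -/
theorem invariant_gibbsKernel_posterior {m : Fin n → ℕ} (hm : ∀ i, 1 ≤ m i)
    {y : (i : Fin n) → Fin (q i + 1) → ℕ} (hy_sum : ∀ i, ∑ k, y i k = m i)
    (hy : ∀ (i : Fin n) (k : Fin (q i)), 1 ≤ y i k.succ)
    (x : (i : Fin n) → Fin (q i) → Fin p → ℝ) (μ : Fin p → ℝ) {Ψ : Matrix (Fin p) (Fin p) ℝ}
    (hΨ : Ψ.PosDef) : Kernel.Invariant (gibbsKernel m y x μ Ψ) (posterior m y x μ Ψ) := by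
  ext A hA
  rw [Measure.bind_apply hA (Kernel.aemeasurable _), posterior, lintegral_smul_measure,
    Measure.smul_apply]
  congr 1
  set f : (Fin p → ℝ) → ℝ≥0∞ := A.indicator 1 with hf
  have hfm : Measurable f := measurable_one.indicator hA
  rw [lintegral_prior_likelihood m y x μ Ψ (Kernel.measurable_coe _ hA),
    ← lintegral_indicator_one hA, lintegral_prior_likelihood m y x μ Ψ hfm]
  have hg : Measurable fun z : LatentU q × LatentV q => ∫⁻ c, f c ∂(bKernel x μ Ψ z) :=
    hfm.lintegral_kernel
  have hJ := measurable_jointDensity m y x μ Ψ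
  -- Both sides of the invariance identity become integrals against the joint density: on the left f
  -- is averaged over the new β, on the right it is evaluated at the old one.
  have hleft : ∀ b, ENNReal.ofReal (normalPDF μ Ψ b) * ENNReal.ofReal (likelihood m y x b) *
      gibbsKernel m y x μ Ψ b A =
      ∫⁻ u, ∫⁻ v, jointDensity m y x μ Ψ b u v * ∫⁻ c, f c ∂(bKernel x μ Ψ (u, v)) := by
    intro b
    rw [← lintegral_indicator_one hA, lintegral_gibbsKernel m y x μ Ψ b hfm,
      lintegral_uKernel_vKernel m y x b
      (F := fun u v => ∫⁻ c, f c ∂(bKernel x μ Ψ (u, v))) hg]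
    have hne : ENNReal.ofReal (normalPDF μ Ψ b) * ENNReal.ofReal (likelihood m y x b) ≠ ∞ :=
      ENNReal.mul_ne_top ENNReal.ofReal_ne_top ENNReal.ofReal_ne_top
    simp_rw [← lintegral_const_mul' _ _ hne, jointDensity, mul_assoc]
  have hright : ∀ b, ENNReal.ofReal (normalPDF μ Ψ b) * ENNReal.ofReal (likelihood m y x b) *
      f b = ∫⁻ u, ∫⁻ v, jointDensity m y x μ Ψ b u v * f b := by
    intro b
    have hfb : f b ≠ ∞ := by
      rw [hf]
      by_cases hb : b ∈ A <;> simp [hb]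
    rw [← lintegral_jointDensity_latent hm hy x μ Ψ b]
    simp_rw [lintegral_mul_const' _ _ hfb]
  have swap : ∀ F : (Fin p → ℝ) → LatentU q → LatentV q → ℝ≥0∞,
      Measurable (fun z : (Fin p → ℝ) × LatentU q × LatentV q => F z.1 z.2.1 z.2.2) →
      ∫⁻ b, ∫⁻ u, ∫⁻ v, F b u v = ∫⁻ u, ∫⁻ v, ∫⁻ b, F b u v := by
    intro F hF
    have h1 : Measurable fun z : ((Fin p → ℝ) × LatentU q) × LatentV q => F z.1.1 z.1.2 z.2 :=
      hF.comp (measurable_fst.fst.prodMk (measurable_fst.snd.prodMk measurable_snd))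
    rw [lintegral_lintegral_swap (Measurable.aemeasurable h1.lintegral_prod_right')]
    refine lintegral_congr fun u => ?_
    have h2 : Measurable fun z : (Fin p → ℝ) × LatentV q => F z.1 u z.2 :=
      hF.comp (measurable_fst.prodMk (measurable_const.prodMk measurable_snd))
    exact lintegral_lintegral_swap h2.aemeasurable
  simp_rw [hleft, hright]
  -- With β innermost, only the identity at fixed latent variables remains: redrawing β from its
  -- conditional law preserves the integral.
  rw [swap _ (hJ.mul (hg.comp measurable_snd)), swap _ (hJ.mul (hfm.comp measurable_fst))]
  refine lintegral_congr_ae ?_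
  filter_upwards [ae_forall_ne_zero] with u hu
  exact lintegral_congr fun v => lintegral_jointDensity_mul_bKernel hm hy_sum hy x μ hΨ hu v hfm

end MultinomialGibbs

/-! ### The drift condition -/

namespace MultinomialGibbs

variable {n p : ℕ} {q : Fin n → ℕ}

/-- The drift function `(β - μ)ᵀ Ψ (β - μ)`. -/
def driftFun (μ : Fin p → ℝ) (Ψ : Matrix (Fin p) (Fin p) ℝ) (b : Fin p → ℝ) : ℝ :=
  (b - μ) ⬝ᵥ (Ψ *ᵥ (b - μ))

lemma continuous_driftFun (μ : Fin p → ℝ) (Ψ : Matrix (Fin p) (Fin p) ℝ) :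
    Continuous (driftFun μ Ψ) := by
  unfold driftFun
  fun_prop

lemma driftFun_nonneg (μ : Fin p → ℝ) {Ψ : Matrix (Fin p) (Fin p) ℝ} (hΨ : Ψ.PosDef)
    (b : Fin p → ℝ) : 0 ≤ driftFun μ Ψ b := hΨ.dotProduct_mulVec_self_nonneg _

/-- Young's inequality for the form Ψ, from its nonnegativity at ηa - b. The parameter η lets the
first coefficient be as close to 1 as needed. -/
lemma quad_add_le {Ψ : Matrix (Fin p) (Fin p) ℝ} (hΨ : Ψ.PosDef) {η : ℝ} (hη : 0 < η)
    (a b : Fin p → ℝ) :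
    (a + b) ⬝ᵥ (Ψ *ᵥ (a + b)) ≤ (1 + η) * (a ⬝ᵥ (Ψ *ᵥ a)) + (1 + 1 / η) * (b ⬝ᵥ (Ψ *ᵥ b)) := by
  have h := hΨ.dotProduct_mulVec_self_nonneg (η • a - b)
  simp only [Matrix.mulVec_sub, Matrix.mulVec_smul, sub_dotProduct, dotProduct_sub,
    smul_dotProduct, dotProduct_smul, smul_eq_mul] at h
  simp only [Matrix.mulVec_add, add_dotProduct, dotProduct_add]
  rw [hΨ.dotProduct_mulVec_symm b a] at h ⊢
  have h1 : 2 * (a ⬝ᵥ (Ψ *ᵥ b)) ≤ η * (a ⬝ᵥ (Ψ *ᵥ a)) + 1 / η * (b ⬝ᵥ (Ψ *ᵥ b)) := by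
    have e : η * (a ⬝ᵥ (Ψ *ᵥ a)) + 1 / η * (b ⬝ᵥ (Ψ *ᵥ b)) =
        (η * (η * (a ⬝ᵥ (Ψ *ᵥ a))) + b ⬝ᵥ (Ψ *ᵥ b)) / η := by
      field_simp
    rw [e, le_div_iff₀ hη]
    linarith
  linarith

lemma quad_le_quad_postPrecision (x : (i : Fin n) → Fin (q i) → Fin p → ℝ)
    (Ψ : Matrix (Fin p) (Fin p) ℝ) (u : LatentU q) {v : LatentV q} (hv : ∀ i k, 0 < v i k)
    (b : Fin p → ℝ) : b ⬝ᵥ (Ψ *ᵥ b) ≤ b ⬝ᵥ (postPrecision x Ψ u v *ᵥ b) := by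
  rw [dotProduct_postPrecision_mulVec]
  exact le_add_of_nonneg_right (Finset.sum_nonneg fun i _ => Finset.sum_nonneg fun k _ =>
    mul_nonneg (mul_nonneg (hv i k).le (sq_nonneg _)) (mul_self_nonneg _))

/-- Separates mean and fluctuation of the new β. The fluctuation measured in Ψ is at most that
measured in the larger precision Q, whose second moment is bounded uniformly in u and v. -/
lemma lintegral_driftFun_bKernel_le (x : (i : Fin n) → Fin (q i) → Fin p → ℝ) (μ : Fin p → ℝ)
    {Ψ : Matrix (Fin p) (Fin p) ℝ} (hΨ : Ψ.PosDef) {η : ℝ} (hη : 0 < η) (u : LatentU q)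
    {v : LatentV q} (hv : ∀ i k, 0 < v i k) :
    ∫⁻ c, ENNReal.ofReal (driftFun μ Ψ c) ∂(bKernel x μ Ψ (u, v)) ≤
      ENNReal.ofReal (1 + η) * ENNReal.ofReal (driftFun μ Ψ (postMean x μ Ψ u v)) +
        ENNReal.ofReal (1 + 1 / η) * ENNReal.ofReal (4 * √2 ^ p) := by
  have := isProbabilityMeasure_bKernel x μ hΨ u hv
  set w := postMean x μ Ψ u v with hw
  set Q := postPrecision x Ψ u v with hQ
  have hQm : Measurable fun c => ENNReal.ofReal ((c - w) ⬝ᵥ (Q *ᵥ (c - w))) :=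
    (continuous_driftFun w Q).measurable.ennreal_ofReal
  have hle : ∀ c, ENNReal.ofReal (driftFun μ Ψ c) ≤
      ENNReal.ofReal (1 + η) * ENNReal.ofReal (driftFun μ Ψ w) +
        ENNReal.ofReal (1 + 1 / η) * ENNReal.ofReal ((c - w) ⬝ᵥ (Q *ᵥ (c - w))) := by
    intro c
    rw [← ENNReal.ofReal_mul (by positivity), ← ENNReal.ofReal_mul (by positivity),
      ← ENNReal.ofReal_add (mul_nonneg (by positivity) (driftFun_nonneg μ hΨ w))
        (mul_nonneg (by positivity)
          ((posDef_postPrecision x hΨ hv).dotProduct_mulVec_self_nonneg _))]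
    refine ENNReal.ofReal_le_ofReal ?_
    have h1 := quad_add_le hΨ hη (w - μ) (c - w)
    have h2 : w - μ + (c - w) = c - μ := by abel
    rw [h2] at h1
    refine h1.trans (add_le_add_right (mul_le_mul_of_nonneg_left
      (quad_le_quad_postPrecision x Ψ u hv _) (by positivity)) _)
  refine (lintegral_mono hle).trans ?_
  rw [lintegral_add_left measurable_const, lintegral_const, measure_univ, mul_one,
    lintegral_const_mul _ hQm, lintegral_bKernel x μ Ψ u v hQm]
  gcongr
  exact lintegral_quad_mul_normalPDF_le w (posDef_postPrecision x hΨ hv)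

/-- The contribution of one category to the quadratic objective whose minimizer is the mean of the
conditional distribution of `β`. -/
lemma mul_sq_sub_div_le {v w d s z : ℝ} (hv : 0 < v) (hw : 0 < w) (hd : |d| ≤ w) :
    v * w ^ 2 * (z - d / (v * w ^ 2)) ^ 2 ≤
      v * (2 * w ^ 2 * (z - d * s / w) ^ 2) + 2 * (w * s * √v - 1 / √v) ^ 2 := by
  have hs : 0 < √v := Real.sqrt_pos.2 hv
  have hsq := Real.sq_sqrt hv.le
  have h1 : (w * s * √v - 1 / √v) ^ 2 = v * (w * s - 1 / v) ^ 2 := by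
    have : w * s * √v - 1 / √v = √v * (w * s - 1 / √v ^ 2) := by
      field_simp
    rw [this, mul_pow, hsq]
  -- The random value 1/v is replaced by ws, the reciprocal of the mean of v when s = √(t² + 4). The
  -- error is controlled by |d| ≤ w and becomes (w s √v - 1/√v)².
  have h2 : z - d / (v * w ^ 2) = (z - d * s / w) + d / w ^ 2 * (w * s - 1 / v) := by
    field_simp
    ring
  have h3 : v * w ^ 2 * (d / w ^ 2 * (w * s - 1 / v)) ^ 2 ≤ v * (w * s - 1 / v) ^ 2 := by
    have h4 : v * w ^ 2 * (d / w ^ 2 * (w * s - 1 / v)) ^ 2 =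
        (d / w) ^ 2 * (v * (w * s - 1 / v) ^ 2) := by
      field_simp
    rw [h4]
    refine mul_le_of_le_one_left (by positivity) ?_
    rw [sq_le_one_iff_abs_le_one, abs_div, abs_of_pos hw]
    exact (div_le_one hw).2 hd
  rw [h1, h2]
  set A := z - d * s / w
  set B := d / w ^ 2 * (w * s - 1 / v)
  have h5 : (A + B) ^ 2 ≤ 2 * A ^ 2 + 2 * B ^ 2 := by nlinarith [sq_nonneg (A - B)]
  have h6 : v * w ^ 2 * (A + B) ^ 2 ≤ v * w ^ 2 * (2 * A ^ 2 + 2 * B ^ 2) :=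
    mul_le_mul_of_nonneg_left h5 (by positivity)
  nlinarith

/-- The cross term is kept while t² ≤ s² and d² ≤ w² bound the two squares, where s = √(t² + 4), w =
u₁ + u₀ and d = u₁ - u₀. The resulting 2ws - 2dt equals 2(s - t)u₁ + 2(s + t)u₀, whose coefficients
are the ones that the gamma means compensate. -/
lemma div_mul_sq_sub_le {u₀ u₁ t e z : ℝ} (hu₀ : 0 < u₀) (hu₁ : 0 < u₁) (hz : z = t - e) :
    (u₁ + u₀) / √(t ^ 2 + 4) *
      (2 * (z - (u₁ - u₀) * √(t ^ 2 + 4) / (u₁ + u₀)) ^ 2) ≤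
      (4 * e ^ 2 / √(t ^ 2 + 4) + 8 * (-t + √(t ^ 2 + 4))) * u₁ +
      (4 * e ^ 2 / √(t ^ 2 + 4) + 8 * (t + √(t ^ 2 + 4))) * u₀ := by
  have hs := sqrt_sq_add_four_pos t
  have hsq := Real.sq_sqrt (by positivity : 0 ≤ t ^ 2 + 4)
  have hts : t ^ 2 ≤ √(t ^ 2 + 4) ^ 2 := by rw [hsq]; linarith
  generalize √(t ^ 2 + 4) = s at *
  set w := u₁ + u₀ with hw
  have hw0 : 0 < w := by positivity
  set d := u₁ - u₀ with hd
  have h1 : (z - d * s / w) ^ 2 ≤ 2 * e ^ 2 + 2 * (t - d * s / w) ^ 2 := by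
    rw [hz]; nlinarith [sq_nonneg (t - d * s / w + e)]
  have hd2 : d ^ 2 ≤ w ^ 2 := by rw [hd, hw]; nlinarith
  have h2 : w / s * (t - d * s / w) ^ 2 ≤ 2 * w * s - 2 * d * t := by
    have e1 : w / s * (t - d * s / w) ^ 2 = w * t ^ 2 / s - 2 * d * t + d ^ 2 * s / w := by
      field_simp
      ring
    have e2 : w * t ^ 2 / s ≤ w * s := by
      rw [div_le_iff₀ hs]; nlinarith
    have e3 : d ^ 2 * s / w ≤ w * s := by
      rw [div_le_iff₀ hw0]; nlinarith
    rw [e1]; linarith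
  calc w / s * (2 * (z - d * s / w) ^ 2)
      ≤ w / s * (2 * (2 * e ^ 2 + 2 * (t - d * s / w) ^ 2)) := by gcongr
    _ = 4 * e ^ 2 / s * w + 4 * (w / s * (t - d * s / w) ^ 2) := by ring
    _ ≤ 4 * e ^ 2 / s * w + 4 * (2 * w * s - 2 * d * t) := by gcongr
    _ = _ := by rw [hw, hd]; ring

lemma lintegral_vKernel_objective_le (x : (i : Fin n) → Fin (q i) → Fin p → ℝ) (b : Fin p → ℝ)
    {u : LatentU q} (hu : ∀ i k, 0 < u i k) (i : Fin n) (k : Fin (q i)) (e : ℝ) :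
    ∫⁻ v, ENNReal.ofReal (v i k * (u i k.succ + u i 0) ^ 2 *
        (linPred x b i k - e - (u i k.succ - u i 0) / (v i k * (u i k.succ + u i 0) ^ 2)) ^ 2)
        ∂(vKernel x (b, u)) ≤
      ENNReal.ofReal (4 * e ^ 2 / √(linPred x b i k ^ 2 + 4) +
        8 * (-linPred x b i k + √(linPred x b i k ^ 2 + 4))) * ENNReal.ofReal (u i k.succ) +
      ENNReal.ofReal (4 * e ^ 2 / √(linPred x b i k ^ 2 + 4) +
        8 * (linPred x b i k + √(linPred x b i k ^ 2 + 4))) * ENNReal.ofReal (u i 0) + 16 := by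
  rw [lintegral_vKernel_eval x b hu i k (f := fun z => ENNReal.ofReal (z *
    (u i k.succ + u i 0) ^ 2 * (linPred x b i k - e - (u i k.succ - u i 0) /
      (z * (u i k.succ + u i 0) ^ 2)) ^ 2)) (by fun_prop)]
  have hu₀ := hu i 0
  have hu₁ := hu i k.succ
  have ha := vParam_pos x b hu i k
  have hmean := lintegral_id_invGaussMeasure ha
  have hsqr := lintegral_sq_invGaussMeasure_le ha
  have hpos := ae_pos_invGaussMeasure (vParam x b u i k)
  have hmain := div_mul_sq_sub_le (t := linPred x b i k) (e := e) hu₀ hu₁ rfl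
  have ht1 := rate_pos (linPred x b i k)
  have ht2 := rate_pos (-linPred x b i k)
  rw [neg_neg, neg_sq] at ht2
  have hs := sqrt_sq_add_four_pos (linPred x b i k)
  unfold vParam at *
  generalize √(linPred x b i k ^ 2 + 4) = s at *
  generalize linPred x b i k = t at *
  generalize u i k.succ = u₁ at *
  generalize u i 0 = u₀ at *
  have hw : 0 < u₁ + u₀ := by positivity
  have hd : |u₁ - u₀| ≤ u₁ + u₀ := abs_le.2 ⟨by linarith, by linarith⟩
  set c := 2 * (u₁ + u₀) ^ 2 * (t - e - (u₁ - u₀) * s / (u₁ + u₀)) ^ 2 with hc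
  have hc0 : 0 ≤ c := by positivity
  calc _ ≤ ∫⁻ v, (ENNReal.ofReal v * ENNReal.ofReal c + 2 * ENNReal.ofReal
          (((u₁ + u₀) * s * √v - 1 / √v) ^ 2)) ∂(invGaussMeasure ((u₁ + u₀) * s)) := by
        refine lintegral_mono_ae ?_
        filter_upwards [hpos] with v hv
        rw [← ENNReal.ofReal_mul hv.le, ← ENNReal.ofReal_ofNat, ← ENNReal.ofReal_mul (by norm_num),
          ← ENNReal.ofReal_add (by positivity) (by positivity)]
        exact ENNReal.ofReal_le_ofReal (mul_sq_sub_div_le hv hw hd)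
    -- The mean 1/(ws) of v turns 2w² into 2w/s, the weight of the preceding estimate, and the
    -- squared term has mean at most 8.
    _ ≤ ENNReal.ofReal (1 / ((u₁ + u₀) * s)) * ENNReal.ofReal c + 2 * 8 := by
        rw [lintegral_add_left (by fun_prop), lintegral_mul_const _ ENNReal.measurable_ofReal,
          hmean, lintegral_const_mul' _ _ ENNReal.ofNat_ne_top]
        gcongr
    _ ≤ _ := by
        rw [← ENNReal.ofReal_mul (by positivity), ← ENNReal.ofReal_mul (by positivity),
          ← ENNReal.ofReal_mul (by positivity),
          ← ENNReal.ofReal_add (by positivity) (by positivity)]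
        refine add_le_add (ENNReal.ofReal_le_ofReal (le_trans (le_of_eq ?_) hmain)) (by norm_num)
        rw [hc]
        field_simp

lemma link_le_sqrt (t : ℝ) : link t ≤ √(t ^ 2 + 4) := by
  have h1 := abs_lt_sqrt_sq_add_four t
  have h2 := le_abs_self t
  unfold link
  linarith

lemma two_le_sqrt_sq_add_four (t : ℝ) : 2 ≤ √(t ^ 2 + 4) :=
  Real.le_sqrt_of_sq_le (by nlinarith)

/-- The growth in β cancels. With t the linear predictor and s = √(t² + 4), the rate of u_{i,k} is s
- t, so (s - t) E u_{i,k} = y_{i,k}; and s + t = 2λ(t) ≤ 2Λ_i, so (s + t) E u_{i,0} ≤ m_i. In the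
terms with e², division by s offsets E u_{i,k} = y_{i,k} λ(t)/2, because λ(t) ≤ s. -/
lemma lintegral_uKernel_category_le {m : Fin n → ℕ} (hm : ∀ i, 1 ≤ m i)
    {y : (i : Fin n) → Fin (q i + 1) → ℕ}
    (hy : ∀ (i : Fin n) (k : Fin (q i)), 1 ≤ y i k.succ)
    (x : (i : Fin n) → Fin (q i) → Fin p → ℝ) (b : Fin p → ℝ) (i : Fin n) (k : Fin (q i))
    (e : ℝ) :
    ∫⁻ u, (ENNReal.ofReal (4 * e ^ 2 / √(linPred x b i k ^ 2 + 4) +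
        8 * (-linPred x b i k + √(linPred x b i k ^ 2 + 4))) * ENNReal.ofReal (u i k.succ) +
      ENNReal.ofReal (4 * e ^ 2 / √(linPred x b i k ^ 2 + 4) +
        8 * (linPred x b i k + √(linPred x b i k ^ 2 + 4))) * ENNReal.ofReal (u i 0) + 16)
        ∂(uKernel m y x b) ≤
      ENNReal.ofReal (4 * e ^ 2 * (y i k.succ + m i) + (8 * y i k.succ + 8 * m i + 16)) := by
  have := isMarkovKernel_uKernel hm hy x
  rw [lintegral_add_right _ measurable_const, lintegral_add_right _ (by fun_prop),
    lintegral_const_mul' _ _ ENNReal.ofReal_ne_top, lintegral_const_mul' _ _ ENNReal.ofReal_ne_top,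
    lintegral_uKernel_eval hm hy, lintegral_uKernel_eval hm hy, lintegral_const, measure_univ,
    mul_one]
  have e1 : uShape m y i k.succ / uRate x b i k.succ =
      y i k.succ / (-linPred x b i k + √(linPred x b i k ^ 2 + 4)) := rfl
  have e2 : uShape m y i 0 / uRate x b i 0 = m i / (2 + 2 * linkSum x b i) := rfl
  rw [e1, e2]
  have hL : link (linPred x b i k) ≤ linkSum x b i :=
    Finset.single_le_sum (f := fun k => link (linPred x b i k))
      (fun k _ => (link_pos _).le) (Finset.mem_univ k)
  have hlink : link (linPred x b i k) =
    (linPred x b i k + √(linPred x b i k ^ 2 + 4)) / 2 := rfl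
  have hr := rate_mul_link (linPred x b i k)
  have h1 := rate_pos (linPred x b i k)
  have h2 := link_pos (linPred x b i k)
  have h3 := link_le_sqrt (linPred x b i k)
  have h4 := two_le_sqrt_sq_add_four (linPred x b i k)
  generalize linkSum x b i = L at *
  generalize √(linPred x b i k ^ 2 + 4) = s at *
  generalize link (linPred x b i k) = l at *
  generalize linPred x b i k = t at *
  have hts : t + s = 2 * l := by linarith
  have hY : (0 : ℝ) ≤ y i k.succ := Nat.cast_nonneg _
  have hM : (0 : ℝ) ≤ m i := Nat.cast_nonneg _
  generalize (y i k.succ : ℝ) = Y at *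
  generalize (m i : ℝ) = M at *
  have hs : 0 < s := by linarith
  have hL0 : 0 < 2 + 2 * L := by linarith
  rw [hts, ← ENNReal.ofReal_mul (by positivity), ← ENNReal.ofReal_mul (by positivity),
    ← ENNReal.ofReal_ofNat, ← ENNReal.ofReal_add (by positivity) (by positivity),
    ← ENNReal.ofReal_add (by positivity) (by positivity)]
  refine ENNReal.ofReal_le_ofReal ?_
  have hYr : Y / (-t + s) = Y * l / 2 := by
    rw [div_eq_div_iff h1.ne' two_ne_zero]
    linear_combination -Y * hr
  have a1 : (4 * e ^ 2 / s + 8 * (-t + s)) * (Y / (-t + s)) ≤ 4 * e ^ 2 * Y + 8 * Y := by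
    have c1 : 4 * e ^ 2 / s * (Y * l / 2) ≤ 4 * e ^ 2 * Y := by
      have c2 : 4 * e ^ 2 / s * (Y * l / 2) = 4 * e ^ 2 * Y * (l / (2 * s)) := by
        field_simp
      rw [c2]
      exact mul_le_of_le_one_right (by positivity) ((div_le_one (by positivity)).2 (by linarith))
    have c3 : 8 * (-t + s) * (Y / (-t + s)) = 8 * Y := by field_simp
    rw [add_mul, c3, hYr]
    linarith
  have a2 : (4 * e ^ 2 / s + 8 * (2 * l)) * (M / (2 + 2 * L)) ≤ 4 * e ^ 2 * M + 8 * M := by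
    have c1 : 4 * e ^ 2 / s * (M / (2 + 2 * L)) ≤ 4 * e ^ 2 * M := by
      have c2 : 4 * e ^ 2 / s * (M / (2 + 2 * L)) = 4 * e ^ 2 * M * (1 / (s * (2 + 2 * L))) := by
        field_simp
      rw [c2]
      exact mul_le_of_le_one_right (by positivity)
        ((div_le_one (by positivity)).2 (by nlinarith))
    have c3 : 8 * (2 * l) * (M / (2 + 2 * L)) ≤ 8 * M := by
      have c4 : 8 * (2 * l) * (M / (2 + 2 * L)) = 8 * M * (2 * l / (2 + 2 * L)) := by ring
      rw [c4]
      exact mul_le_of_le_one_right (by positivity) ((div_le_one (by positivity)).2 (by linarith))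
    rw [add_mul]
    linarith
  linarith

/-- One step of the chain contracts the drift function, up to a constant; `t` is a free
parameter. -/
lemma lintegral_driftFun_postMean_le {m : Fin n → ℕ} (hm : ∀ i, 1 ≤ m i)
    {y : (i : Fin n) → Fin (q i + 1) → ℕ}
    (hy : ∀ (i : Fin n) (k : Fin (q i)), 1 ≤ y i k.succ)
    (x : (i : Fin n) → Fin (q i) → Fin p → ℝ) (μ : Fin p → ℝ) {Ψ : Matrix (Fin p) (Fin p) ℝ}
    (hΨ : Ψ.PosDef) (t : ℝ) (b : Fin p → ℝ) :
    ∫⁻ u, ∫⁻ v, ENNReal.ofReal (driftFun μ Ψ (postMean x μ Ψ u v)) ∂(vKernel x (b, u))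
        ∂(uKernel m y x b) ≤
      ENNReal.ofReal (t ^ 2 * driftFun μ Ψ b + ∑ i, ∑ k : Fin (q i),
        (4 * ((1 - t) * (x i k ⬝ᵥ (b - μ))) ^ 2 * (y i k.succ + m i) +
          (8 * y i k.succ + 8 * m i + 16))) := by
  have := isMarkovKernel_uKernel hm hy x
  have hstep : ∀ᵐ u ∂(uKernel m y x b),
      ∫⁻ v, ENNReal.ofReal (driftFun μ Ψ (postMean x μ Ψ u v)) ∂(vKernel x (b, u)) ≤
      ENNReal.ofReal (t ^ 2 * driftFun μ Ψ b) + ∑ i, ∑ k : Fin (q i),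
      (ENNReal.ofReal (4 * ((1 - t) * (x i k ⬝ᵥ (b - μ))) ^ 2 / √(linPred x b i k ^ 2 + 4) +
        8 * (-linPred x b i k + √(linPred x b i k ^ 2 + 4))) * ENNReal.ofReal (u i k.succ) +
      ENNReal.ofReal (4 * ((1 - t) * (x i k ⬝ᵥ (b - μ))) ^ 2 / √(linPred x b i k ^ 2 + 4) +
        8 * (linPred x b i k + √(linPred x b i k ^ 2 + 4))) * ENNReal.ofReal (u i 0) + 16) := by
    filter_upwards [ae_uKernel_pos hm hy x b] with u hu
    have := isProbabilityMeasure_vKernel x b hu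
    have hle : ∀ᵐ v ∂(vKernel x (b, u)), ENNReal.ofReal (driftFun μ Ψ (postMean x μ Ψ u v)) ≤
        ENNReal.ofReal (t ^ 2 * driftFun μ Ψ b) + ∑ i, ∑ k : Fin (q i),
        ENNReal.ofReal (v i k * (u i k.succ + u i 0) ^ 2 *
        (linPred x b i k - (1 - t) * (x i k ⬝ᵥ (b - μ)) -
          (u i k.succ - u i 0) / (v i k * (u i k.succ + u i 0) ^ 2)) ^ 2) := by
      filter_upwards [ae_vKernel_pos x b hu] with v hv
      have hnn : ∀ i (k : Fin (q i)), 0 ≤ v i k * (u i k.succ + u i 0) ^ 2 *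
        (linPred x b i k - (1 - t) * (x i k ⬝ᵥ (b - μ)) -
          (u i k.succ - u i 0) / (v i k * (u i k.succ + u i 0) ^ 2)) ^ 2 := fun i k =>
        mul_nonneg (mul_nonneg (hv i k).le (sq_nonneg _)) (sq_nonneg _)
      have hsum : ∀ i, ∑ k : Fin (q i), ENNReal.ofReal (v i k * (u i k.succ + u i 0) ^ 2 *
        (linPred x b i k - (1 - t) * (x i k ⬝ᵥ (b - μ)) -
          (u i k.succ - u i 0) / (v i k * (u i k.succ + u i 0) ^ 2)) ^ 2) =
          ENNReal.ofReal (∑ k : Fin (q i), v i k * (u i k.succ + u i 0) ^ 2 *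
        (linPred x b i k - (1 - t) * (x i k ⬝ᵥ (b - μ)) -
          (u i k.succ - u i 0) / (v i k * (u i k.succ + u i 0) ^ 2)) ^ 2) := fun i =>
        (ENNReal.ofReal_sum_of_nonneg fun k _ => hnn i k).symm
      simp_rw [hsum]
      rw [← ENNReal.ofReal_sum_of_nonneg fun i _ => Finset.sum_nonneg fun k _ => hnn i k,
        ← ENNReal.ofReal_add (mul_nonneg (sq_nonneg _) (driftFun_nonneg μ hΨ b))
          (Finset.sum_nonneg fun i _ => Finset.sum_nonneg fun k _ => hnn i k)]
      refine ENNReal.ofReal_le_ofReal ?_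
      -- The trial point μ + t(b - μ) shrinks b toward the prior mean. Its linear predictors differ
      -- from those of b by e = (1 - t) xᵀ(b - μ).
      have h := quad_postMean_sub_le x μ hΨ hv (fun i k => add_pos (hu i k.succ) (hu i 0))
        (μ + t • (b - μ))
      have e1 : μ + t • (b - μ) - μ = t • (b - μ) := by abel
      have e2 : ∀ i k, linPred x (μ + t • (b - μ)) i k =
          linPred x b i k - (1 - t) * (x i k ⬝ᵥ (b - μ)) := fun i k => by
        simp only [linPred, dotProduct_add, dotProduct_smul, dotProduct_sub, smul_eq_mul]
        ring
      rw [e1, Matrix.mulVec_smul, smul_dotProduct, dotProduct_smul, smul_eq_mul, smul_eq_mul,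
        ← mul_assoc, ← sq] at h
      simp_rw [e2] at h
      exact h
    refine (lintegral_mono_ae hle).trans ?_
    have hmeas : ∀ i (k : Fin (q i)), Measurable fun v : LatentV q =>
        ENNReal.ofReal (v i k * (u i k.succ + u i 0) ^ 2 *
        (linPred x b i k - (1 - t) * (x i k ⬝ᵥ (b - μ)) -
          (u i k.succ - u i 0) / (v i k * (u i k.succ + u i 0) ^ 2)) ^ 2) := fun i k => by
      fun_prop
    rw [lintegral_add_left measurable_const, lintegral_const, measure_univ, mul_one,
      lintegral_finsetSum _ fun i _ => Finset.measurable_fun_sum _ fun k _ => hmeas i k]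
    refine add_le_add_right (Finset.sum_le_sum fun i _ => ?_) _
    rw [lintegral_finsetSum _ fun k _ => hmeas i k]
    exact Finset.sum_le_sum fun k _ => lintegral_vKernel_objective_le x b hu i k _
  refine (lintegral_mono_ae hstep).trans ?_
  have hmeas : ∀ i (k : Fin (q i)), Measurable fun u : LatentU q =>
      (ENNReal.ofReal (4 * ((1 - t) * (x i k ⬝ᵥ (b - μ))) ^ 2 / √(linPred x b i k ^ 2 + 4) +
        8 * (-linPred x b i k + √(linPred x b i k ^ 2 + 4))) * ENNReal.ofReal (u i k.succ) +
      ENNReal.ofReal (4 * ((1 - t) * (x i k ⬝ᵥ (b - μ))) ^ 2 / √(linPred x b i k ^ 2 + 4) +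
        8 * (linPred x b i k + √(linPred x b i k ^ 2 + 4))) * ENNReal.ofReal (u i 0) + 16) :=
    fun i k => by fun_prop
  have hnn : ∀ i (k : Fin (q i)), (0 : ℝ) ≤ 4 * ((1 - t) * (x i k ⬝ᵥ (b - μ))) ^ 2 *
      (y i k.succ + m i) + (8 * y i k.succ + 8 * m i + 16) := fun i k => by positivity
  rw [lintegral_add_left measurable_const, lintegral_const, measure_univ, mul_one,
    lintegral_finsetSum _ fun i _ => Finset.measurable_fun_sum _ fun k _ => hmeas i k,
    ENNReal.ofReal_add (mul_nonneg (sq_nonneg _) (driftFun_nonneg μ hΨ b))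
      (Finset.sum_nonneg fun i _ => Finset.sum_nonneg fun k _ => hnn i k),
    ENNReal.ofReal_sum_of_nonneg fun i _ => Finset.sum_nonneg fun k _ => hnn i k]
  refine add_le_add_right (Finset.sum_le_sum fun i _ => ?_) _
  rw [lintegral_finsetSum _ fun k _ => hmeas i k,
    ENNReal.ofReal_sum_of_nonneg fun k _ => hnn i k]
  exact Finset.sum_le_sum fun k _ => lintegral_uKernel_category_le hm hy x b i k _

/-- The mean of the conditional distribution of `β` satisfies a drift condition. -/
lemma exists_drift_postMean {m : Fin n → ℕ} (hm : ∀ i, 1 ≤ m i)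
    {y : (i : Fin n) → Fin (q i + 1) → ℕ}
    (hy : ∀ (i : Fin n) (k : Fin (q i)), 1 ≤ y i k.succ)
    (x : (i : Fin n) → Fin (q i) → Fin p → ℝ) (μ : Fin p → ℝ) {Ψ : Matrix (Fin p) (Fin p) ℝ}
    (hΨ : Ψ.PosDef) :
    ∃ γ K : ℝ, 0 ≤ γ ∧ γ < 1 ∧ 0 ≤ K ∧ ∀ b,
      ∫⁻ u, ∫⁻ v, ENNReal.ofReal (driftFun μ Ψ (postMean x μ Ψ u v)) ∂(vKernel x (b, u))
        ∂(uKernel m y x b) ≤ ENNReal.ofReal (γ * driftFun μ Ψ b + K) := by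
  choose C hC0 hC using fun i (k : Fin (q i)) => hΨ.exists_sq_dotProduct_le (x i k)
  obtain ⟨A, hA⟩ : ∃ A : ℝ, A = ∑ i, ∑ k : Fin (q i), 4 * C i k * (y i k.succ + m i) := ⟨_, rfl⟩
  have hA0 : 0 ≤ A := by
    rw [hA]
    exact Finset.sum_nonneg fun i _ => Finset.sum_nonneg fun k _ =>
      mul_nonneg (mul_nonneg zero_le_four (hC0 i k)) (by positivity)
  have hγ0 : 0 ≤ A / (1 + A) := by positivity
  have hγ1 : A / (1 + A) < 1 := (div_lt_one (by positivity)).2 (by linarith)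
  -- The value t = A / (1 + A) minimizes t² + (1 - t)² A, and the minimum is again A / (1 + A). The
  -- same γ is therefore the trial parameter and the contraction factor.
  have hγeq : (A / (1 + A)) ^ 2 + (1 - A / (1 + A)) ^ 2 * A = A / (1 + A) := by
    field_simp
    ring
  generalize A / (1 + A) = γ at *
  refine ⟨γ, ∑ i, ∑ k : Fin (q i), ((8 : ℝ) * y i k.succ + 8 * m i + 16), hγ0, hγ1,
    Finset.sum_nonneg fun i _ => Finset.sum_nonneg fun k _ => by positivity, fun b => ?_⟩
  refine (lintegral_driftFun_postMean_le hm hy x μ hΨ γ b).trans (ENNReal.ofReal_le_ofReal ?_)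
  have h1 : ∀ i (k : Fin (q i)), 4 * ((1 - γ) * (x i k ⬝ᵥ (b - μ))) ^ 2 *
      ((y i k.succ : ℝ) + m i) + (8 * y i k.succ + 8 * m i + 16) ≤
      (1 - γ) ^ 2 * driftFun μ Ψ b * (4 * C i k * (y i k.succ + m i)) +
        (8 * y i k.succ + 8 * m i + 16) := by
    intro i k
    have h2 := mul_le_mul_of_nonneg_left (hC i k (b - μ))
      (by positivity : 0 ≤ 4 * (1 - γ) ^ 2 * ((y i k.succ : ℝ) + m i))
    have h3 : driftFun μ Ψ b = (b - μ) ⬝ᵥ (Ψ *ᵥ (b - μ)) := rfl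
    rw [← h3] at h2
    linarith
  have h2 : ∑ i, ∑ k : Fin (q i), ((1 - γ) ^ 2 * driftFun μ Ψ b *
      (4 * C i k * (y i k.succ + m i)) + ((8 : ℝ) * y i k.succ + 8 * m i + 16)) =
      (1 - γ) ^ 2 * driftFun μ Ψ b * A +
        ∑ i, ∑ k : Fin (q i), ((8 : ℝ) * y i k.succ + 8 * m i + 16) := by
    rw [hA, Finset.mul_sum, ← Finset.sum_add_distrib]
    refine Finset.sum_congr rfl fun i _ => ?_
    rw [Finset.mul_sum, ← Finset.sum_add_distrib]
  have h3 := Finset.sum_le_sum fun i (_ : i ∈ Finset.univ) =>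
    Finset.sum_le_sum fun k (_ : k ∈ Finset.univ) => h1 i k
  rw [h2] at h3
  have h4 : γ * driftFun μ Ψ b = γ ^ 2 * driftFun μ Ψ b + (1 - γ) ^ 2 * driftFun μ Ψ b * A := by
    linear_combination -(driftFun μ Ψ b) * hγeq
  linarith

/-- The drift condition for the Gibbs sampler. -/
theorem exists_drift_gibbsKernel {m : Fin n → ℕ} (hm : ∀ i, 1 ≤ m i)
    {y : (i : Fin n) → Fin (q i + 1) → ℕ}
    (hy : ∀ (i : Fin n) (k : Fin (q i)), 1 ≤ y i k.succ)
    (x : (i : Fin n) → Fin (q i) → Fin p → ℝ) (μ : Fin p → ℝ) {Ψ : Matrix (Fin p) (Fin p) ℝ}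
    (hΨ : Ψ.PosDef) :
    ∃ γ K : ℝ, 0 ≤ γ ∧ γ < 1 ∧ 0 ≤ K ∧ ∀ b,
      ∫⁻ c, ENNReal.ofReal (driftFun μ Ψ c) ∂(gibbsKernel m y x μ Ψ b) ≤
        ENNReal.ofReal (γ * driftFun μ Ψ b + K) := by
  obtain ⟨γ₀, K₀, hγ₀0, hγ₀1, hK₀0, hmean⟩ := exists_drift_postMean hm hy x μ hΨ
  -- This keeps (1 + η) γ₀ below 1, since 1 - (1 + η) γ₀ = (1 - γ₀)(2 - γ₀)/2.
  obtain ⟨η, hη⟩ : ∃ η : ℝ, η = (1 - γ₀) / 2 := ⟨_, rfl⟩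
  have hη0 : 0 < η := by rw [hη]; linarith
  refine ⟨(1 + η) * γ₀, (1 + η) * K₀ + (1 + 1 / η) * (4 * √2 ^ p), by positivity,
    by rw [hη]; nlinarith, by positivity, fun b => ?_⟩
  have := isMarkovKernel_uKernel hm hy x
  have hV0 := driftFun_nonneg μ hΨ b
  rw [lintegral_gibbsKernel m y x μ Ψ b (continuous_driftFun μ Ψ).measurable.ennreal_ofReal]
  have hstep : ∀ᵐ u ∂(uKernel m y x b), ∫⁻ v, ∫⁻ c, ENNReal.ofReal (driftFun μ Ψ c)
      ∂(bKernel x μ Ψ (u, v)) ∂(vKernel x (b, u)) ≤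
      ENNReal.ofReal (1 + η) * ∫⁻ v, ENNReal.ofReal (driftFun μ Ψ (postMean x μ Ψ u v))
        ∂(vKernel x (b, u)) + ENNReal.ofReal (1 + 1 / η) * ENNReal.ofReal (4 * √2 ^ p) := by
    filter_upwards [ae_uKernel_pos hm hy x b] with u hu
    have := isProbabilityMeasure_vKernel x b hu
    have hle : ∀ᵐ v ∂(vKernel x (b, u)), ∫⁻ c, ENNReal.ofReal (driftFun μ Ψ c)
        ∂(bKernel x μ Ψ (u, v)) ≤ ENNReal.ofReal (1 + η) *
          ENNReal.ofReal (driftFun μ Ψ (postMean x μ Ψ u v)) +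
          ENNReal.ofReal (1 + 1 / η) * ENNReal.ofReal (4 * √2 ^ p) := by
      filter_upwards [ae_vKernel_pos x b hu] with v hv
      exact lintegral_driftFun_bKernel_le x μ hΨ hη0 u hv
    refine (lintegral_mono_ae hle).trans_eq ?_
    rw [lintegral_add_right _ measurable_const, lintegral_const, measure_univ, mul_one,
      lintegral_const_mul' _ _ ENNReal.ofReal_ne_top]
  refine (lintegral_mono_ae hstep).trans ?_
  rw [lintegral_add_right _ measurable_const, lintegral_const, measure_univ, mul_one,
    lintegral_const_mul' _ _ ENNReal.ofReal_ne_top]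
  calc _ ≤ ENNReal.ofReal (1 + η) * ENNReal.ofReal (γ₀ * driftFun μ Ψ b + K₀) +
        ENNReal.ofReal (1 + 1 / η) * ENNReal.ofReal (4 * √2 ^ p) := by
          gcongr
          exact hmean b
    _ = _ := by
      rw [← ENNReal.ofReal_mul (by positivity), ← ENNReal.ofReal_mul (by positivity),
        ← ENNReal.ofReal_add (by positivity) (by positivity)]
      congr 1
      ring

/-- The drift function is integrable for the posterior distribution. -/
lemma lintegral_driftFun_posterior_ne_top (m : Fin n → ℕ) (y : (i : Fin n) → Fin (q i + 1) → ℕ)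
    (x : (i : Fin n) → Fin (q i) → Fin p → ℝ) (μ : Fin p → ℝ) {Ψ : Matrix (Fin p) (Fin p) ℝ}
    (hΨ : Ψ.PosDef) :
    ∫⁻ b, ENNReal.ofReal (driftFun μ Ψ b) ∂(posterior m y x μ Ψ) ≠ ∞ := by
  have hVm : Measurable fun b => ENNReal.ofReal (driftFun μ Ψ b) :=
    (continuous_driftFun μ Ψ).measurable.ennreal_ofReal
  rw [posterior, lintegral_smul_measure, lintegral_withDensity_eq_lintegral_mul _
    (measurable_likelihood m y x).ennreal_ofReal hVm]
  refine ENNReal.mul_ne_top (ENNReal.inv_ne_top.2 (lintegral_likelihood_ne_zero m y x μ hΨ)) ?_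
  refine ne_top_of_le_ne_top ?_ (lintegral_likelihood_mul_le m y x μ Ψ _)
  refine ENNReal.mul_ne_top ENNReal.ofReal_ne_top ?_
  rw [prior, lintegral_withDensity_eq_lintegral_mul _
    (continuous_normalPDF μ Ψ).measurable.ennreal_ofReal hVm]
  exact ne_top_of_le_ne_top ENNReal.ofReal_ne_top (lintegral_quad_mul_normalPDF_le μ hΨ)

end MultinomialGibbs

/-! ### The minorization condition on compact sets -/

lemma continuousOn_gammaPDFReal {α : Type*} [TopologicalSpace α] (a : ℝ) {f g : α → ℝ} {S : Set α}
    (hf : ContinuousOn f S) (hg : ContinuousOn g S) (hf0 : ∀ z ∈ S, 0 < f z)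
    (hg0 : ∀ z ∈ S, 0 < g z) : ContinuousOn (fun z => gammaPDFReal a (f z) (g z)) S := by
  have h : ContinuousOn (fun z => f z ^ a / Real.Gamma a * g z ^ (a - 1) *
      Real.exp (-(f z * g z))) S := by
    have h1 := hf.rpow_const (p := a) fun z hz => Or.inl (hf0 z hz).ne'
    have h2 := hg.rpow_const (p := a - 1) fun z hz => Or.inl (hg0 z hz).ne'
    fun_prop
  exact h.congr fun z hz => by simp only [gammaPDFReal, if_pos (hg0 z hz).le]

namespace MultinomialGibbs

lemma continuousOn_invGaussPDF {α : Type*} [TopologicalSpace α] {f g : α → ℝ} {S : Set α}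
    (hf : ContinuousOn f S) (hg : ContinuousOn g S) (hg0 : ∀ z ∈ S, 0 < g z) :
    ContinuousOn (fun z => invGaussPDF (1 / f z) 1 (g z)) S := by
  have hs0 : ∀ z ∈ S, √(g z) ≠ 0 := fun z hz => (Real.sqrt_pos.2 (hg0 z hz)).ne'
  have hs : ContinuousOn (fun z => √(g z)) S := hg.sqrt
  have h1 : ContinuousOn (fun z => 1 / (g z * √(g z))) S :=
    continuousOn_const.div (hg.mul hs) fun z hz => mul_ne_zero (hg0 z hz).ne' (hs0 z hz)
  have h2 : ContinuousOn (fun z => 1 / √(g z)) S := continuousOn_const.div hs hs0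
  have h : ContinuousOn (fun z => 1 / (g z * √(g z)) * (√(1 / (2 * Real.pi)) *
      Real.exp (-(1 / 2) * (f z * √(g z) - 1 / √(g z)) ^ 2))) S := by
    fun_prop
  exact h.congr fun z hz => invGaussPDF_of_pos (hg0 z hz)

lemma invGaussPDF_pos {a v : ℝ} (hv : 0 < v) : 0 < invGaussPDF (1 / a) 1 v := by
  have := Real.pi_pos
  have := Real.sqrt_pos.2 hv
  rw [invGaussPDF_of_pos hv]
  positivity

variable {n p : ℕ} {q : Fin n → ℕ}

lemma continuous_linPred (x : (i : Fin n) → Fin (q i) → Fin p → ℝ) (i : Fin n) (k : Fin (q i)) :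
    Continuous fun b => linPred x b i k := by
  unfold linPred
  fun_prop

lemma continuous_uRate (x : (i : Fin n) → Fin (q i) → Fin p → ℝ) (i : Fin n)
    (k : Fin (q i + 1)) : Continuous fun b => uRate x b i k := by
  have h := continuous_linPred x i
  refine Fin.cases ?_ (fun k => ?_) k
  · show Continuous fun b => 2 + 2 * linkSum x b i
    unfold linkSum link
    fun_prop
  · show Continuous fun b => -linPred x b i k + √(linPred x b i k ^ 2 + 4)
    fun_prop

/-- A cube of positive gamma latent variables. -/
def boxU (q : Fin n → ℕ) : Set (LatentU q) :=
  Set.univ.pi fun _ => Set.univ.pi fun _ => Set.Icc 1 2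

/-- A cube of positive inverse Gaussian latent variables. -/
def boxV (q : Fin n → ℕ) : Set (LatentV q) :=
  Set.univ.pi fun _ => Set.univ.pi fun _ => Set.Icc 1 2

lemma isCompact_boxU : IsCompact (boxU q) :=
  isCompact_univ_pi fun _ => isCompact_univ_pi fun _ => isCompact_Icc

lemma isCompact_boxV : IsCompact (boxV q) :=
  isCompact_univ_pi fun _ => isCompact_univ_pi fun _ => isCompact_Icc

lemma volume_boxU : volume (boxU q) = 1 := by
  simp only [boxU, volume_pi, Measure.pi_pi, Real.volume_Icc]
  norm_num

lemma volume_boxV : volume (boxV q) = 1 := by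
  simp only [boxV, volume_pi, Measure.pi_pi, Real.volume_Icc]
  norm_num

lemma pos_of_mem_boxU {u : LatentU q} (hu : u ∈ boxU q) (i : Fin n) (k : Fin (q i + 1)) :
    0 < u i k := one_pos.trans_le (hu i trivial k trivial).1

lemma pos_of_mem_boxV {v : LatentV q} (hv : v ∈ boxV q) (i : Fin n) (k : Fin (q i)) :
    0 < v i k := one_pos.trans_le (hv i trivial k trivial).1

/-- On compact sets, the conditional density of the latent variables in the unit cubes is bounded
away from zero. -/
lemma exists_pos_le_uDensity_mul_vDensity {m : Fin n → ℕ} (hm : ∀ i, 1 ≤ m i)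
    {y : (i : Fin n) → Fin (q i + 1) → ℕ}
    (hy : ∀ (i : Fin n) (k : Fin (q i)), 1 ≤ y i k.succ)
    (x : (i : Fin n) → Fin (q i) → Fin p → ℝ) {C : Set (Fin p → ℝ)} (hC : IsCompact C) :
    ∃ ε : ℝ, 0 < ε ∧ ∀ b ∈ C, ∀ u ∈ boxU q, ∀ v ∈ boxV q,
      ε ≤ uDensity m y x b u * vDensity x b u v := by
  set S : Set ((Fin p → ℝ) × LatentU q × LatentV q) := C ×ˢ (boxU q ×ˢ boxV q) with hS
  have hSc : IsCompact S := hC.prod (isCompact_boxU.prod isCompact_boxV)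
  have hu : ∀ i (k : Fin (q i + 1)), Continuous
      fun z : (Fin p → ℝ) × LatentU q × LatentV q => z.2.1 i k := fun i k => by fun_prop
  have hv : ∀ i (k : Fin (q i)), Continuous
      fun z : (Fin p → ℝ) × LatentU q × LatentV q => z.2.2 i k := fun i k => by fun_prop
  have h1 : ContinuousOn (fun z : (Fin p → ℝ) × LatentU q × LatentV q =>
      ∏ i, ∏ k, gammaPDFReal (uShape m y i k) (uRate x z.1 i k) (z.2.1 i k)) S :=
    continuousOn_finsetProd _ fun i _ => continuousOn_finsetProd _ fun k _ =>
      continuousOn_gammaPDFReal _ ((continuous_uRate x i k).comp continuous_fst).continuousOn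
        (hu i k).continuousOn (fun z _ => uRate_pos x z.1 i k)
        fun z hz => pos_of_mem_boxU hz.2.1 i k
  have h2 : ContinuousOn (fun z : (Fin p → ℝ) × LatentU q × LatentV q =>
      ∏ i, ∏ k, invGaussPDF (1 / vParam x z.1 z.2.1 i k) 1 (z.2.2 i k)) S := by
    refine continuousOn_finsetProd _ fun i _ => continuousOn_finsetProd _ fun k _ =>
      continuousOn_invGaussPDF (Continuous.continuousOn ?_) (hv i k).continuousOn
        fun z hz => pos_of_mem_boxV hz.2.2 i k
    have h3 : Continuous fun z : (Fin p → ℝ) × LatentU q × LatentV q => linPred x z.1 i k :=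
      (continuous_linPred x i k).comp continuous_fst
    have h4 := hu i k.succ
    have h5 := hu i 0
    unfold vParam
    fun_prop
  -- The cubes stay away from 0, where the densities may be discontinuous. There the product is
  -- continuous and positive on a compact set, hence bounded below.
  obtain ⟨ε, hε, hle⟩ := hSc.exists_forall_le' (h1.mul h2) (a := 0) fun z hz => by
    refine mul_pos (Finset.prod_pos fun i _ => Finset.prod_pos fun k _ =>
      gammaPDFReal_pos (uShape_pos hm hy i k) (uRate_pos x z.1 i k)
        (pos_of_mem_boxU hz.2.1 i k)) (Finset.prod_pos fun i _ => Finset.prod_pos fun k _ =>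
        invGaussPDF_pos (pos_of_mem_boxV hz.2.2 i k))
  refine ⟨ε, hε, fun b hb u hu v hv => ?_⟩
  have := hle (b, u, v) ⟨hb, hu, hv⟩
  rw [uDensity_eq_prod]
  exact this

/-- The transition kernel is minorized on compact sets. -/
lemma exists_minorization_gibbsKernel {m : Fin n → ℕ} (hm : ∀ i, 1 ≤ m i)
    {y : (i : Fin n) → Fin (q i + 1) → ℕ}
    (hy : ∀ (i : Fin n) (k : Fin (q i)), 1 ≤ y i k.succ)
    (x : (i : Fin n) → Fin (q i) → Fin p → ℝ) (μ : Fin p → ℝ) {Ψ : Matrix (Fin p) (Fin p) ℝ}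
    (hΨ : Ψ.PosDef) {C : Set (Fin p → ℝ)} (hC : IsCompact C) :
    ∃ ν : Measure (Fin p → ℝ), ν ≠ 0 ∧ ∀ b ∈ C, ν ≤ gibbsKernel m y x μ Ψ b := by
  obtain ⟨ε, hε, hle⟩ := exists_pos_le_uDensity_mul_vDensity hm hy x hC
  have hbox : MeasurableSet (boxU q ×ˢ boxV q) :=
    (isCompact_boxU (q := q)).measurableSet.prod (isCompact_boxV (q := q)).measurableSet
  set ρ : Measure (LatentU q × LatentV q) :=
    (volume.prod volume).restrict (boxU q ×ˢ boxV q) with hρ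
  have hν : ∀ A, MeasurableSet A → (ENNReal.ofReal ε • ρ.bind (bKernel x μ Ψ)) A =
      ENNReal.ofReal ε * ∫⁻ z in boxU q ×ˢ boxV q, bKernel x μ Ψ z A ∂(volume.prod volume) :=
    fun A hA => by
      rw [Measure.smul_apply, Measure.bind_apply hA (Kernel.aemeasurable _), smul_eq_mul]
  -- The measure ν draws (u, v) uniformly from the cubes and then β, scaled by ε. It does not depend
  -- on b, and has mass ε because the cubes have volume 1.
  refine ⟨ENNReal.ofReal ε • ρ.bind (bKernel x μ Ψ), fun h => ?_, fun b hb => ?_⟩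
  · have h1 := hν Set.univ MeasurableSet.univ
    have h2 : ∫⁻ z in boxU q ×ˢ boxV q, bKernel x μ Ψ z Set.univ ∂(volume.prod volume) =
        ∫⁻ _ in boxU q ×ˢ boxV q, 1 ∂(volume.prod volume) := by
      refine setLIntegral_congr_fun hbox fun z hz => ?_
      have := isProbabilityMeasure_bKernel x μ hΨ z.1 (pos_of_mem_boxV hz.2)
      exact measure_univ
    rw [h, h2, lintegral_one, Measure.restrict_apply_univ, Measure.prod_prod, volume_boxU,
      volume_boxV] at h1
    simp only [Measure.coe_zero, Pi.zero_apply, mul_one] at h1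
    exact (ENNReal.ofReal_pos.2 hε).ne h1
  · refine Measure.le_iff.2 fun A hA => ?_
    have hb1 : Measurable fun z => bKernel x μ Ψ z A := Kernel.measurable_coe _ hA
    have hfm : Measurable (A.indicator (1 : (Fin p → ℝ) → ℝ≥0∞)) := measurable_one.indicator hA
    have hb2 : ∀ u v, ∫⁻ c, A.indicator (1 : (Fin p → ℝ) → ℝ≥0∞) c ∂(bKernel x μ Ψ (u, v)) =
        bKernel x μ Ψ (u, v) A := fun u v => lintegral_indicator_one hA
    have hdu : Measurable fun z : LatentU q × LatentV q => ENNReal.ofReal (uDensity m y x b z.1) :=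
      ((measurable_uDensity m y x).of_uncurry_left (x := b)).ennreal_ofReal.comp measurable_fst
    have hdv : Measurable fun z : LatentU q × LatentV q =>
        ENNReal.ofReal (vDensity x b z.1 z.2) := by
      simpa only [Function.comp_def, Function.uncurry_def] using ((measurable_vDensity x).comp
        ((measurable_const (a := b)).prodMk measurable_fst |>.prodMk measurable_snd)).ennreal_ofReal
    rw [hν A hA, ← lintegral_indicator_one (μ := gibbsKernel m y x μ Ψ b) hA,
      lintegral_gibbsKernel m y x μ Ψ b hfm]
    simp_rw [hb2]
    rw [lintegral_uKernel_vKernel m y x b (F := fun u v => bKernel x μ Ψ (u, v) A) hb1,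
      ← lintegral_prod (fun z : LatentU q × LatentV q => ENNReal.ofReal (uDensity m y x b z.1) *
        ENNReal.ofReal (vDensity x b z.1 z.2) * bKernel x μ Ψ z A)
        ((hdu.mul hdv).mul hb1).aemeasurable,
      ← lintegral_const_mul _ hb1]
    refine le_trans (setLIntegral_mono' hbox fun z hz => ?_) (setLIntegral_le_lintegral _ _)
    rw [← ENNReal.ofReal_mul (uDensity_nonneg hm hy x b z.1)]
    exact mul_le_mul_left (ENNReal.ofReal_le_ofReal (hle b hb z.1 hz.1 z.2 hz.2)) _

/-- Each coordinate is a linear form, so it is bounded by the positive definite form Ψ, and the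
closed sublevel set lies in a box. -/
lemma isCompact_driftFun_le (μ : Fin p → ℝ) {Ψ : Matrix (Fin p) (Fin p) ℝ} (hΨ : Ψ.PosDef)
    (R : ℝ) : IsCompact {b | driftFun μ Ψ b ≤ R} := by
  choose C hC0 hC using fun r : Fin p => hΨ.exists_sq_dotProduct_le (Pi.single r 1)
  refine (isCompact_Icc (a := fun r => μ r - √(C r * R)) (b := fun r => μ r + √(C r * R))
    ).of_isClosed_subset (isClosed_le (continuous_driftFun μ Ψ) continuous_const) fun b hb => ?_
  have h : ∀ r, |b r - μ r| ≤ √(C r * R) := fun r => by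
    refine Real.abs_le_sqrt ?_
    have h1 := hC r (b - μ)
    rw [single_dotProduct, one_mul, Pi.sub_apply] at h1
    exact h1.trans (mul_le_mul_of_nonneg_left hb (hC0 r))
  exact ⟨fun r => by have := (abs_le.1 (h r)).1; simp only; linarith,
    fun r => by have := (abs_le.1 (h r)).2; simp only; linarith⟩

end MultinomialGibbs

/-- Geometric ergodicity of the Gibbs sampler for the multinomial regression model. -/
theorem theorem2 {n p : ℕ} {q : Fin n → ℕ} (m : Fin n → ℕ) (hm : ∀ i, 1 ≤ m i)
    (y : (i : Fin n) → Fin (q i + 1) → ℕ) (hy_sum : ∀ i, ∑ k, y i k = m i)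
    (x : (i : Fin n) → Fin (q i) → Fin p → ℝ)
    (μ : Fin p → ℝ) (Ψ : Matrix (Fin p) (Fin p) ℝ) (hΨ : Ψ.PosDef)
    (hx : (∑ i, ∑ k, Matrix.vecMulVec (x i k) (x i k)).PosDef)
    (hy : ∀ (i : Fin n) (k : Fin (q i)), 1 ≤ y i k.succ) :
    IsGeometricallyErgodic (MultinomialGibbs.gibbsKernel m y x μ Ψ)
      (MultinomialGibbs.posterior m y x μ Ψ) := by
  have := MultinomialGibbs.isMarkovKernel_gibbsKernel hm hy x μ hΨ
  have := MultinomialGibbs.isProbabilityMeasure_posterior m y x μ hΨ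
  obtain ⟨γ, K, hγ0, hγ, hK, hdrift⟩ := MultinomialGibbs.exists_drift_gibbsKernel hm hy x μ hΨ
  exact isGeometricallyErgodic_of_drift_of_minorization _ _
    (MultinomialGibbs.invariant_gibbsKernel_posterior hm hy_sum hy x μ hΨ)
    (MultinomialGibbs.continuous_driftFun μ Ψ).measurable
    (MultinomialGibbs.driftFun_nonneg μ hΨ)
    (MultinomialGibbs.lintegral_driftFun_posterior_ne_top m y x μ hΨ) hγ0 hγ hK hdrift
    fun R => MultinomialGibbs.exists_minorization_gibbsKernel hm hy x μ hΨ
      (MultinomialGibbs.isCompact_driftFun_le μ hΨ R)
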